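/- **Corollary 3.13 (independence of the Batchelor model).** Let $\mathcal M=(M,\mathcal O_{\mathcal M})$ be a smooth finite-dimensional real supermanifold, with tangent sheaf $\mathcal T_{\mathcal M}=\mathrm{Der}_{\mathbb R}(\mathcal O_{\mathcal M})$, and let $\nabla$ be a connection on $\mathcal M$, i.e. an even morphism of sheaves $\nabla:\mathcal T_{\mathcal M}\otimes_{\mathbb R}\mathcal T_{\mathcal M}\to\mathcal T_{\mathcal M}$ that is $\mathcal O_{\mathcal M}$-linear in the first argument and satisfies $\nabla_X(fY)=X(f)Y+(-1)^{|X||f|}f\nabla_XY$ for homogeneous $X$ and $f$. *The reduced connection.* Let $\pi:E\to M$ be a smooth real vector bundle of finite rank and let $\theta:\mathcal O_{\mathcal M}\cong\Gamma_{\Lambda E^*}$ be an isomorphism of sheaves of superalgebras on $M$ (a Batchelor model); identify $\mathcal O_{\mathcal M}$ with $\Gamma_{\Lambda E^*}$ by $\theta$. Let $\mathcal F=\Gamma_{\mathbb R\oplus E^*}\subset\Gamma_{\Lambda E^*}$, let $pr:\Gamma_{\Lambda E^*}\to\mathcal F$ be the projection that removes all components of degree $\ge 2$, and for $s=s_0+s_1\in\mathcal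 F(V)$, $V\subset M$ open, let $\psi(s)\in C^\infty(\pi^{-1}(V))$ be the function $e\mapsto s_0(\pi(e))+s_1(\pi(e))(e)$. Let $\mathcal L_{\bar 0}(U)$ be the set of even $X\in\mathcal T_{\mathcal M}(U)$ with $X(\mathcal F)\subset\mathcal F$; for such $X$ let $\Psi(X)$ be the smooth vector field on $\pi^{-1}(U)$ with $\Psi(X)(\psi(s))=\psi(X(s))$ for all $s\in\mathcal F(V)$ and all open $V\subset U$. A *reduced connection* of $\nabla$ with respect to $(E,\theta)$ is a smooth affine connection $\nabla^{TE}$ on the manifold $E$ such that $$\big(\nabla^{TE}_{\Psi(X)}\Psi(Y)\big)(\psi(s))=\psi\big(pr((\nabla_XY)(s))\big)$$ for all open $V\subset U\subset M$, $X,Y\in\mathcal L_{\bar 0}(U)$ and $s\in\mathcal F(V)$. *Claim.* For every Batchelor model $(E,\theta)$ of $\mathcal M$ there is exactly one reduced connection $\nabla^{TE}$, and the manifold with connection $(E,\nabla^{TE})$ is well defined up to diffeomorphisms of manifolds with connection that are induced by smooth vector bundle isomorphisms: if $(E_1,\theta_1)$ and $(E_2,\theta_2)$ are two Batchelor models of $\mathcal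 M$ with reduced connections $\nabla^{TE_1}$ and $\nabla^{TE_2}$, then there is a smooth isomorphism of vector bundles $\varphi:E_1\to E_2$ over $\mathrm{id}_M$ with $\varphi_*(\nabla^{TE_1}_XY)=\nabla^{TE_2}_{\varphi_*X}(\varphi_*Y)$ for all vector fields $X,Y$ on $E_1$. In particular, for $E_1=E_2=E$, the manifold with connection $(E,\nabla^{TE})$ does not depend on the chosen isomorphism $\mathcal O_{\mathcal M}\cong\Gamma_{\Lambda E^*}$, up to smooth vector bundle automorphisms of $E\to M$. -/

import Mathlib

open scoped Manifold ContDiff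
open TopologicalSpace Bundle

noncomputable section

namespace Supergeometry

universe u w

/-! ### Sheaves of supercommutative superalgebras and their superderivations -/

/-- A sheaf of supercommutative real superalgebras on a topological space: a sheaf of (unital,
associative) `ℝ`-algebras, with a `ℤ/2`-grading of each algebra of sections that is compatible
with restriction, and with `a b = (-1)^{|a||b|} b a` for homogeneous `a`, `b`. -/
structure SuperalgebraSheaf (M : Type u) [TopologicalSpace M] where
  /-- the underlying sheaf of algebras -/
  sheaf : TopCat.Sheaf (AlgCat.{w} ℝ) (TopCat.of M)
  /-- `parity U 0` and `parity U 1` are the even and the odd sections over `U` -/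
  parity (U : Opens M) : ZMod 2 → Submodule ℝ (sheaf.presheaf.obj (Opposite.op U))
  gradedAlgebra (U : Opens M) : GradedAlgebra (parity U)
  res_mem_parity {U V : Opens M} (h : V ≤ U) (i : ZMod 2)
    (f : sheaf.presheaf.obj (Opposite.op U)) : f ∈ parity U i →
      (sheaf.presheaf.map (CategoryTheory.homOfLE h).op).hom f ∈ parity V i
  supercommutative (U : Opens M) (i j : ZMod 2)
    (a b : sheaf.presheaf.obj (Opposite.op U)) : a ∈ parity U i → b ∈ parity U j →
      a * b = (-1 : ℝ) ^ (i * j).val • (b * a)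

namespace SuperalgebraSheaf

variable {M : Type u} [TopologicalSpace M] (O : SuperalgebraSheaf.{u, w} M)

attribute [instance] SuperalgebraSheaf.gradedAlgebra

/-- The algebra `O(U)` of sections over `U`. -/
abbrev Sec (U : Opens M) : Type w := O.sheaf.presheaf.obj (Opposite.op U)

/-- The restriction `O(U) → O(V)` for `V ⊆ U`. -/
def res {U V : Opens M} (h : V ≤ U) : O.Sec U →ₐ[ℝ] O.Sec V :=
  (O.sheaf.presheaf.map (CategoryTheory.homOfLE h).op).hom

theorem res_res {U V W : Opens M} (h : V ≤ U) (h' : W ≤ V) (f : O.Sec U) :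
    O.res h' (O.res h f) = O.res (h'.trans h) f := by
  have := O.sheaf.presheaf.map_comp (CategoryTheory.homOfLE h).op (CategoryTheory.homOfLE h').op
  exact (congrArg (fun g => AlgCat.Hom.hom g f) this).symm

/-- Families of linear endomorphisms of `O(V)`, one for each open `V ⊆ U`. -/
abbrev LinFamily (U : Opens M) : Type (max u w) :=
  (V : {V : Opens M // V ≤ U}) → (O.Sec V.1 →ₗ[ℝ] O.Sec V.1)

/-- The superderivations of parity `i` of the sheaf `O|_U`: linear maps `X : O(V) → O(V)` for
`V ⊆ U` that commute with restriction, shift the parity by `i`, and satisfy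
`X (f g) = X(f) g + (-1)^{i |f|} f X(g)` for homogeneous `f`. -/
def superDer (U : Opens M) (i : ZMod 2) : Submodule ℝ (O.LinFamily U) where
  carrier := {X |
    (∀ (V W : Opens M) (hV : V ≤ U) (h : W ≤ V) (f : O.Sec V),
      O.res h (X ⟨V, hV⟩ f) = X ⟨W, h.trans hV⟩ (O.res h f)) ∧
    (∀ (V : {V : Opens M // V ≤ U}) (j : ZMod 2) (f : O.Sec V.1), f ∈ O.parity V.1 j →
      X V f ∈ O.parity V.1 (i + j)) ∧
    (∀ (V : {V : Opens M // V ≤ U}) (j : ZMod 2) (f g : O.Sec V.1), f ∈ O.parity V.1 j →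
      X V (f * g) = X V f * g + (-1 : ℝ) ^ (i * j).val • (f * X V g))}
  zero_mem' := by
    refine ⟨fun _ _ _ _ _ => by simp, fun _ _ _ _ => by simp, fun _ _ _ _ _ => by simp⟩
  add_mem' := by
    rintro X Y ⟨hX1, hX2, hX3⟩ ⟨hY1, hY2, hY3⟩
    refine ⟨fun V W hV h f => ?_, fun V j f hf => ?_, fun V j f g hf => ?_⟩
    · simp [hX1, hY1]
    · exact Submodule.add_mem _ (hX2 V j f hf) (hY2 V j f hf)
    · simp only [Pi.add_apply, LinearMap.add_apply, hX3 V j f g hf, hY3 V j f g hf, add_mul,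
        mul_add, smul_add]
      abel
  smul_mem' := by
    rintro c X ⟨hX1, hX2, hX3⟩
    refine ⟨fun V W hV h f => ?_, fun V j f hf => ?_, fun V j f g hf => ?_⟩
    · simp [hX1]
    · exact Submodule.smul_mem _ c (hX2 V j f hf)
    · simp only [Pi.smul_apply, LinearMap.smul_apply, hX3 V j f g hf, smul_add, smul_mul_assoc,
        mul_smul_comm]
      rw [smul_comm]

/-- The sections over `U` of the tangent sheaf `Der_ℝ(O)`, the sum of the even and of the odd
superderivations of `O|_U`. -/
def tangent (U : Opens M) : Submodule ℝ (O.LinFamily U) :=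
  O.superDer U 0 ⊔ O.superDer U 1

/-- Left multiplication of a family of endomorphisms by a superfunction, `(f X)(g) = f X(g)`. -/
def smulFamily {U : Opens M} (f : O.Sec U) (X : O.LinFamily U) : O.LinFamily U :=
  fun V => (LinearMap.mulLeft ℝ (O.res V.2 f)).comp (X V)

theorem smulFamily_mem_superDer {U : Opens M} {i j : ZMod 2} {f : O.Sec U} {X : O.LinFamily U}
    (hf : f ∈ O.parity U i) (hX : X ∈ O.superDer U j) :
    O.smulFamily f X ∈ O.superDer U (i + j) := by
  obtain ⟨h1, h2, h3⟩ := hX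
  have hres : ∀ V : {V : Opens M // V ≤ U}, O.res V.2 f ∈ O.parity V.1 i :=
    fun V => O.res_mem_parity V.2 i f hf
  refine ⟨fun V W hV h g => ?_, fun V k g hg => ?_, fun V k g g' hg => ?_⟩
  · simp [smulFamily, h1, res_res]
  · rw [add_assoc]
    exact SetLike.GradedMul.mul_mem (hres V) (h2 V k g hg)
  · have hc := O.supercommutative V.1 i k _ _ (hres V) hg
    have hs : (-1 : ℝ) ^ ((i + j) * k).val = (-1) ^ (i * k).val * (-1) ^ (j * k).val := by
      have : ∀ i j k : ZMod 2,
          (-1 : ℤ) ^ ((i + j) * k).val = (-1) ^ (i * k).val * (-1) ^ (j * k).val := by decide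
      exact_mod_cast this i j k
    simp only [smulFamily, LinearMap.comp_apply, LinearMap.mulLeft_apply, h3 V k g g' hg, mul_add,
      mul_smul_comm, ← mul_assoc, hs]
    rw [hc, smul_mul_assoc, smul_smul, mul_comm ((-1 : ℝ) ^ (j * k).val)]

theorem smulFamily_mem_tangent {U : Opens M} (f : O.Sec U) {X : O.LinFamily U}
    (hX : X ∈ O.tangent U) : O.smulFamily f X ∈ O.tangent U := by
  have hadd : ∀ (f g : O.Sec U) (X : O.LinFamily U),
      O.smulFamily (f + g) X = O.smulFamily f X + O.smulFamily g X := by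
    intro f g X; funext V; ext a; simp [smulFamily, add_mul]
  have hadd' : ∀ (f : O.Sec U) (X Y : O.LinFamily U),
      O.smulFamily f (X + Y) = O.smulFamily f X + O.smulFamily f Y := by
    intro f X Y; funext V; ext a; simp [smulFamily, mul_add]
  have hle : ∀ i : ZMod 2, O.superDer U i ≤ O.tangent U := by
    intro i
    fin_cases i
    · exact le_sup_left
    · exact le_sup_right
  obtain ⟨X0, h0, X1, h1, rfl⟩ := Submodule.mem_sup.mp hX
  induction f using DirectSum.Decomposition.inductionOn (O.parity U) with
  | zero =>
    have : O.smulFamily 0 (X0 + X1) = 0 := by funext V; ext a; simp [smulFamily]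
    rw [this]; exact Submodule.zero_mem _
  | homogeneous m =>
    rw [hadd']
    exact Submodule.add_mem _ (hle _ (O.smulFamily_mem_superDer m.2 h0))
      (hle _ (O.smulFamily_mem_superDer m.2 h1))
  | add a b ha hb => rw [hadd]; exact Submodule.add_mem _ ha hb

/-- The `O(U)`-module structure of the tangent sheaf. -/
instance {U : Opens M} : SMul (O.Sec U) (O.tangent U) :=
  ⟨fun f X => ⟨O.smulFamily f X.1, O.smulFamily_mem_tangent f X.2⟩⟩

/-- Restriction of superderivations from `U` to `V ⊆ U`. -/
def resTangent {U V : Opens M} (h : V ≤ U) (X : O.tangent U) : O.tangent V :=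
  ⟨fun W => X.1 ⟨W.1, W.2.trans h⟩, by
    obtain ⟨X0, h0, X1, h1, hX⟩ := Submodule.mem_sup.mp X.2
    have key : ∀ (i : ZMod 2) (Y : O.LinFamily U), Y ∈ O.superDer U i →
        (fun W : {W : Opens M // W ≤ V} => Y ⟨W.1, W.2.trans h⟩) ∈ O.superDer V i :=
      fun i Y hY => ⟨fun A B hA hB f => hY.1 A B (hA.trans h) hB f,
        fun A => hY.2.1 ⟨A.1, A.2.trans h⟩, fun A => hY.2.2 ⟨A.1, A.2.trans h⟩⟩
    rw [← hX]
    exact Submodule.add_mem_sup (key 0 X0 h0) (key 1 X1 h1)⟩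

/-- A connection on `O` (an affine superconnection on the tangent sheaf): an even morphism of
sheaves `∇ : T ⊗_ℝ T → T`, written `∇_X Y = nabla U X Y`, which is `O`-linear in `X` and satisfies
`∇_X (f Y) = X(f) Y + (-1)^{|X||f|} f ∇_X Y` for homogeneous `X` and `f`. -/
structure Connection where
  nabla (U : Opens M) : O.tangent U →ₗ[ℝ] O.tangent U →ₗ[ℝ] O.tangent U
  nabla_res {U V : Opens M} (h : V ≤ U) (X Y : O.tangent U) :
    O.resTangent h (nabla U X Y) = nabla V (O.resTangent h X) (O.resTangent h Y)
  nabla_even (U : Opens M) (i j : ZMod 2) (X Y : O.tangent U) :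
    X.1 ∈ O.superDer U i → Y.1 ∈ O.superDer U j → (nabla U X Y).1 ∈ O.superDer U (i + j)
  nabla_smul_left (U : Opens M) (f : O.Sec U) (X Y : O.tangent U) :
    nabla U (f • X) Y = f • nabla U X Y
  nabla_leibniz (U : Opens M) (i j : ZMod 2) (f : O.Sec U) (X Y : O.tangent U) :
    X.1 ∈ O.superDer U i → f ∈ O.parity U j →
      nabla U X (f • Y) = X.1 ⟨U, le_rfl⟩ f • Y + (-1 : ℝ) ^ (i * j).val • (f • nabla U X Y)

end SuperalgebraSheaf

/-! ### The sheaf of sections of the exterior bundle `Λ E*` -/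

section Forms

variable {n : ℕ} {M : Type u} [TopologicalSpace M] [ChartedSpace (EuclideanSpace ℝ (Fin n)) M]
  (F : Type*) [NormedAddCommGroup F] [NormedSpace ℝ F]
  (E : M → Type*) [∀ x, AddCommGroup (E x)] [∀ x, Module ℝ (E x)] [∀ x, TopologicalSpace (E x)]
  [TopologicalSpace (TotalSpace F E)] [FiberBundle F E]

/-- The fibre `Λ E_x*`. -/
abbrev ExtDual {M : Type*} (E : M → Type*) [∀ x, AddCommGroup (E x)] [∀ x, Module ℝ (E x)]
    (x : M) : Type _ :=
  ExteriorAlgebra ℝ (Module.Dual ℝ (E x))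

/-- The sections of `Λ E*` that are on `V` a smooth function or a smooth section of `E*`. A section
`s` of `E*` is smooth on `V` iff the fibrewise linear function `e ↦ s(π e)(e)` is smooth on
`π⁻¹(V)`. -/
def smoothGenerators (V : Set M) : Set ((x : M) → ExtDual E x) :=
  {t | ∃ f : M → ℝ, ContMDiffOn (𝓡 n) 𝓘(ℝ) ∞ f V ∧
      t = fun x => algebraMap ℝ (ExtDual E x) (f x)} ∪
  {t | ∃ s : (x : M) → Module.Dual ℝ (E x),
      ContMDiffOn ((𝓡 n).prod 𝓘(ℝ, F)) 𝓘(ℝ) ∞ (fun e : TotalSpace F E => s e.proj e.2)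
        (TotalSpace.proj ⁻¹' V) ∧
      t = fun x => ExteriorAlgebra.ι ℝ (s x)}

theorem smoothGenerators_mono {V W : Set M} (h : W ⊆ V) :
    smoothGenerators (n := n) F E V ⊆ smoothGenerators (n := n) F E W := by
  rintro t (⟨f, hf, rfl⟩ | ⟨s, hs, rfl⟩)
  · exact Or.inl ⟨f, hf.mono h, rfl⟩
  · exact Or.inr ⟨s, hs.mono (Set.preimage_mono h), rfl⟩

/-- The algebra `Γ_{Λ E*}(U)` of smooth sections of `Λ E*` over `U`, with pointwise operations:
those sections that are locally sums of products of smooth functions and smooth sections of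
`E*`. -/
def forms (U : Opens M) : Subalgebra ℝ ((x : U) → ExtDual E (x : M)) where
  carrier := {a | ∀ x : U, ∃ V : Opens M, (x : M) ∈ V ∧
    ∃ t ∈ Algebra.adjoin ℝ (smoothGenerators (n := n) F E (V : Set M)),
      ∀ y : U, (y : M) ∈ V → a y = t y}
  mul_mem' := by
    intro a b ha hb x
    obtain ⟨V, hV, t, ht, hat⟩ := ha x
    obtain ⟨W, hW, s, hs, hbs⟩ := hb x
    refine ⟨V ⊓ W, ⟨hV, hW⟩, t * s, Subalgebra.mul_mem _ ?_ ?_, fun y hy => ?_⟩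
    · exact Algebra.adjoin_mono (smoothGenerators_mono F E Set.inter_subset_left) ht
    · exact Algebra.adjoin_mono (smoothGenerators_mono F E Set.inter_subset_right) hs
    · simp [hat y hy.1, hbs y hy.2]
  add_mem' := by
    intro a b ha hb x
    obtain ⟨V, hV, t, ht, hat⟩ := ha x
    obtain ⟨W, hW, s, hs, hbs⟩ := hb x
    refine ⟨V ⊓ W, ⟨hV, hW⟩, t + s, Subalgebra.add_mem _ ?_ ?_, fun y hy => ?_⟩
    · exact Algebra.adjoin_mono (smoothGenerators_mono F E Set.inter_subset_left) ht
    · exact Algebra.adjoin_mono (smoothGenerators_mono F E Set.inter_subset_right) hs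
    · simp [hat y hy.1, hbs y hy.2]
  algebraMap_mem' := by
    intro c x
    exact ⟨⊤, trivial, algebraMap ℝ _ c, Subalgebra.algebraMap_mem _ c, fun y _ => rfl⟩

variable {F E}

/-- The subspace `Λ^0 E_x* ⊕ Λ^1 E_x* = ℝ ⊕ E_x*` of the fibre `Λ E_x*`. -/
def affineFibre (E : M → Type*) [∀ x, AddCommGroup (E x)] [∀ x, Module ℝ (E x)] (x : M) :
    Submodule ℝ (ExtDual E x) :=
  LinearMap.range (Algebra.linearMap ℝ (ExtDual E x)) ⊔ LinearMap.range (ExteriorAlgebra.ι ℝ)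

/-- `IsAffine s` says that `s ∈ 𝓕(V) = Γ_{ℝ ⊕ E*}(V)`. -/
def IsAffine {V : Opens M} (s : forms (n := n) F E V) : Prop :=
  ∀ x : V, s.1 x ∈ affineFibre E (x : M)

open Classical in
/-- The function `e ↦ s₀(π e) + s₁(π e)(e)` on `π⁻¹(V) ⊆ E`, where `s₀` and `s₁` are the components
of `s` of degree `0` and `1` (extended by zero outside `π⁻¹(V)`). On `𝓕(V)` this is the
identification `ψ` with the functions on `π⁻¹(V)` that are affine on the fibres; on all of
`Γ_{Λ E*}(V)` it is `ψ ∘ pr` for the projection `pr` to `𝓕(V)`. -/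
def affineFun {V : Opens M} (s : forms (n := n) F E V) (e : TotalSpace F E) : ℝ :=
  if h : e.proj ∈ V then
    ExteriorAlgebra.algebraMapInv (s.1 ⟨e.proj, h⟩) +
      ExteriorAlgebra.ιInv (s.1 ⟨e.proj, h⟩) e.2
  else 0

end Forms

/-! ### Supermanifolds and Batchelor models -/

section Models

variable {n : ℕ} {M : Type u} [TopologicalSpace M] [ChartedSpace (EuclideanSpace ℝ (Fin n)) M]

/-- An isomorphism `O|_U ≅ Γ_{Λ E*}|_U` of sheaves of superalgebras (over the identity of `U`). -/
structure ModelIso (O : SuperalgebraSheaf.{u, w} M)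
    (F : Type*) [NormedAddCommGroup F] [NormedSpace ℝ F]
    (E : M → Type*) [∀ x, AddCommGroup (E x)] [∀ x, Module ℝ (E x)] [∀ x, TopologicalSpace (E x)]
    [TopologicalSpace (TotalSpace F E)] [FiberBundle F E] (U : Opens M) where
  equiv (V : Opens M) (hV : V ≤ U) : O.Sec V ≃ₐ[ℝ] forms (n := n) F E V
  equiv_res {V W : Opens M} (hV : V ≤ U) (h : W ≤ V) (f : O.Sec V) (x : W) :
    (equiv W (h.trans hV) (O.res h f)).1 x = (equiv V hV f).1 ⟨x, h x.2⟩
  equiv_parity (V : Opens M) (hV : V ≤ U) (i : ZMod 2) (f : O.Sec V) : f ∈ O.parity V i →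
    ∀ x : V, (equiv V hV f).1 x ∈
      CliffordAlgebra.evenOdd (0 : QuadraticForm ℝ (Module.Dual ℝ (E (x : M)))) i

/-- A supermanifold of dimension `n|q` with underlying manifold `M`: a sheaf of supercommutative
superalgebras on `M` that is locally isomorphic to `C^∞ ⊗ Λ(ℝ^q)*`, the sheaf of sections of the
exterior bundle of (the dual of) the trivial bundle of rank `q`. -/
structure Supermanifold (n q : ℕ) (M : Type u) [TopologicalSpace M]
    [ChartedSpace (EuclideanSpace ℝ (Fin n)) M] extends SuperalgebraSheaf.{u, w} M where
  exists_local_model (x : M) : ∃ U : Opens M, x ∈ U ∧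
    Nonempty (ModelIso (n := n) toSuperalgebraSheaf (EuclideanSpace ℝ (Fin q))
      (Bundle.Trivial M (EuclideanSpace ℝ (Fin q))) U)

/-- A Batchelor model of `O`: an isomorphism `O ≅ Γ_{Λ E*}` of sheaves of superalgebras. -/
abbrev BatchelorModel (O : SuperalgebraSheaf.{u, w} M)
    (F : Type*) [NormedAddCommGroup F] [NormedSpace ℝ F]
    (E : M → Type*) [∀ x, AddCommGroup (E x)] [∀ x, Module ℝ (E x)] [∀ x, TopologicalSpace (E x)]
    [TopologicalSpace (TotalSpace F E)] [FiberBundle F E] :=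
  ModelIso (n := n) O F E ⊤

end Models

/-! ### The reduced connection on the total space of `E` -/

section Reduction

variable {n : ℕ} {M : Type u} [TopologicalSpace M] [ChartedSpace (EuclideanSpace ℝ (Fin n)) M]
  {F : Type*} [NormedAddCommGroup F] [NormedSpace ℝ F]
  {E : M → Type*} [∀ x, AddCommGroup (E x)] [∀ x, Module ℝ (E x)] [∀ x, TopologicalSpace (E x)]
  [TopologicalSpace (TotalSpace F E)] [FiberBundle F E]
  {O : SuperalgebraSheaf.{u, w} M}

/-- The action on `Γ_{Λ E*}(V)`, `V ⊆ U`, of a superderivation `X` of `O|_U`, transported along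
the Batchelor model `θ`. -/
def ModelIso.act (θ : BatchelorModel (n := n) O F E) {U : Opens M} (X : O.tangent U)
    {V : Opens M} (hV : V ≤ U) (s : forms (n := n) F E V) : forms (n := n) F E V :=
  θ.equiv V le_top (X.1 ⟨V, hV⟩ ((θ.equiv V le_top).symm s))

/-- A vector field on the manifold `E`; only its values over the open set under consideration
matter. -/
abbrev VField (n : ℕ) {M : Type u} [TopologicalSpace M]
    [ChartedSpace (EuclideanSpace ℝ (Fin n)) M] (F : Type*) [NormedAddCommGroup F]
    [NormedSpace ℝ F] (E : M → Type*) [∀ x, TopologicalSpace (E x)]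
    [TopologicalSpace (TotalSpace F E)] [FiberBundle F E] :=
  (e : TotalSpace F E) → TangentSpace ((𝓡 n).prod 𝓘(ℝ, F)) e

variable [IsManifold (𝓡 n) ∞ M] [VectorBundle ℝ F E] [ContMDiffVectorBundle ∞ F E (𝓡 n)]

/-- `Corresponds θ X X'` says that, in the model `θ`, the superderivation `X` lies in `𝓛_0(U)`, i.e.
it is even and preserves `𝓕`, and that `X'` is, on `π⁻¹(U)`, the smooth vector field `Ψ(X)`, i.e.
`X'(ψ(s)) = ψ(X(s))` for all `s ∈ 𝓕(V)`, `V ⊆ U`. -/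
structure Corresponds (θ : BatchelorModel (n := n) O F E) {U : Opens M} (X : O.tangent U)
    (X' : VField n F E) : Prop where
  even : X.1 ∈ O.superDer U 0
  preserves : ∀ (V : Opens M) (hV : V ≤ U) (s : forms (n := n) F E V),
    IsAffine s → IsAffine (θ.act X hV s)
  smooth : ContMDiffOn ((𝓡 n).prod 𝓘(ℝ, F)) ((𝓡 n).prod 𝓘(ℝ, F)).tangent ∞
    (fun e => (⟨e, X' e⟩ : TangentBundle ((𝓡 n).prod 𝓘(ℝ, F)) (TotalSpace F E)))
    (TotalSpace.proj ⁻¹' (U : Set M))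
  conj : ∀ (V : Opens M) (hV : V ≤ U) (s : forms (n := n) F E V), IsAffine s →
    ∀ e : TotalSpace F E, e.proj ∈ V →
      mvfderiv ((𝓡 n).prod 𝓘(ℝ, F)) (affineFun s) e (X' e) = affineFun (θ.act X hV s) e

/-- Affine connections on the manifold `E`; `∇_{X'} Y'` at `e` is `D Y' e (X' e)`. -/
abbrev AffineConnection (n : ℕ) {M : Type u} [TopologicalSpace M]
    [ChartedSpace (EuclideanSpace ℝ (Fin n)) M] [IsManifold (𝓡 n) ∞ M]
    (F : Type*) [NormedAddCommGroup F] [NormedSpace ℝ F]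
    (E : M → Type*) [∀ x, AddCommGroup (E x)] [∀ x, Module ℝ (E x)] [∀ x, TopologicalSpace (E x)]
    [TopologicalSpace (TotalSpace F E)] [FiberBundle F E] [VectorBundle ℝ F E]
    [ContMDiffVectorBundle ∞ F E (𝓡 n)] :=
  CovariantDerivative ((𝓡 n).prod 𝓘(ℝ, F)) (EuclideanSpace ℝ (Fin n) × F)
    (TangentSpace ((𝓡 n).prod 𝓘(ℝ, F)) : TotalSpace F E → Type _)

/-- `IsReduced θ D C` says that the smooth connection `C` on the manifold `E` is the reduction
`∇^{TE}` of the connection `∇ = D` with respect to the Batchelor model `θ`: on `𝓛'_0 = Ψ(𝓛_0)` it is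
`∇^{TE}_{X'} Y' = Ψ(p(∇_X Y))` for `X' = Ψ(X)`, `Y' = Ψ(Y)`, where `p(Z) = pr ∘ Z|_𝓕`. As
`𝓛'_0` determines a connection on `E`, this determines `C`. -/
structure IsReduced (θ : BatchelorModel (n := n) O F E) (D : O.Connection)
    (C : AffineConnection n F E) : Prop where
  smooth : CovariantDerivative.ContMDiffCovariantDerivative C ∞
  reduces : ∀ (U : Opens M) (X Y : O.tangent U) (X' Y' : VField n F E),
    Corresponds θ X X' → Corresponds θ Y Y' →
      ∀ (V : Opens M) (hV : V ≤ U) (s : forms (n := n) F E V), IsAffine s →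
        ∀ e : TotalSpace F E, e.proj ∈ V →
          mvfderiv ((𝓡 n).prod 𝓘(ℝ, F)) (affineFun s) e (C Y' e (X' e)) =
            affineFun (θ.act (D.nabla U X Y) hV s) e

/-- Two connections on the manifold `E` are the same if they agree on differentiable vector
fields (their values on other fields are irrelevant). -/
def SameConnection (C C' : AffineConnection n F E) : Prop :=
  ∀ (Y : VField n F E) (e : TotalSpace F E),
    MDifferentiableAt ((𝓡 n).prod 𝓘(ℝ, F)) ((𝓡 n).prod 𝓘(ℝ, F)).tangent
      (fun e => (⟨e, Y e⟩ : TangentBundle ((𝓡 n).prod 𝓘(ℝ, F)) (TotalSpace F E))) e →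
    C Y e = C' Y e

variable {F₂ : Type*} [NormedAddCommGroup F₂] [NormedSpace ℝ F₂]
  {E₂ : M → Type*} [∀ x, AddCommGroup (E₂ x)] [∀ x, Module ℝ (E₂ x)]
  [∀ x, TopologicalSpace (E₂ x)] [TopologicalSpace (TotalSpace F₂ E₂)] [FiberBundle F₂ E₂]
  [VectorBundle ℝ F₂ E₂] [ContMDiffVectorBundle ∞ F₂ E₂ (𝓡 n)]

/-- `φ : (E, C) → (E₂, C₂)` is a diffeomorphism of manifolds with connection:
`φ_* ∘ C = C₂ ∘ (φ_* ⊗ φ_*)`. -/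
def PreservesConnection
    (φ : TotalSpace F E ≃ₘ⟮(𝓡 n).prod 𝓘(ℝ, F), (𝓡 n).prod 𝓘(ℝ, F₂)⟯ TotalSpace F₂ E₂)
    (C : AffineConnection n F E) (C₂ : AffineConnection n F₂ E₂) : Prop :=
  ∀ (Y : VField n F E) (Y₂ : VField n F₂ E₂),
    (∀ e, Y₂ (φ e) = mfderiv ((𝓡 n).prod 𝓘(ℝ, F)) ((𝓡 n).prod 𝓘(ℝ, F₂)) φ e (Y e)) →
    ∀ e : TotalSpace F E,
      MDifferentiableAt ((𝓡 n).prod 𝓘(ℝ, F)) ((𝓡 n).prod 𝓘(ℝ, F)).tangent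
        (fun e => (⟨e, Y e⟩ : TangentBundle ((𝓡 n).prod 𝓘(ℝ, F)) (TotalSpace F E))) e →
      ∀ v : TangentSpace ((𝓡 n).prod 𝓘(ℝ, F)) e,
        mfderiv ((𝓡 n).prod 𝓘(ℝ, F)) ((𝓡 n).prod 𝓘(ℝ, F₂)) φ e (C Y e v) =
          C₂ Y₂ (φ e) (mfderiv ((𝓡 n).prod 𝓘(ℝ, F)) ((𝓡 n).prod 𝓘(ℝ, F₂)) φ e v)

/-- `φ` is an isomorphism of vector bundles over the identity of `M`: it maps `E_x` to `(E₂)_x` by a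
linear isomorphism, for every `x`. -/
def IsBundleIso
    (φ : TotalSpace F E ≃ₘ⟮(𝓡 n).prod 𝓘(ℝ, F), (𝓡 n).prod 𝓘(ℝ, F₂)⟯ TotalSpace F₂ E₂) : Prop :=
  ∃ L : (x : M) → E x ≃ₗ[ℝ] E₂ x, ∀ e, φ e = ⟨e.proj, L e.proj e.2⟩

end Reduction

end Supergeometry

end

/-! Write `val f` for the degree 0 component of a section `f` of `O`, read in a Batchelor model, and
`psi f` for the function `f₀ + f₁` on `E`, which is affine on the fibres. Both are defined for every
section, not only for those in `𝓕`, and both ignore components of degree at least two. The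
projection to `ℝ ⊕ E*` is multiplicative onto a square-zero extension. Hence `ψ(f g) = ψ(f) ψ(g)`
for even `f`, and `ψ(f g) = ψ(f) val(g)` for odd `f`.

Existence. Let `c_k` be supercoordinates with coordinate derivations `∂_k`. A superderivation is `X
= ∑ X(c_k) ∂_k`, because one that kills the coordinates is zero (`superDer_eq_zero`, by Hadamard's
lemma). For even `X` and `Y` the Leibniz rule gives `(∇_X Y)(c_κ) = X(Y c_κ) + ∑ Y(c_ν) X(c_μ)
Γ_{μν}^κ`. Applying `ψ` turns this into the classical formula for a connection in the coordinates
`z_k = ψ(c_k)` of `E`. Its Christoffel symbols `redChristoffel` are smooth and do not depend on `X`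
and `Y`. This is `mvfderiv_psi_christoffelCov`.

Uniqueness. The derivations `∂_i` (even coordinates) and `c_a ∂_a` (odd coordinates) lie in `𝓛_0`
and correspond to the fields `∂/∂z_i` and `z_a ∂/∂z_a`. The difference of two reduced connections is
a tensor that vanishes on pairs of these fields, hence on coordinate fields wherever the relevant
odd `z_a` are nonzero. Such points are dense and the tensor is continuous, so it vanishes
(`eq_christoffelCov`). The same argument shows that the local connection does not depend on the
coordinates, so the local connections agree on overlaps and define a global one.

Independence. `val` is the same in all models: a function that does not vanish at a point is
invertible near it. A point `e` of `E₁` defines the functional `f ↦ ψ₁(f)(e)`. It is determined by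
`val` and by its linear restriction to constant odd generators, so it is also given by a point of
`E₂` over the same base point. The resulting map `φ` satisfies `ψ₂(f) ∘ φ = ψ₁(f)` for all `f`, and
this makes it a smooth bundle isomorphism. Supercoordinates of the first model, although in general
not affine for the second, therefore yield the coordinates `z ∘ φ⁻¹` on `E₂` with the same
Christoffel symbols. Since the reduced connection may be computed in any such coordinates, `φ`
preserves it. -/

set_option linter.unusedSectionVars false

noncomputable section

namespace Supergeometry

universe u w

/-! ### Exterior algebras: components of degree 0 and 1, parity, contraction. -/

section ExteriorAlgebraFacts

variable {V : Type*} [AddCommGroup V] [Module ℝ V] {V' : Type*} [AddCommGroup V'] [Module ℝ V']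

open ExteriorAlgebra in
theorem algebraMapInv_and_ιInv_mul (a b : ExteriorAlgebra ℝ V) :
    ιInv (a * b) = algebraMapInv a • ιInv b + algebraMapInv b • ιInv a := by
  -- `ιInv` is the second component of the algebra map `toTrivSqZeroExt`, so the formula is the
  -- product rule of the square-zero extension. That extension needs a right module structure on
  -- `V`.
  let : Module ℝᵐᵒᵖ V := Module.compHom _ ((RingHom.id ℝ).fromOpposite mul_comm)
  have : IsCentralScalar ℝ V := ⟨fun r m => rfl⟩
  have key : ∀ x : ExteriorAlgebra ℝ V,
      TrivSqZeroExt.fst (toTrivSqZeroExt x) = algebraMapInv x := by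
    intro x
    have : (TrivSqZeroExt.fstHom ℝ ℝ V).comp toTrivSqZeroExt = (algebraMapInv (R := ℝ) (M := V)) := by
      apply ExteriorAlgebra.hom_ext
      ext m
      simp [algebraMapInv]
    exact DFunLike.congr_fun this x
  change TrivSqZeroExt.snd (toTrivSqZeroExt (a * b)) = algebraMapInv a •
    TrivSqZeroExt.snd (toTrivSqZeroExt b) + algebraMapInv b • TrivSqZeroExt.snd (toTrivSqZeroExt a)
  rw [map_mul, TrivSqZeroExt.snd_mul, key, key]
  rfl

theorem ιInv_mul (a b : ExteriorAlgebra ℝ V) :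
    ExteriorAlgebra.ιInv (a * b) = ExteriorAlgebra.algebraMapInv a • ExteriorAlgebra.ιInv b +
      ExteriorAlgebra.algebraMapInv b • ExteriorAlgebra.ιInv a :=
  algebraMapInv_and_ιInv_mul a b

@[simp]
theorem algebraMapInv_algebraMap (r : ℝ) :
    ExteriorAlgebra.algebraMapInv (algebraMap ℝ (ExteriorAlgebra ℝ V) r) = r :=
  ExteriorAlgebra.algebraMap_leftInverse V r

@[simp]
theorem algebraMapInv_ι (v : V) :
    ExteriorAlgebra.algebraMapInv (ExteriorAlgebra.ι ℝ v) = 0 := by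
  simp [ExteriorAlgebra.algebraMapInv]

@[simp]
theorem ιInv_ι (v : V) : ExteriorAlgebra.ιInv (ExteriorAlgebra.ι ℝ v) = v :=
  ExteriorAlgebra.ι_leftInverse v

@[simp]
theorem ιInv_one : ExteriorAlgebra.ιInv (1 : ExteriorAlgebra ℝ V) = 0 := by
  have h := ιInv_mul (1 : ExteriorAlgebra ℝ V) 1
  simpa using h

@[simp]
theorem ιInv_algebraMap (r : ℝ) :
    ExteriorAlgebra.ιInv (algebraMap ℝ (ExteriorAlgebra ℝ V) r) = 0 := by
  rw [Algebra.algebraMap_eq_smul_one, map_smul, ιInv_one, smul_zero]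

/-- The submodule of even or odd elements of the exterior algebra. -/
abbrev extParity (V : Type*) [AddCommGroup V] [Module ℝ V] (i : ZMod 2) :
    Submodule ℝ (ExteriorAlgebra ℝ V) :=
  CliffordAlgebra.evenOdd (0 : QuadraticForm ℝ V) i

/-- An even element is a sum of a scalar and of products with at least two vector factors, and by
`ιInv_mul` such products have no component of degree one. -/
theorem ιInv_of_even {a : ExteriorAlgebra ℝ V} (ha : a ∈ extParity V 0) :
    ExteriorAlgebra.ιInv a = 0 := by
  induction a, ha using CliffordAlgebra.even_induction with
  | algebraMap r => exact ιInv_algebraMap r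
  | add x y hx hy h1 h2 => rw [map_add, h1, h2, add_zero]
  | ι_mul_ι_mul m₁ m₂ x hx h =>
    have h0 : ∀ m : V, ExteriorAlgebra.algebraMapInv (CliffordAlgebra.ι (0 : QuadraticForm ℝ V) m) = 0 :=
      algebraMapInv_ι
    have e := ιInv_mul (V := V) (CliffordAlgebra.ι (0 : QuadraticForm ℝ V) m₁)
      (CliffordAlgebra.ι (0 : QuadraticForm ℝ V) m₂ * x)
    rw [mul_assoc]
    refine e.trans ?_
    rw [h0, map_mul ExteriorAlgebra.algebraMapInv, h0]
    simp

theorem algebraMapInv_of_odd {a : ExteriorAlgebra ℝ V} (ha : a ∈ extParity V 1) :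
    ExteriorAlgebra.algebraMapInv a = 0 := by
  have h0 : ∀ m : V, ExteriorAlgebra.algebraMapInv (CliffordAlgebra.ι (0 : QuadraticForm ℝ V) m) = 0 :=
      algebraMapInv_ι
  induction a, ha using CliffordAlgebra.odd_induction with
  | ι r => exact h0 r
  | add x y hx hy h1 h2 => rw [map_add, h1, h2, add_zero]
  | ι_mul_ι_mul m₁ m₂ x hx h =>
    rw [map_mul, map_mul, h0]
    simp

theorem mul_mem_extParity {i j : ZMod 2} {a b : ExteriorAlgebra ℝ V} (ha : a ∈ extParity V i)
    (hb : b ∈ extParity V j) : a * b ∈ extParity V (i + j) :=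
  (CliffordAlgebra.evenOdd.gradedMonoid (0 : QuadraticForm ℝ V)).mul_mem ha hb

theorem algebraMap_mem_extParity (r : ℝ) : algebraMap ℝ (ExteriorAlgebra ℝ V) r ∈ extParity V 0 := by
  rw [Algebra.algebraMap_eq_smul_one]
  exact Submodule.smul_mem _ _ (CliffordAlgebra.evenOdd.gradedMonoid (0 : QuadraticForm ℝ V)).one_mem

theorem ι_mem_extParity (v : V) : ExteriorAlgebra.ι ℝ v ∈ extParity V 1 :=
  CliffordAlgebra.ι_mem_evenOdd_one _ v

theorem map_mem_extParity (f : V →ₗ[ℝ] V') {i : ZMod 2} {a : ExteriorAlgebra ℝ V}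
    (ha : a ∈ extParity V i) : ExteriorAlgebra.map f a ∈ extParity V' i := by
  have hpair : ∀ (m₁ m₂ : V) (x : ExteriorAlgebra ℝ V) (j : ZMod 2),
      ExteriorAlgebra.map f x ∈ extParity V' j →
      ExteriorAlgebra.map f (ExteriorAlgebra.ι ℝ m₁ * ExteriorAlgebra.ι ℝ m₂ * x) ∈
        extParity V' j := by
    intro m₁ m₂ x j h
    rw [map_mul, map_mul, ExteriorAlgebra.map_apply_ι, ExteriorAlgebra.map_apply_ι]
    have := mul_mem_extParity (mul_mem_extParity (ι_mem_extParity (f m₁)) (ι_mem_extParity (f m₂))) h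
    rwa [show (1 : ZMod 2) + 1 = 0 from rfl, zero_add] at this
  fin_cases i
  · change a ∈ extParity V 0 at ha
    change _ ∈ extParity V' 0
    induction a, ha using CliffordAlgebra.even_induction with
    | algebraMap r =>
      have e := AlgHom.commutes (ExteriorAlgebra.map f) r
      exact e ▸ algebraMap_mem_extParity r
    | add x y hx hy h1 h2 => rw [map_add]; exact add_mem h1 h2
    | ι_mul_ι_mul m₁ m₂ x hx h => exact hpair m₁ m₂ x 0 h
  · change a ∈ extParity V 1 at ha
    change _ ∈ extParity V' 1
    induction a, ha using CliffordAlgebra.odd_induction with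
    | ι r => exact (ExteriorAlgebra.map_apply_ι f r) ▸ ι_mem_extParity (f r)
    | add x y hx hy h1 h2 => rw [map_add]; exact add_mem h1 h2
    | ι_mul_ι_mul m₁ m₂ x hx h => exact hpair m₁ m₂ x 1 h

@[simp]
theorem algebraMapInv_map (f : V →ₗ[ℝ] V') (a : ExteriorAlgebra ℝ V) :
    ExteriorAlgebra.algebraMapInv (ExteriorAlgebra.map f a) = ExteriorAlgebra.algebraMapInv a := by
  have : (ExteriorAlgebra.algebraMapInv).comp (ExteriorAlgebra.map f) =
      (ExteriorAlgebra.algebraMapInv (R := ℝ) (M := V)) := by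
    apply ExteriorAlgebra.hom_ext
    ext m
    simp
  exact DFunLike.congr_fun this a

@[simp]
theorem ιInv_map (f : V →ₗ[ℝ] V') (a : ExteriorAlgebra ℝ V) :
    ExteriorAlgebra.ιInv (ExteriorAlgebra.map f a) = f (ExteriorAlgebra.ιInv a) :=
  DFunLike.congr_fun (ExteriorAlgebra.ιInv_comp_map f) a

/-- Contraction of an element of the exterior algebra with a linear form. -/
def contract (d : Module.Dual ℝ V) : ExteriorAlgebra ℝ V →ₗ[ℝ] ExteriorAlgebra ℝ V :=
  CliffordAlgebra.contractLeft (Q := (0 : QuadraticForm ℝ V)) d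

theorem contract_ι_mul (d : Module.Dual ℝ V) (v : V) (a : ExteriorAlgebra ℝ V) :
    contract d (ExteriorAlgebra.ι ℝ v * a) = d v • a - ExteriorAlgebra.ι ℝ v * contract d a :=
  CliffordAlgebra.contractLeft_ι_mul d v a

@[simp]
theorem contract_algebraMap (d : Module.Dual ℝ V) (r : ℝ) :
    contract d (algebraMap ℝ (ExteriorAlgebra ℝ V) r) = 0 :=
  CliffordAlgebra.contractLeft_algebraMap _ d r

theorem contract_algebraMap_mul (d : Module.Dual ℝ V) (r : ℝ) (a : ExteriorAlgebra ℝ V) :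
    contract d (algebraMap ℝ (ExteriorAlgebra ℝ V) r * a) = algebraMap ℝ _ r * contract d a :=
  CliffordAlgebra.contractLeft_algebraMap_mul d r a

@[simp]
theorem contract_ι (d : Module.Dual ℝ V) (v : V) :
    contract d (ExteriorAlgebra.ι ℝ v) = algebraMap ℝ _ (d v) :=
  CliffordAlgebra.contractLeft_ι _ d v

/-- Contraction is an odd superderivation. Both claims are proved in one induction that adds two
vectors at a time, so that the parity, and with it the sign, stays fixed. -/
theorem contract_mul_aux (d : Module.Dual ℝ V) (i : ZMod 2) (a : ExteriorAlgebra ℝ V)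
    (ha : a ∈ extParity V i) (b : ExteriorAlgebra ℝ V) :
    contract d a ∈ extParity V (1 + i) ∧
      contract d (a * b) = contract d a * b + (-1 : ℝ) ^ i.val • (a * contract d b) := by
  have hι : ∀ v : V, CliffordAlgebra.ι (0 : QuadraticForm ℝ V) v = ExteriorAlgebra.ι ℝ v :=
    fun _ => rfl
  -- The inductive step is the same for both parities; `s` stands for the sign.
  have step : ∀ (m₁ m₂ : V) (x : ExteriorAlgebra ℝ V) (s : ℝ) (j : ZMod 2), x ∈ extParity V j →
      (contract d x ∈ extParity V (1 + j) ∧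
        contract d (x * b) = contract d x * b + s • (x * contract d b)) →
      contract d (ExteriorAlgebra.ι ℝ m₁ * ExteriorAlgebra.ι ℝ m₂ * x) ∈ extParity V (1 + j) ∧
        contract d (ExteriorAlgebra.ι ℝ m₁ * ExteriorAlgebra.ι ℝ m₂ * x * b) =
          contract d (ExteriorAlgebra.ι ℝ m₁ * ExteriorAlgebra.ι ℝ m₂ * x) * b +
          s • (ExteriorAlgebra.ι ℝ m₁ * ExteriorAlgebra.ι ℝ m₂ * x * contract d b) := by
    intro m₁ m₂ x s j hx h
    constructor
    · rw [mul_assoc, contract_ι_mul, contract_ι_mul]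
      have h1 : ∀ m : V, ExteriorAlgebra.ι ℝ m ∈ extParity V 1 :=
        CliffordAlgebra.ι_mem_evenOdd_one _
      refine sub_mem (Submodule.smul_mem _ _ (mul_mem_extParity (h1 _) hx)) ?_
      rw [mul_sub]
      refine sub_mem ?_ ?_
      · rw [mul_smul_comm]
        exact Submodule.smul_mem _ _ (mul_mem_extParity (h1 _) hx)
      · rw [← mul_assoc]
        have := mul_mem_extParity (mul_mem_extParity (h1 m₁) (h1 m₂)) h.1
        have e : (1 : ZMod 2) + 1 + (1 + j) = 1 + j := by
          rw [show (1 : ZMod 2) + 1 = 0 from rfl, zero_add]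
        rwa [e] at this
    · simp only [mul_assoc, contract_ι_mul, h.2]
      simp only [mul_add, mul_sub, sub_mul, smul_mul_assoc, mul_smul_comm, mul_assoc]
      abel
  fin_cases i
  · change a ∈ extParity V 0 at ha
    change contract d a ∈ extParity V (1 + 0) ∧ contract d (a * b) = contract d a * b +
      (-1 : ℝ) ^ (0 : ZMod 2).val • (a * contract d b)
    induction a, ha using CliffordAlgebra.even_induction with
    | algebraMap r =>
      have e : (algebraMap ℝ (CliffordAlgebra (0 : QuadraticForm ℝ V)) r) =
        algebraMap ℝ (ExteriorAlgebra ℝ V) r := rfl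
      rw [e, contract_algebraMap_mul]
      simp
    | add x y hx hy h1 h2 =>
      refine ⟨?_, ?_⟩
      · rw [map_add]; exact add_mem h1.1 h2.1
      · rw [add_mul, map_add, h1.2, h2.2, map_add]
        simp only [add_mul, smul_add]
        abel
    | ι_mul_ι_mul m₁ m₂ x hx h => exact step m₁ m₂ x _ 0 hx h
  · change a ∈ extParity V 1 at ha
    change contract d a ∈ extParity V (1 + 1) ∧ contract d (a * b) = contract d a * b +
      (-1 : ℝ) ^ (1 : ZMod 2).val • (a * contract d b)
    induction a, ha using CliffordAlgebra.odd_induction with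
    | ι r =>
      rw [hι, contract_ι_mul]
      refine ⟨?_, ?_⟩
      · rw [contract_ι]; exact algebraMap_mem_extParity _
      · rw [contract_ι, show (1 : ZMod 2).val = 1 from rfl, Algebra.smul_def]
        simp [sub_eq_add_neg]
    | add x y hx hy h1 h2 =>
      refine ⟨?_, ?_⟩
      · rw [map_add]; exact add_mem h1.1 h2.1
      · rw [add_mul, map_add, h1.2, h2.2, map_add]
        simp only [add_mul, smul_add]
        abel
    | ι_mul_ι_mul m₁ m₂ x hx h => exact step m₁ m₂ x _ 1 hx h

theorem contract_mem (d : Module.Dual ℝ V) {i : ZMod 2} {a : ExteriorAlgebra ℝ V}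
    (ha : a ∈ extParity V i) : contract d a ∈ extParity V (1 + i) :=
  (contract_mul_aux d i a ha 0).1

theorem contract_mul (d : Module.Dual ℝ V) {i : ZMod 2} {a : ExteriorAlgebra ℝ V}
    (ha : a ∈ extParity V i) (b : ExteriorAlgebra ℝ V) :
    contract d (a * b) = contract d a * b + (-1 : ℝ) ^ i.val • (a * contract d b) :=
  (contract_mul_aux d i a ha b).2

/-- This makes the degree 0 component of an odd coordinate derivative equal to the corresponding
coefficient of the degree 1 component, which is the derivative of `f₀ + f₁` along the fibre. -/
theorem algebraMapInv_contract (d : Module.Dual ℝ V) (a : ExteriorAlgebra ℝ V) :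
    ExteriorAlgebra.algebraMapInv (contract d a) = d (ExteriorAlgebra.ιInv a) := by
  induction a using CliffordAlgebra.left_induction with
  | algebraMap r =>
    have e : (algebraMap ℝ (CliffordAlgebra (0 : QuadraticForm ℝ V)) r) =
        algebraMap ℝ (ExteriorAlgebra ℝ V) r := rfl
    rw [e]; simp
  | add x y hx hy => rw [map_add, map_add, hx, hy, map_add, map_add]
  | ι_mul x m h =>
    have hι : CliffordAlgebra.ι (0 : QuadraticForm ℝ V) m = ExteriorAlgebra.ι ℝ m := rfl
    rw [hι, contract_ι_mul, ιInv_mul]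
    simp [mul_comm]

/-- The projection of the exterior algebra onto its components of degree at most one. -/
def affineProj (V : Type*) [AddCommGroup V] [Module ℝ V] :
    ExteriorAlgebra ℝ V →ₗ[ℝ] ExteriorAlgebra ℝ V :=
  Algebra.linearMap ℝ _ ∘ₗ (ExteriorAlgebra.algebraMapInv (R := ℝ) (M := V)).toLinearMap +
    ExteriorAlgebra.ι ℝ ∘ₗ ExteriorAlgebra.ιInv

theorem affineProj_apply (a : ExteriorAlgebra ℝ V) : affineProj V a =
    algebraMap ℝ _ (ExteriorAlgebra.algebraMapInv a) + ExteriorAlgebra.ι ℝ (ExteriorAlgebra.ιInv a) :=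
  rfl

theorem affineProj_eq_self_iff (a : ExteriorAlgebra ℝ V) : affineProj V a = a ↔
    a ∈ LinearMap.range (Algebra.linearMap ℝ (ExteriorAlgebra ℝ V)) ⊔
      LinearMap.range (ExteriorAlgebra.ι ℝ) := by
  constructor
  · intro h
    rw [← h, affineProj_apply]
    exact Submodule.add_mem_sup ⟨_, rfl⟩ ⟨_, rfl⟩
  · intro h
    obtain ⟨_, ⟨r, rfl⟩, _, ⟨v, rfl⟩, rfl⟩ := Submodule.mem_sup.mp h
    simp [affineProj_apply]

theorem map_affineProj (f : V →ₗ[ℝ] V') (a : ExteriorAlgebra ℝ V) :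
    ExteriorAlgebra.map f (affineProj V a) = affineProj V' (ExteriorAlgebra.map f a) := by
  simp [affineProj_apply]

/-- Contraction lowers the degree by one and multiplication by a vector restores it. This is why `ξ
∂/∂ξ` preserves `𝓕`, whereas `∂/∂ξ` is excluded from `𝓛_0` by its parity. -/
theorem ι_mul_contract_affine (d : Module.Dual ℝ V) (v : V) {a : ExteriorAlgebra ℝ V}
    (ha : affineProj V a = a) :
    affineProj V (ExteriorAlgebra.ι ℝ v * contract d a) = ExteriorAlgebra.ι ℝ v * contract d a := by
  rw [← ha, affineProj_apply a, map_add, contract_algebraMap, zero_add, contract_ι,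
    ← Algebra.commutes, ← Algebra.smul_def, map_smul]
  simp [affineProj_apply]

/-- The value at `u` of the affine function `a₀ + a₁` given by the components of degree `0` and `1`
of an element `a` of the exterior algebra of the dual. -/
def affineEval {W : Type*} [AddCommGroup W] [Module ℝ W] (u : W) :
    ExteriorAlgebra ℝ (Module.Dual ℝ W) →ₗ[ℝ] ℝ :=
  (ExteriorAlgebra.algebraMapInv).toLinearMap + (Module.Dual.eval ℝ W u) ∘ₗ ExteriorAlgebra.ιInv

theorem affineEval_apply {W : Type*} [AddCommGroup W] [Module ℝ W] (u : W)
    (a : ExteriorAlgebra ℝ (Module.Dual ℝ W)) :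
    affineEval u a = ExteriorAlgebra.algebraMapInv a + ExteriorAlgebra.ιInv a u := rfl

instance finite_exteriorAlgebra [Module.Finite ℝ V] : Module.Finite ℝ (ExteriorAlgebra ℝ V) := by
  exact Module.Finite.of_basis (Module.finBasis ℝ V).ExteriorAlgebra

end ExteriorAlgebraFacts

/-! ### Smooth parameter integrals and Hadamard's lemma. -/

section Hadamard

open MeasureTheory Set Filter Topology Convolution

/-- The integral is the value at `0` of the convolution of the indicator function of `[-1, 0]` with
a compactly supported function of `t`, and such convolutions depend smoothly on parameters. -/
theorem contDiff_integral_zero_one {E G : Type*} [NormedAddCommGroup E] [NormedSpace ℝ E]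
    [NormedAddCommGroup G] [NormedSpace ℝ G] [CompleteSpace G] {h : E × ℝ → G}
    (hh : ContDiff ℝ ∞ h) : ContDiff ℝ ∞ (fun p => ∫ t in (0 : ℝ)..1, h (p, t)) := by
  -- The bump function is `1` on the ball of radius `2`, which contains `[0, 1]`, so the cutoff does
  -- not change the integral; it supplies the compact support.
  let β : ContDiffBump (0 : ℝ) := ⟨2, 3, by norm_num, by norm_num⟩
  let g : E → ℝ → G := fun p t => β t • h (p, t)
  let f : ℝ → ℝ := (Icc (-1 : ℝ) 0).indicator (fun _ => (1 : ℝ))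
  have hf : LocallyIntegrable f volume :=
    (locallyIntegrable_const (1 : ℝ)).indicator measurableSet_Icc
  have hg : ContDiffOn ℝ ∞ (Function.uncurry g) (univ ×ˢ univ) := by
    apply ContDiff.contDiffOn
    exact (β.contDiff.comp contDiff_snd).smul (hh.comp (contDiff_fst.prodMk contDiff_snd))
  have main := contDiffOn_convolution_right_with_param_comp (n := ⊤) (μ := volume)
    (ContinuousLinearMap.lsmul ℝ ℝ : ℝ →L[ℝ] G →L[ℝ] G) (s := (univ : Set E)) (v := fun _ => (0 : ℝ))
    contDiffOn_const (f := f) (g := g) isOpen_univ (isCompact_closedBall (0 : ℝ) 3)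
    (by
      intro p x _ hx
      have : β x = 0 := β.zero_of_le_dist (by
        rw [Metric.mem_closedBall, not_le] at hx
        exact hx.le)
      simp [g, this]) hf hg
  rw [contDiffOn_univ] at main
  convert main using 2 with p
  rw [convolution_def]
  have e1 : (fun t => (ContinuousLinearMap.lsmul ℝ ℝ : ℝ →L[ℝ] G →L[ℝ] G) (f t) (g p (0 - t))) =
      (Icc (-1 : ℝ) 0).indicator (fun t => h (p, -t)) := by
    funext t
    by_cases ht : t ∈ Icc (-1 : ℝ) 0
    · have : β (-t) = 1 := β.one_of_mem_closedBall (by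
        rw [Metric.mem_closedBall, Real.dist_eq, sub_zero, abs_neg, abs_le]
        change -2 ≤ t ∧ t ≤ 2
        constructor <;> linarith [ht.1, ht.2])
      simp [f, g, ht, this]
    · simp [f, ht]
  rw [e1, integral_indicator measurableSet_Icc, integral_Icc_eq_integral_Ioc,
    ← intervalIntegral.integral_of_le (by norm_num), intervalIntegral.integral_comp_neg
      (fun t => h (p, t))]
  simp

/-- The fundamental theorem of calculus on the segment from `p₀` to `p`; `g` is the mean of the
derivative over the segment. -/
theorem exists_eq_add_apply_sub {E : Type*} [NormedAddCommGroup E] [NormedSpace ℝ E]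
    {f : E → ℝ} (hf : ContDiff ℝ ∞ f) (p₀ : E) : ∃ g : E → (E →L[ℝ] ℝ), ContDiff ℝ ∞ g ∧
      ∀ p, f p = f p₀ + g p (p - p₀) := by
  have hd : ContDiff ℝ ∞ (fderiv ℝ f) := hf.fderiv_right (by simp)
  have hh : ContDiff ℝ ∞ (fun q : E × ℝ => fderiv ℝ f (p₀ + q.2 • (q.1 - p₀))) :=
    hd.comp (contDiff_const.add (contDiff_snd.smul (contDiff_fst.sub contDiff_const)))
  refine ⟨_, contDiff_integral_zero_one hh, fun p => ?_⟩
  have hcont : Continuous (fun t : ℝ => fderiv ℝ f (p₀ + t • (p - p₀))) :=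
    hh.continuous.comp (continuous_const.prodMk continuous_id)
  rw [ContinuousLinearMap.intervalIntegral_apply (hcont.intervalIntegrable _ _)]
  have hder : ∀ t ∈ uIcc (0 : ℝ) 1, HasDerivAt (fun t : ℝ => f (p₀ + t • (p - p₀)))
      (fderiv ℝ f (p₀ + t • (p - p₀)) (p - p₀)) t := by
    intro t _
    have h1 : HasDerivAt (fun t : ℝ => p₀ + t • (p - p₀)) (p - p₀) t := by
      simpa using ((hasDerivAt_id t).smul_const (p - p₀)).const_add p₀
    exact ((hf.differentiable (by simp)) _).hasFDerivAt.comp_hasDerivAt t h1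
  rw [intervalIntegral.integral_eq_sub_of_hasDerivAt hder
    ((hcont.clm_apply continuous_const).intervalIntegrable _ _)]
  simp

/-- **Hadamard's lemma**. -/
theorem hadamard {n : ℕ} {f : EuclideanSpace ℝ (Fin n) → ℝ} {s : Set (EuclideanSpace ℝ (Fin n))}
    (hs : IsOpen s) (hf : ContDiffOn ℝ ∞ f s) {p₀ : EuclideanSpace ℝ (Fin n)} (hp₀ : p₀ ∈ s) :
    ∃ t ⊆ s, IsOpen t ∧ p₀ ∈ t ∧ ∃ g : Fin n → EuclideanSpace ℝ (Fin n) → ℝ,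
      (∀ i, ContDiff ℝ ∞ (g i)) ∧ ∀ p ∈ t, f p = f p₀ + ∑ i, (p i - p₀ i) * g i p := by
  obtain ⟨r, hr, hrs⟩ := Metric.isOpen_iff.mp hs p₀ hp₀
  -- The support of `ρ` lies in `s`, so `ρ f` is smooth everywhere; it equals `f` on the ball of
  -- radius `r / 4`, where the conclusion is drawn.
  let ρ : ContDiffBump p₀ := ⟨r / 4, r / 2, by positivity, by linarith⟩
  have hcd : ContDiff ℝ ∞ (fun p => ρ p * f p) := by
    rw [contDiff_iff_contDiffAt]
    intro p
    by_cases hp : p ∈ s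
    · exact ρ.contDiff.contDiffAt.mul (hf.contDiffAt (hs.mem_nhds hp))
    · have hp' : p ∉ tsupport ρ := by
        rw [ρ.tsupport_eq]
        intro h
        apply hp (hrs _)
        rw [Metric.mem_closedBall] at h
        rw [Metric.mem_ball]
        change dist p p₀ ≤ r / 2 at h
        linarith
      have : (fun p => ρ p * f p) =ᶠ[𝓝 p] fun _ => 0 := by
        filter_upwards [notMem_tsupport_iff_eventuallyEq.mp hp'] with q hq
        simp [hq]
      exact contDiffAt_const.congr_of_eventuallyEq this
  obtain ⟨g, hg, hfg⟩ := exists_eq_add_apply_sub hcd p₀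
  refine ⟨Metric.ball p₀ (r / 4), fun p hp => hrs (Metric.ball_subset_ball (by linarith) hp),
    Metric.isOpen_ball, Metric.mem_ball_self (by positivity),
    fun i p => g p (EuclideanSpace.single i 1),
    fun i => hg.clm_apply contDiff_const, fun p hp => ?_⟩
  have h1 : ∀ q ∈ Metric.ball p₀ (r / 4), ρ q = 1 := fun q hq =>
    ρ.one_of_mem_closedBall (Metric.ball_subset_closedBall hq)
  have h2 := hfg p
  simp only [h1 p hp, h1 p₀ (Metric.mem_ball_self (by positivity)), one_mul] at h2
  rw [h2]
  congr 1
  have h3 : p - p₀ = ∑ i, (p i - p₀ i) • EuclideanSpace.single i (1 : ℝ) := by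
    ext j
    simp [Finset.sum_apply, Pi.single_apply]
  conv_lhs => rw [h3, map_sum]
  simp

end Hadamard

/-! ### Derivatives of functions in the constant directions of a chart. -/

section DirectionalDerivative

variable {n : ℕ} {M : Type u} [TopologicalSpace M] [ChartedSpace (EuclideanSpace ℝ (Fin n)) M]

/-- The derivative of a function on a manifold in a constant direction of a chart. -/
def dirDeriv (c : OpenPartialHomeomorph M (EuclideanSpace ℝ (Fin n))) (v : EuclideanSpace ℝ (Fin n))
    (g : M → ℝ) (y : M) : ℝ :=
  fderiv ℝ (g ∘ c.symm) (c y) v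

variable {c : OpenPartialHomeomorph M (EuclideanSpace ℝ (Fin n))} {v : EuclideanSpace ℝ (Fin n)}

theorem contDiffOn_comp_chart_symm [IsManifold (𝓡 n) ∞ M]
    (hc : c ∈ IsManifold.maximalAtlas (𝓡 n) ∞ M) {g : M → ℝ} {V : Set M}
    (hg : ContMDiffOn (𝓡 n) 𝓘(ℝ) ∞ g V) : ContDiffOn ℝ ∞ (g ∘ c.symm) (c.target ∩ c.symm ⁻¹' V) := by
  rw [← contMDiffOn_iff_contDiffOn]
  exact hg.comp ((contMDiffOn_symm_of_mem_maximalAtlas hc).mono Set.inter_subset_left)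
    fun x hx => hx.2

theorem contMDiffOn_comp_chart [IsManifold (𝓡 n) ∞ M]
    (hc : c ∈ IsManifold.maximalAtlas (𝓡 n) ∞ M) {h : EuclideanSpace ℝ (Fin n) → ℝ}
    {V : Set M} {W : Set (EuclideanSpace ℝ (Fin n))} (hV : V ⊆ c.source)
    (hh : ContDiffOn ℝ ∞ h W) (hVW : ∀ y ∈ V, c y ∈ W) :
    ContMDiffOn (𝓡 n) 𝓘(ℝ) ∞ (fun y => h (c y)) V := by
  rw [← contMDiffOn_iff_contDiffOn] at hh
  exact hh.comp ((contMDiffOn_of_mem_maximalAtlas hc).mono hV) hVW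

theorem isOpen_chart_target_inter {V : Set M} (hV : IsOpen V) :
    IsOpen (c.target ∩ c.symm ⁻¹' V) :=
  c.isOpen_inter_preimage_symm hV

theorem chart_mem_target_inter {V : Set M} (hV : V ⊆ c.source) {y : M} (hy : y ∈ V) :
    c y ∈ c.target ∩ c.symm ⁻¹' V :=
  ⟨c.map_source (hV hy), by simpa [c.left_inv (hV hy)] using hy⟩

theorem differentiableAt_comp_chart_symm [IsManifold (𝓡 n) ∞ M]
    (hc : c ∈ IsManifold.maximalAtlas (𝓡 n) ∞ M) {g : M → ℝ} {V : Set M} (hV : IsOpen V)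
    (hVc : V ⊆ c.source) (hg : ContMDiffOn (𝓡 n) 𝓘(ℝ) ∞ g V) {y : M} (hy : y ∈ V) :
    DifferentiableAt ℝ (g ∘ c.symm) (c y) :=
  ((contDiffOn_comp_chart_symm hc hg).contDiffAt
    ((isOpen_chart_target_inter hV).mem_nhds (chart_mem_target_inter hVc hy))).differentiableAt
    (by simp)

theorem contMDiffOn_dirDeriv [IsManifold (𝓡 n) ∞ M]
    (hc : c ∈ IsManifold.maximalAtlas (𝓡 n) ∞ M) {g : M → ℝ} {V : Set M} (hV : IsOpen V)
    (hVc : V ⊆ c.source) (hg : ContMDiffOn (𝓡 n) 𝓘(ℝ) ∞ g V) :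
    ContMDiffOn (𝓡 n) 𝓘(ℝ) ∞ (dirDeriv c v g) V := by
  have h1 := contDiffOn_comp_chart_symm hc hg
  have h2 : ContDiffOn ℝ ∞ (fun p => fderiv ℝ (g ∘ c.symm) p v) (c.target ∩ c.symm ⁻¹' V) :=
    (h1.fderiv_of_isOpen (isOpen_chart_target_inter hV) (by simp)).clm_apply contDiffOn_const
  exact contMDiffOn_comp_chart hc hVc h2 fun y hy => chart_mem_target_inter hVc hy

theorem dirDeriv_congr {g g' : M → ℝ} {V : Set M} (hV : IsOpen V) (hVc : V ⊆ c.source)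
    (h : ∀ y ∈ V, g y = g' y) {y : M} (hy : y ∈ V) : dirDeriv c v g y = dirDeriv c v g' y := by
  have : (g ∘ c.symm) =ᶠ[nhds (c y)] (g' ∘ c.symm) := by
    filter_upwards [(isOpen_chart_target_inter hV).mem_nhds (chart_mem_target_inter hVc hy)]
      with p hp using h _ hp.2
  rw [dirDeriv, dirDeriv, this.fderiv_eq]

theorem dirDeriv_const (r : ℝ) (y : M) : dirDeriv c v (fun _ => r) y = 0 := by
  have : (fun _ : M => r) ∘ c.symm = fun _ => r := rfl
  simp [dirDeriv, this]

theorem dirDeriv_add [IsManifold (𝓡 n) ∞ M]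
    (hc : c ∈ IsManifold.maximalAtlas (𝓡 n) ∞ M) {g g' : M → ℝ} {V : Set M} (hV : IsOpen V)
    (hVc : V ⊆ c.source) (hg : ContMDiffOn (𝓡 n) 𝓘(ℝ) ∞ g V)
    (hg' : ContMDiffOn (𝓡 n) 𝓘(ℝ) ∞ g' V) {y : M} (hy : y ∈ V) :
    dirDeriv c v (fun y => g y + g' y) y = dirDeriv c v g y + dirDeriv c v g' y := by
  have := fderiv_add (differentiableAt_comp_chart_symm hc hV hVc hg hy)
    (differentiableAt_comp_chart_symm hc hV hVc hg' hy)
  exact DFunLike.congr_fun this v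

theorem dirDeriv_mul [IsManifold (𝓡 n) ∞ M]
    (hc : c ∈ IsManifold.maximalAtlas (𝓡 n) ∞ M) {g g' : M → ℝ} {V : Set M} (hV : IsOpen V)
    (hVc : V ⊆ c.source) (hg : ContMDiffOn (𝓡 n) 𝓘(ℝ) ∞ g V)
    (hg' : ContMDiffOn (𝓡 n) 𝓘(ℝ) ∞ g' V) {y : M} (hy : y ∈ V) :
    dirDeriv c v (fun y => g y * g' y) y = dirDeriv c v g y * g' y + g y * dirDeriv c v g' y := by
  have := fderiv_mul (differentiableAt_comp_chart_symm hc hV hVc hg hy)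
    (differentiableAt_comp_chart_symm hc hV hVc hg' hy)
  refine (DFunLike.congr_fun this v).trans ?_
  simp only [add_apply, smul_apply, Function.comp_apply,
    c.left_inv (hVc hy), smul_eq_mul, dirDeriv]
  ring

theorem dirDeriv_const_mul [IsManifold (𝓡 n) ∞ M]
    (hc : c ∈ IsManifold.maximalAtlas (𝓡 n) ∞ M) {g : M → ℝ} {V : Set M} (hV : IsOpen V)
    (hVc : V ⊆ c.source) (hg : ContMDiffOn (𝓡 n) 𝓘(ℝ) ∞ g V) (r : ℝ) {y : M} (hy : y ∈ V) :
    dirDeriv c v (fun y => r * g y) y = r * dirDeriv c v g y := by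
  rw [dirDeriv_mul hc hV hVc contMDiffOn_const hg hy, dirDeriv_const]
  ring

theorem dirDeriv_sum [IsManifold (𝓡 n) ∞ M]
    (hc : c ∈ IsManifold.maximalAtlas (𝓡 n) ∞ M) {ι : Type*} (s : Finset ι) {g : ι → M → ℝ}
    {V : Set M} (hV : IsOpen V) (hVc : V ⊆ c.source)
    (hg : ∀ i, ContMDiffOn (𝓡 n) 𝓘(ℝ) ∞ (g i) V) {y : M} (hy : y ∈ V) :
    dirDeriv c v (fun y => ∑ i ∈ s, g i y) y = ∑ i ∈ s, dirDeriv c v (g i) y := by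
  classical
  induction s using Finset.induction_on with
  | empty => simpa using dirDeriv_const (c := c) (v := v) 0 y
  | insert a s ha ih =>
    simp only [Finset.sum_insert ha]
    rw [dirDeriv_add hc hV hVc (hg a) (contMDiffOn_finsetSum fun i _ => hg i) hy, ih]

theorem dirDeriv_chart_coord {y : M} (hy : y ∈ c.source) (i : Fin n) :
    dirDeriv c v (fun y => c y i) y = v i := by
  have h : ((fun y => c y i) ∘ c.symm) =ᶠ[nhds (c y)] fun p => p i := by
    filter_upwards [c.open_target.mem_nhds (c.map_source hy)] with p hp
    simp [c.right_inv hp]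
  rw [dirDeriv, h.fderiv_eq]
  have := (EuclideanSpace.proj (𝕜 := ℝ) i).hasFDerivAt (x := c y)
  exact DFunLike.congr_fun this.fderiv v

end DirectionalDerivative

/-! ### Smooth maps to a finite-dimensional algebra and their derivatives. -/

section SmoothSections

variable {n : ℕ} {M : Type u} [TopologicalSpace M] [ChartedSpace (EuclideanSpace ℝ (Fin n)) M]
  {Λ : Type*} [Ring Λ] [Algebra ℝ Λ]

/-- Smoothness on an open set of a map to a (finite-dimensional) algebra, by components. -/
def SmoothComponents (n : ℕ) {M : Type u} [TopologicalSpace M]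
    [ChartedSpace (EuclideanSpace ℝ (Fin n)) M] {Λ : Type*} [Ring Λ] [Algebra ℝ Λ]
    (a : M → Λ) (V : Set M) : Prop :=
  ∀ l : Module.Dual ℝ Λ, ContMDiffOn (𝓡 n) 𝓘(ℝ) ∞ (fun y => l (a y)) V

namespace SmoothComponents

variable {a b : M → Λ} {V : Set M}

theorem congr (ha : SmoothComponents n a V) (h : ∀ y ∈ V, b y = a y) : SmoothComponents n b V :=
  fun l => (ha l).congr fun y hy => by rw [h y hy]

theorem mono (ha : SmoothComponents n a V) {W : Set M} (h : W ⊆ V) : SmoothComponents n a W :=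
  fun l => (ha l).mono h

theorem const (x : Λ) : SmoothComponents n (fun _ : M => x) V :=
  fun _ => contMDiffOn_const

theorem add (ha : SmoothComponents n a V) (hb : SmoothComponents n b V) :
    SmoothComponents n (fun y => a y + b y) V :=
  fun l => ((ha l).add (hb l)).congr fun y _ => map_add l (a y) (b y)

theorem smul {f : M → ℝ} (hf : ContMDiffOn (𝓡 n) 𝓘(ℝ) ∞ f V) (ha : SmoothComponents n a V) :
    SmoothComponents n (fun y => f y • a y) V :=
  fun l => (hf.mul (ha l)).congr fun y _ => map_smul l (f y) (a y)

theorem sum {ι : Type*} (s : Finset ι) {a : ι → M → Λ} (ha : ∀ i ∈ s, SmoothComponents n (a i) V) :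
    SmoothComponents n (fun y => ∑ i ∈ s, a i y) V :=
  fun l => by simpa only [map_sum] using contMDiffOn_finsetSum fun i hi => ha i hi l

theorem comp {Λ' : Type*} [Ring Λ'] [Algebra ℝ Λ'] (T : Λ →ₗ[ℝ] Λ') (ha : SmoothComponents n a V) :
    SmoothComponents n (fun y => T (a y)) V :=
  fun l => ha (l ∘ₗ T)

theorem mul [Module.Finite ℝ Λ] (ha : SmoothComponents n a V) (hb : SmoothComponents n b V) :
    SmoothComponents n (fun y => a y * b y) V := by
  have B := Module.finBasis ℝ Λ
  have h : ∀ y, a y * b y = ∑ i, B.coord i (b y) • (a y * B i) := by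
    intro y
    conv_lhs => rw [← B.sum_repr (b y), Finset.mul_sum]
    simp
  simp only [h]
  exact sum _ fun i _ => smul (hb _) (ha.comp (LinearMap.mulRight ℝ (B i)))

end SmoothComponents

/-- The componentwise derivative of a map to a finite-dimensional algebra in a constant direction
of a chart. -/
def dirDerivComponents [Module.Finite ℝ Λ]
    (c : OpenPartialHomeomorph M (EuclideanSpace ℝ (Fin n))) (v : EuclideanSpace ℝ (Fin n))
    (a : M → Λ) (y : M) : Λ :=
  ∑ i, dirDeriv c v (fun y => (Module.finBasis ℝ Λ).coord i (a y)) y • Module.finBasis ℝ Λ i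

variable {c : OpenPartialHomeomorph M (EuclideanSpace ℝ (Fin n))} {v : EuclideanSpace ℝ (Fin n)}
  [Module.Finite ℝ Λ] [IsManifold (𝓡 n) ∞ M]

/-- The derivative commutes with every linear form, so it does not depend on the chosen basis, and
the rules of calculus below reduce to the scalar case by `dual_ext`. -/
theorem apply_dirDerivComponents (hc : c ∈ IsManifold.maximalAtlas (𝓡 n) ∞ M) {V : Set M}
    (hV : IsOpen V) (hVc : V ⊆ c.source) {a : M → Λ} (ha : SmoothComponents n a V) {y : M}
    (hy : y ∈ V) (l : Module.Dual ℝ Λ) :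
    l (dirDerivComponents c v a y) = dirDeriv c v (fun y => l (a y)) y := by
  let B := Module.finBasis ℝ Λ
  have h : ∀ y, l (a y) = ∑ i, l (B i) * B.coord i (a y) := by
    intro y
    conv_lhs => rw [← B.sum_repr (a y), map_sum]
    simp [mul_comm]
  simp only [h]
  rw [dirDeriv_sum (g := fun i y => l (B i) * B.coord i (a y)) hc _ hV hVc
    (fun i => contMDiffOn_const.mul (ha _)) hy, dirDerivComponents,
    map_sum]
  refine Finset.sum_congr rfl fun i _ => ?_
  rw [dirDeriv_const_mul hc hV hVc (ha _) _ hy, map_smul, smul_eq_mul, mul_comm]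

theorem dual_ext {x y : Λ} (h : ∀ l : Module.Dual ℝ Λ, l x = l y) : x = y := by
  rw [← sub_eq_zero]
  exact (Module.forall_dual_apply_eq_zero_iff ℝ (x - y)).mp fun l => by rw [map_sub, h, sub_self]

theorem smoothComponents_dirDerivComponents (hc : c ∈ IsManifold.maximalAtlas (𝓡 n) ∞ M)
    {V : Set M} (hV : IsOpen V) (hVc : V ⊆ c.source) {a : M → Λ} (ha : SmoothComponents n a V) :
    SmoothComponents n (dirDerivComponents c v a) V :=
  fun l => (contMDiffOn_dirDeriv hc hV hVc (ha l)).congr fun _ hy =>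
    apply_dirDerivComponents hc hV hVc ha hy l

theorem dirDerivComponents_congr {V : Set M}
    (hV : IsOpen V) (hVc : V ⊆ c.source) {a b : M → Λ} (h : ∀ y ∈ V, a y = b y) {y : M}
    (hy : y ∈ V) : dirDerivComponents c v a y = dirDerivComponents c v b y := by
  refine Finset.sum_congr rfl fun i _ => ?_
  rw [dirDeriv_congr hV hVc (fun y hy => by rw [h y hy]) hy]

/-- Linear forms on the quotient by `P` vanish along `a`, hence so do their derivatives. The use is
that differentiation along the base preserves parity. -/
theorem dirDerivComponents_mem (hc : c ∈ IsManifold.maximalAtlas (𝓡 n) ∞ M)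
    {V : Set M} (hV : IsOpen V) (hVc : V ⊆ c.source) {a : M → Λ} (ha : SmoothComponents n a V)
    (P : Submodule ℝ Λ) (hP : ∀ y ∈ V, a y ∈ P) {y : M} (hy : y ∈ V) :
    dirDerivComponents c v a y ∈ P := by
  rw [← Submodule.Quotient.mk_eq_zero P, ← Module.forall_dual_apply_eq_zero_iff ℝ]
  intro l
  have h := apply_dirDerivComponents (v := v) hc hV hVc ha hy (l ∘ₗ P.mkQ)
  refine h.trans ?_
  rw [dirDeriv_congr (g' := fun _ => 0) hV hVc (fun y hy => ?_) hy, dirDeriv_const]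
  simp [(Submodule.Quotient.mk_eq_zero P).mpr (hP y hy)]

theorem dirDerivComponents_add (hc : c ∈ IsManifold.maximalAtlas (𝓡 n) ∞ M)
    {V : Set M} (hV : IsOpen V) (hVc : V ⊆ c.source) {a b : M → Λ} (ha : SmoothComponents n a V)
    (hb : SmoothComponents n b V) {y : M} (hy : y ∈ V) :
    dirDerivComponents c v (fun y => a y + b y) y =
      dirDerivComponents c v a y + dirDerivComponents c v b y := by
  refine dual_ext fun l => ?_
  rw [apply_dirDerivComponents hc hV hVc (ha.add hb) hy, map_add,
    apply_dirDerivComponents hc hV hVc ha hy, apply_dirDerivComponents hc hV hVc hb hy]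
  simp only [map_add]
  exact dirDeriv_add hc hV hVc (ha l) (hb l) hy

theorem dirDerivComponents_smul (hc : c ∈ IsManifold.maximalAtlas (𝓡 n) ∞ M)
    {V : Set M} (hV : IsOpen V) (hVc : V ⊆ c.source) {f : M → ℝ} {a : M → Λ}
    (hf : ContMDiffOn (𝓡 n) 𝓘(ℝ) ∞ f V)
    (ha : SmoothComponents n a V) {y : M} (hy : y ∈ V) :
    dirDerivComponents c v (fun y => f y • a y) y =
      dirDeriv c v f y • a y + f y • dirDerivComponents c v a y := by
  refine dual_ext fun l => ?_
  rw [apply_dirDerivComponents hc hV hVc (ha.smul hf) hy, map_add, map_smul, map_smul,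
    apply_dirDerivComponents hc hV hVc ha hy]
  simp only [map_smul, smul_eq_mul]
  exact dirDeriv_mul hc hV hVc hf (ha l) hy

theorem dirDerivComponents_comp (hc : c ∈ IsManifold.maximalAtlas (𝓡 n) ∞ M)
    {V : Set M} (hV : IsOpen V) (hVc : V ⊆ c.source) {a : M → Λ}
    (ha : SmoothComponents n a V) (T : Λ →ₗ[ℝ] Λ) {y : M} (hy : y ∈ V) :
    dirDerivComponents c v (fun y => T (a y)) y = T (dirDerivComponents c v a y) := by
  refine dual_ext fun l => ?_
  rw [apply_dirDerivComponents hc hV hVc (ha.comp T) hy]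
  exact (apply_dirDerivComponents hc hV hVc ha hy (l ∘ₗ T)).symm

theorem dirDerivComponents_sum (hc : c ∈ IsManifold.maximalAtlas (𝓡 n) ∞ M)
    {V : Set M} (hV : IsOpen V) (hVc : V ⊆ c.source) {ι : Type*} (s : Finset ι) {a : ι → M → Λ}
    (ha : ∀ i, SmoothComponents n (a i) V) {y : M} (hy : y ∈ V) :
    dirDerivComponents c v (fun y => ∑ i ∈ s, a i y) y = ∑ i ∈ s, dirDerivComponents c v (a i) y := by
  refine dual_ext fun l => ?_
  rw [apply_dirDerivComponents hc hV hVc (SmoothComponents.sum s fun i _ => ha i) hy, map_sum]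
  simp only [map_sum]
  rw [dirDeriv_sum hc s hV hVc (fun i => ha i l) hy]
  exact Finset.sum_congr rfl fun i _ => (apply_dirDerivComponents hc hV hVc (ha i) hy l).symm

theorem dirDerivComponents_mul (hc : c ∈ IsManifold.maximalAtlas (𝓡 n) ∞ M)
    {V : Set M} (hV : IsOpen V) (hVc : V ⊆ c.source) {a b : M → Λ} (ha : SmoothComponents n a V)
    (hb : SmoothComponents n b V) {y : M} (hy : y ∈ V) :
    dirDerivComponents c v (fun y => a y * b y) y =
      dirDerivComponents c v a y * b y + a y * dirDerivComponents c v b y := by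
  let B := Module.finBasis ℝ Λ
  have hb' : ∀ y, b y = ∑ i, B.coord i (b y) • B i := fun y => (B.sum_repr (b y)).symm
  have h : ∀ y, a y * b y = ∑ i, B.coord i (b y) • LinearMap.mulRight ℝ (B i) (a y) := by
    intro y
    conv_lhs => rw [hb' y, Finset.mul_sum]
    simp
  have hd : dirDerivComponents c v b y = ∑ i, dirDeriv c v (fun y => B.coord i (b y)) y • B i := rfl
  simp only [h]
  rw [dirDerivComponents_sum hc hV hVc _ (fun i => (ha.comp _).smul (hb _)) hy, hd,
    Finset.mul_sum]
  conv_rhs => rw [hb' y, Finset.mul_sum, ← Finset.sum_add_distrib]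
  refine Finset.sum_congr rfl fun i _ => ?_
  rw [dirDerivComponents_smul hc hV hVc (hb _) (ha.comp _) hy,
    dirDerivComponents_comp hc hV hVc ha _ hy]
  simp [add_comm]

end SmoothSections

/-! ### Local models `C^∞ ⊗ Λ F*` of the structure sheaf and their coordinate derivations. -/

section LocalModels

variable {n : ℕ} {M : Type u} [TopologicalSpace M] [ChartedSpace (EuclideanSpace ℝ (Fin n)) M]
  {F : Type*} [AddCommGroup F] [Module ℝ F]

/-- The exterior algebra of the dual space. -/
abbrev ExtAlg (F : Type*) [AddCommGroup F] [Module ℝ F] : Type _ :=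
  ExteriorAlgebra ℝ (Module.Dual ℝ F)

/-- An identification of the sections of `O` over the open subsets of `U` with the smooth functions
with values in the exterior algebra of the dual of a fixed vector space. The values outside the
open set under consideration do not matter. -/
structure LocalModel (n : ℕ) {M : Type u} [TopologicalSpace M]
    [ChartedSpace (EuclideanSpace ℝ (Fin n)) M] (O : SuperalgebraSheaf.{u, w} M)
    (F : Type*) [AddCommGroup F] [Module ℝ F] (U : Opens M) where
  hat (V : Opens M) : O.Sec V →ₗ[ℝ] (M → ExtAlg F)
  hat_one {V : Opens M} (hV : V ≤ U) {y : M} (hy : y ∈ V) : hat V 1 y = 1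
  hat_mul {V : Opens M} (hV : V ≤ U) (f g : O.Sec V) {y : M} (hy : y ∈ V) :
    hat V (f * g) y = hat V f y * hat V g y
  hat_res {V W : Opens M} (hV : V ≤ U) (h : W ≤ V) (f : O.Sec V) {y : M} (hy : y ∈ W) :
    hat W (O.res h f) y = hat V f y
  hat_smooth {V : Opens M} (hV : V ≤ U) (f : O.Sec V) : SmoothComponents n (hat V f) (V : Set M)
  hat_parity {V : Opens M} (hV : V ≤ U) {i : ZMod 2} {f : O.Sec V} (hf : f ∈ O.parity V i) {y : M}
    (hy : y ∈ V) : hat V f y ∈ extParity (Module.Dual ℝ F) i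
  hat_inj {V : Opens M} (hV : V ≤ U) {f g : O.Sec V} (h : ∀ y ∈ V, hat V f y = hat V g y) : f = g
  exists_hat {V : Opens M} (hV : V ≤ U) {a : M → ExtAlg F} (ha : SmoothComponents n a (V : Set M)) :
    ∃ f : O.Sec V, ∀ y ∈ V, hat V f y = a y

namespace LocalModel

variable {O : SuperalgebraSheaf.{u, w} M} {U : Opens M} (m : LocalModel n O F U)

/-- The section given by a smooth function with values in the exterior algebra. -/
def toSec {V : Opens M} (hV : V ≤ U) (a : M → ExtAlg F) (ha : SmoothComponents n a (V : Set M)) :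
    O.Sec V :=
  (m.exists_hat hV ha).choose

theorem hat_toSec {V : Opens M} (hV : V ≤ U) {a : M → ExtAlg F}
    (ha : SmoothComponents n a (V : Set M)) {y : M} (hy : y ∈ V) : m.hat V (m.toSec hV a ha) y = a y :=
  (m.exists_hat hV ha).choose_spec y hy

-- Parity can be tested on values: the component of `f` of the wrong parity has values of both
-- parities, so these are zero, and sections are determined by their values.
open Classical in
theorem mem_parity {V : Opens M} (hV : V ≤ U) {i : ZMod 2} {f : O.Sec V}
    (hf : ∀ y ∈ V, m.hat V f y ∈ extParity (Module.Dual ℝ F) i) : f ∈ O.parity V i := by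
  have hdisj : ∀ j : ZMod 2, ∀ x : ExtAlg F, x ∈ extParity (Module.Dual ℝ F) j →
      x ∈ extParity (Module.Dual ℝ F) (j + 1) → x = 0 := by
    have h := (CliffordAlgebra.evenOdd_isCompl (0 : QuadraticForm ℝ (Module.Dual ℝ F))).disjoint
    rw [Submodule.disjoint_def] at h
    intro j x h1 h2
    fin_cases j
    · exact h x h1 h2
    · exact h x h2 h1
  obtain ⟨f₀, h₀, f₁, h₁, rfl⟩ : ∃ f₀ ∈ O.parity V i, ∃ f₁ ∈ O.parity V (i + 1), f₀ + f₁ = f := by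
    have hs := DirectSum.sum_support_decompose (O.parity V) f
    have h2 : ((DirectSum.decompose (O.parity V) f i : O.Sec V)) +
        (DirectSum.decompose (O.parity V) f (i + 1) : O.Sec V) = f := by
      have : f = ∑ j : ZMod 2, (DirectSum.decompose (O.parity V) f j : O.Sec V) := by
        conv_lhs => rw [← hs]
        refine Finset.sum_subset (Finset.subset_univ _) fun j _ hj => ?_
        simpa using hj
      have h3 : ∀ (g : ZMod 2 → O.Sec V) (i : ZMod 2), ∑ j : ZMod 2, g j = g i + g (i + 1) := by
        intro g i
        have : (∑ j : ZMod 2, g j) = g 0 + g 1 := Fin.sum_univ_two g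
        rw [this]
        fin_cases i
        · rfl
        · exact add_comm _ _
      rw [h3 _ i] at this
      exact this.symm
    exact ⟨_, SetLike.coe_mem _, _, SetLike.coe_mem _, h2⟩
  have : f₁ = 0 := by
    refine m.hat_inj hV fun y hy => ?_
    have e : m.hat V f₁ y = m.hat V (f₀ + f₁) y - m.hat V f₀ y := by simp
    rw [map_zero, Pi.zero_apply]
    refine hdisj i _ ?_ (m.hat_parity hV h₁ hy)
    rw [e]
    exact sub_mem (hf y hy) (m.hat_parity hV h₀ hy)
  rw [this, add_zero]
  exact h₀

theorem toSec_mem_parity {V : Opens M} (hV : V ≤ U) {a : M → ExtAlg F}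
    (ha : SmoothComponents n a (V : Set M)) {i : ZMod 2}
    (h : ∀ y ∈ V, a y ∈ extParity (Module.Dual ℝ F) i) : m.toSec hV a ha ∈ O.parity V i :=
  m.mem_parity hV fun y hy => by rw [m.hat_toSec hV ha hy]; exact h y hy

end LocalModel

/-- An operator on functions with values in the exterior algebra that is local and a
superderivation of parity `i` on smooth functions. -/
structure IsLocalSuperDer (n : ℕ) {M : Type u} [TopologicalSpace M]
    [ChartedSpace (EuclideanSpace ℝ (Fin n)) M] {F : Type*} [AddCommGroup F] [Module ℝ F]
    (U : Opens M) (i : ZMod 2) (T : (M → ExtAlg F) → (M → ExtAlg F)) : Prop where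
  smooth {V : Opens M} (hV : V ≤ U) {a : M → ExtAlg F} :
    SmoothComponents n a (V : Set M) → SmoothComponents n (T a) (V : Set M)
  congr {V : Opens M} (hV : V ≤ U) {a b : M → ExtAlg F} : (∀ y ∈ V, a y = b y) →
    ∀ y ∈ V, T a y = T b y
  add {V : Opens M} (hV : V ≤ U) {a b : M → ExtAlg F} : SmoothComponents n a (V : Set M) →
    SmoothComponents n b (V : Set M) → ∀ y ∈ V, T (a + b) y = T a y + T b y
  smul {V : Opens M} (hV : V ≤ U) (r : ℝ) {a : M → ExtAlg F} : SmoothComponents n a (V : Set M) →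
    ∀ y ∈ V, T (r • a) y = r • T a y
  parity {V : Opens M} (hV : V ≤ U) {j : ZMod 2} {a : M → ExtAlg F} :
    SmoothComponents n a (V : Set M) → (∀ y ∈ V, a y ∈ extParity (Module.Dual ℝ F) j) →
    ∀ y ∈ V, T a y ∈ extParity (Module.Dual ℝ F) (i + j)
  mul {V : Opens M} (hV : V ≤ U) {j : ZMod 2} {a b : M → ExtAlg F} :
    SmoothComponents n a (V : Set M) → SmoothComponents n b (V : Set M) →
    (∀ y ∈ V, a y ∈ extParity (Module.Dual ℝ F) j) →
    ∀ y ∈ V, T (fun y => a y * b y) y = T a y * b y + (-1 : ℝ) ^ (i * j).val • (a y * T b y)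

theorem isLocalSuperDer_dirDeriv [IsManifold (𝓡 n) ∞ M] [Module.Finite ℝ F] {U : Opens M}
    {c : OpenPartialHomeomorph M (EuclideanSpace ℝ (Fin n))}
    (hc : c ∈ IsManifold.maximalAtlas (𝓡 n) ∞ M) (hU : (U : Set M) ⊆ c.source)
    (v : EuclideanSpace ℝ (Fin n)) :
    IsLocalSuperDer n (F := F) U 0 (dirDerivComponents c v) where
  smooth {V} hV a ha := smoothComponents_dirDerivComponents hc V.2
    (Set.Subset.trans (fun _ hy => hV hy) hU) ha
  congr {V} hV a b h y hy := dirDerivComponents_congr V.2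
    (Set.Subset.trans (fun _ hy => hV hy) hU) h hy
  add {V} hV a b ha hb y hy := dirDerivComponents_add hc V.2
    (Set.Subset.trans (fun _ hy => hV hy) hU) ha hb hy
  smul {V} hV r a ha y hy := by
    refine (dirDerivComponents_smul hc V.2 (Set.Subset.trans (fun _ hy => hV hy) hU)
      (contMDiffOn_const (c := r)) ha hy).trans ?_
    rw [dirDeriv_const, zero_smul, zero_add]
  parity {V} hV j a ha h y hy := by
    rw [zero_add]
    exact dirDerivComponents_mem hc V.2 (Set.Subset.trans (fun _ hy => hV hy) hU) ha _ h hy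
  mul {V} hV j a b ha hb h y hy := by
    rw [dirDerivComponents_mul hc V.2 (Set.Subset.trans (fun _ hy => hV hy) hU) ha hb hy, zero_mul]
    simp

theorem isLocalSuperDer_contract {U : Opens M} (v : F) :
    IsLocalSuperDer n U 1 (fun (a : M → ExtAlg F) y => contract (Module.Dual.eval ℝ F v) (a y)) where
  smooth hV a ha := ha.comp _
  congr hV a b h y hy := by simp only [h y hy]
  add hV a b ha hb y hy := by simp
  smul hV r a ha y hy := by simp
  parity hV j a ha h y hy := contract_mem _ (h y hy)
  mul hV j a b ha hb h y hy := by simp only [one_mul]; exact contract_mul _ (h y hy) _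

namespace LocalModel

variable {O : SuperalgebraSheaf.{u, w} M} {U : Opens M} (m : LocalModel n O F U)

/-- The superderivation of `O` defined by an operator on smooth functions. -/
def derOf {i : ZMod 2} {T : (M → ExtAlg F) → (M → ExtAlg F)} (hT : IsLocalSuperDer n U i T) :
    O.LinFamily U := fun V =>
  { toFun := fun f => m.toSec V.2 (T (m.hat V.1 f)) (hT.smooth V.2 (m.hat_smooth V.2 f))
    map_add' := fun f g => m.hat_inj V.2 fun y hy => by
      simp only [map_add, Pi.add_apply]
      rw [m.hat_toSec _ _ hy, m.hat_toSec _ _ hy, m.hat_toSec _ _ hy]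
      exact hT.add V.2 (m.hat_smooth V.2 f) (m.hat_smooth V.2 g) y hy
    map_smul' := fun r f => m.hat_inj V.2 fun y hy => by
      simp only [map_smul, Pi.smul_apply, RingHom.id_apply]
      rw [m.hat_toSec _ _ hy, m.hat_toSec _ _ hy]
      exact hT.smul V.2 r (m.hat_smooth V.2 f) y hy }

theorem hat_derOf {i : ZMod 2} {T : (M → ExtAlg F) → (M → ExtAlg F)} (hT : IsLocalSuperDer n U i T)
    {V : Opens M} (hV : V ≤ U) (f : O.Sec V) {y : M} (hy : y ∈ V) :
    m.hat V (m.derOf hT ⟨V, hV⟩ f) y = T (m.hat V f) y :=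
  m.hat_toSec hV (hT.smooth hV (m.hat_smooth hV f)) hy

/-- Each law of a superderivation is an identity between values. Locality of `T` matters, because
the values of `hat` outside the open set are arbitrary. -/
theorem derOf_mem {i : ZMod 2} {T : (M → ExtAlg F) → (M → ExtAlg F)}
    (hT : IsLocalSuperDer n U i T) : m.derOf hT ∈ O.superDer U i := by
  refine ⟨fun V W hV h f => ?_, fun V j f hf => ?_, fun V j f g hf => ?_⟩
  · refine m.hat_inj (h.trans hV) fun y hy => ?_
    rw [m.hat_res hV h _ hy, m.hat_derOf hT hV f (h hy), m.hat_derOf hT _ _ hy]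
    exact hT.congr (h.trans hV) (fun y hy => (m.hat_res hV h f hy).symm) y hy
  · refine m.mem_parity V.2 fun y hy => ?_
    rw [m.hat_derOf hT V.2 f hy]
    exact hT.parity V.2 (m.hat_smooth V.2 f) (fun y hy => m.hat_parity V.2 hf hy) y hy
  · refine m.hat_inj V.2 fun y hy => ?_
    simp only [map_add, map_smul, Pi.add_apply, Pi.smul_apply]
    rw [m.hat_mul V.2 _ _ hy, m.hat_mul V.2 _ _ hy, m.hat_derOf hT V.2 _ hy,
      m.hat_derOf hT V.2 _ hy, m.hat_derOf hT V.2 _ hy]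
    rw [hT.congr V.2 (b := fun y => m.hat V.1 f y * m.hat V.1 g y)
      (fun y hy => m.hat_mul V.2 f g hy) y hy]
    exact hT.mul V.2 (m.hat_smooth V.2 f) (m.hat_smooth V.2 g)
      (fun y hy => m.hat_parity V.2 hf hy) y hy

/-! ### Coordinates -/

/-- The index set of the coordinates. -/
abbrev Idx (n : ℕ) (F : Type*) [AddCommGroup F] [Module ℝ F] : Type :=
  Fin n ⊕ Fin (Module.finrank ℝ F)

/-- The parity of the coordinates. -/
def idxParity : Idx n F → ZMod 2 := Sum.elim (fun _ => 0) (fun _ => 1)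

variable [Module.Finite ℝ F]

/-- The coordinates in the exterior algebra: the coordinates of a chart and the generators of the
exterior algebra given by a basis. -/
def coordFun (c : OpenPartialHomeomorph M (EuclideanSpace ℝ (Fin n))) : Idx n F → M → ExtAlg F :=
  Sum.elim (fun i y => algebraMap ℝ _ (c y i))
    (fun a _ => ExteriorAlgebra.ι ℝ ((Module.finBasis ℝ F).coord a))

/-- The partial derivatives in the coordinates. -/
def partialFun (c : OpenPartialHomeomorph M (EuclideanSpace ℝ (Fin n))) :
    Idx n F → (M → ExtAlg F) → (M → ExtAlg F) :=
  Sum.elim (fun i => dirDerivComponents c (EuclideanSpace.single i 1))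
    (fun a f y => contract (Module.Dual.eval ℝ F (Module.finBasis ℝ F a)) (f y))

theorem smooth_algebraMap {f : M → ℝ} {V : Set M} (hf : ContMDiffOn (𝓡 n) 𝓘(ℝ) ∞ f V) :
    SmoothComponents n (fun y => algebraMap ℝ (ExtAlg F) (f y)) V := by
  simp only [Algebra.algebraMap_eq_smul_one]
  exact SmoothComponents.smul hf (SmoothComponents.const _)

variable [IsManifold (𝓡 n) ∞ M] {c : OpenPartialHomeomorph M (EuclideanSpace ℝ (Fin n))}

theorem smooth_chart_coord (hc : c ∈ IsManifold.maximalAtlas (𝓡 n) ∞ M) (i : Fin n) :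
    ContMDiffOn (𝓡 n) 𝓘(ℝ) ∞ (fun y => c y i) c.source :=
  contMDiffOn_comp_chart (h := fun p => p i) (W := Set.univ) hc subset_rfl
    (EuclideanSpace.proj (𝕜 := ℝ) i).contDiff.contDiffOn fun _ _ => trivial

theorem smooth_coordFun (hc : c ∈ IsManifold.maximalAtlas (𝓡 n) ∞ M) (k : Idx n F) :
    SmoothComponents n (coordFun c k) c.source := by
  cases k with
  | inl i => exact smooth_algebraMap (smooth_chart_coord hc i)
  | inr a => exact SmoothComponents.const _

theorem coordFun_mem (k : Idx n F) (y : M) :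
    coordFun c k y ∈ extParity (Module.Dual ℝ F) (idxParity k) := by
  cases k with
  | inl i => exact algebraMap_mem_extParity _
  | inr a => exact ι_mem_extParity _

theorem isLocalSuperDer_partialFun (hc : c ∈ IsManifold.maximalAtlas (𝓡 n) ∞ M)
    (hU : (U : Set M) ⊆ c.source) (k : Idx n F) :
    IsLocalSuperDer n U (idxParity k) (partialFun c k) := by
  cases k with
  | inl i => exact isLocalSuperDer_dirDeriv hc hU _
  | inr a => exact isLocalSuperDer_contract _

theorem dirDerivComponents_const {V : Set M} (hc : c ∈ IsManifold.maximalAtlas (𝓡 n) ∞ M)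
    (hV : IsOpen V) (hVc : V ⊆ c.source) (v : EuclideanSpace ℝ (Fin n)) (x : ExtAlg F) {y : M}
    (hy : y ∈ V) : dirDerivComponents c v (fun _ => x) y = 0 := by
  refine dual_ext fun l => ?_
  rw [apply_dirDerivComponents hc hV hVc (SmoothComponents.const x) hy, dirDeriv_const, map_zero]

/-- Duality of the coordinates and the partial derivatives. In the mixed cases one differentiates a
constant generator along the base or contracts a scalar. -/
theorem partialFun_coordFun (hc : c ∈ IsManifold.maximalAtlas (𝓡 n) ∞ M) (k l : Idx n F) {y : M}
    (hy : y ∈ c.source) : partialFun c k (coordFun c l) y = if k = l then 1 else 0 := by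
  classical
  cases k with
  | inl i =>
    cases l with
    | inl j =>
      have h : (coordFun c (Sum.inl j) : M → ExtAlg F) = fun y => c y j • (1 : ExtAlg F) := by
        funext y; exact Algebra.algebraMap_eq_smul_one _
      change dirDerivComponents c _ (coordFun c (Sum.inl j)) y = _
      rw [h, dirDerivComponents_smul hc c.open_source subset_rfl (smooth_chart_coord hc j)
        (SmoothComponents.const _) hy, dirDeriv_chart_coord hy,
        dirDerivComponents_const hc c.open_source subset_rfl _ _ hy]
      simp [eq_comm]
    | inr b =>
      exact (dirDerivComponents_const hc c.open_source subset_rfl _ _ hy).trans (by simp)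
  | inr a =>
    cases l with
    | inl j => exact (contract_algebraMap _ _).trans (by simp)
    | inr b =>
      refine (contract_ι _ _).trans ?_
      by_cases h : a = b
      · simp [h]
      · have h' : b ≠ a := fun e => h e.symm
        simp [h, h']

/-- The coordinates as sections of `O`. -/
def coord (hc : c ∈ IsManifold.maximalAtlas (𝓡 n) ∞ M) (hU : (U : Set M) ⊆ c.source)
    (k : Idx n F) : O.Sec U :=
  m.toSec le_rfl (coordFun c k) ((smooth_coordFun hc k).mono hU)

theorem hat_coord (hc : c ∈ IsManifold.maximalAtlas (𝓡 n) ∞ M) (hU : (U : Set M) ⊆ c.source)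
    (k : Idx n F) {y : M} (hy : y ∈ U) : m.hat U (m.coord hc hU k) y = coordFun c k y :=
  m.hat_toSec _ _ hy

theorem coord_mem (hc : c ∈ IsManifold.maximalAtlas (𝓡 n) ∞ M) (hU : (U : Set M) ⊆ c.source)
    (k : Idx n F) : m.coord hc hU k ∈ O.parity U (idxParity k) :=
  m.toSec_mem_parity _ _ fun y _ => coordFun_mem k y

/-- The coordinate superderivations. -/
def partialDer (hc : c ∈ IsManifold.maximalAtlas (𝓡 n) ∞ M) (hU : (U : Set M) ⊆ c.source)
    (k : Idx n F) : O.LinFamily U :=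
  m.derOf (isLocalSuperDer_partialFun hc hU k)

theorem partialDer_mem (hc : c ∈ IsManifold.maximalAtlas (𝓡 n) ∞ M) (hU : (U : Set M) ⊆ c.source)
    (k : Idx n F) : m.partialDer hc hU k ∈ O.superDer U (idxParity k) :=
  m.derOf_mem _

theorem hat_partialDer (hc : c ∈ IsManifold.maximalAtlas (𝓡 n) ∞ M) (hU : (U : Set M) ⊆ c.source)
    (k : Idx n F) {V : Opens M} (hV : V ≤ U) (f : O.Sec V) {y : M} (hy : y ∈ V) :
    m.hat V (m.partialDer hc hU k ⟨V, hV⟩ f) y = partialFun c k (m.hat V f) y :=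
  m.hat_derOf _ hV f hy

theorem partialDer_coord (hc : c ∈ IsManifold.maximalAtlas (𝓡 n) ∞ M)
    (hU : (U : Set M) ⊆ c.source) (k l : Idx n F) :
    m.partialDer hc hU k ⟨U, le_rfl⟩ (m.coord hc hU l) = if k = l then 1 else 0 := by
  refine m.hat_inj le_rfl fun y hy => ?_
  rw [m.hat_partialDer hc hU k le_rfl _ hy,
    (isLocalSuperDer_partialFun hc hU k).congr le_rfl (fun y hy => m.hat_coord hc hU l hy) y hy,
    partialFun_coordFun hc k l (hU hy)]
  split_ifs
  · exact (m.hat_one le_rfl hy).symm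
  · simp

end LocalModel

end LocalModels

/-! ### Restriction of superderivations and their values on constants. -/

namespace SuperalgebraSheaf

variable {M : Type u} [TopologicalSpace M] (O : SuperalgebraSheaf.{u, w} M)

/-- Restriction of a family of endomorphisms to a smaller open set. -/
def resFamily {U V : Opens M} (h : V ≤ U) (X : O.LinFamily U) : O.LinFamily V :=
  fun W => X ⟨W.1, W.2.trans h⟩

variable {O}

theorem res_self {U : Opens M} (h : U ≤ U) (f : O.Sec U) : O.res h f = f := by
  have := O.sheaf.presheaf.map_id (Opposite.op U)
  exact congrArg (fun g => AlgCat.Hom.hom g f) this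

theorem resFamily_mem {U V : Opens M} (h : V ≤ U) {i : ZMod 2} {X : O.LinFamily U}
    (hX : X ∈ O.superDer U i) : O.resFamily h X ∈ O.superDer V i :=
  ⟨fun A B hA hB f => hX.1 A B (hA.trans h) hB f,
    fun A => hX.2.1 ⟨A.1, A.2.trans h⟩, fun A => hX.2.2 ⟨A.1, A.2.trans h⟩⟩

theorem superDer_le_tangent {U : Opens M} (i : ZMod 2) : O.superDer U i ≤ O.tangent U := by
  fin_cases i
  · exact le_sup_left
  · exact le_sup_right

theorem one_mem_parity (U : Opens M) : (1 : O.Sec U) ∈ O.parity U 0 :=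
  SetLike.one_mem_graded (O.parity U)

theorem superDer_one {U : Opens M} {i : ZMod 2} {X : O.LinFamily U} (hX : X ∈ O.superDer U i)
    (V : {V : Opens M // V ≤ U}) : X V 1 = 0 := by
  have h := hX.2.2 V 0 1 1 (one_mem_parity V.1)
  simpa using h

theorem superDer_const {U : Opens M} {i : ZMod 2} {X : O.LinFamily U} (hX : X ∈ O.superDer U i)
    (V : {V : Opens M // V ≤ U}) (r : ℝ) : X V (algebraMap ℝ _ r) = 0 := by
  rw [Algebra.algebraMap_eq_smul_one, map_smul, superDer_one hX, smul_zero]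

end SuperalgebraSheaf

open SuperalgebraSheaf

/-! ### Superderivations are determined by their values on coordinates. -/

section Expansion

variable {n : ℕ} {M : Type u} [TopologicalSpace M] [ChartedSpace (EuclideanSpace ℝ (Fin n)) M]
  {F : Type*} [AddCommGroup F] [Module ℝ F]

namespace LocalModel

variable {O : SuperalgebraSheaf.{u, w} M} {U : Opens M} (m : LocalModel n O F U)

/-- The constant section with a given value in the exterior algebra. -/
def constSec {V : Opens M} (hV : V ≤ U) (x : ExtAlg F) : O.Sec V :=
  m.toSec hV (fun _ => x) (SmoothComponents.const x)

theorem hat_constSec {V : Opens M} (hV : V ≤ U) (x : ExtAlg F) {y : M} (hy : y ∈ V) :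
    m.hat V (m.constSec hV x) y = x :=
  m.hat_toSec hV (SmoothComponents.const x) hy

/-- Constant sections form a subalgebra. -/
def constHom {V : Opens M} (hV : V ≤ U) : ExtAlg F →ₐ[ℝ] O.Sec V :=
  AlgHom.ofLinearMap
    { toFun := m.constSec hV
      map_add' := fun a b => m.hat_inj hV fun y hy => by
        rw [map_add, Pi.add_apply, m.hat_constSec hV _ hy, m.hat_constSec hV _ hy,
          m.hat_constSec hV _ hy]
      map_smul' := fun r b => m.hat_inj hV fun y hy => by
        rw [map_smul, Pi.smul_apply, m.hat_constSec hV _ hy, m.hat_constSec hV _ hy,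
          RingHom.id_apply] }
    (m.hat_inj hV fun y hy => (m.hat_constSec hV _ hy).trans (m.hat_one hV hy).symm)
    (fun a b => m.hat_inj hV fun y hy => by
      rw [m.hat_mul hV _ _ hy]
      exact (m.hat_constSec hV _ hy).trans
        (congrArg₂ (· * ·) (m.hat_constSec hV _ hy).symm (m.hat_constSec hV _ hy).symm))

theorem hat_constHom {V : Opens M} (hV : V ≤ U) (x : ExtAlg F) {y : M} (hy : y ∈ V) :
    m.hat V (m.constHom hV x) y = x :=
  m.hat_constSec hV x hy

theorem constHom_mem {V : Opens M} (hV : V ≤ U) {x : ExtAlg F} {i : ZMod 2}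
    (hx : x ∈ extParity (Module.Dual ℝ F) i) : m.constHom hV x ∈ O.parity V i :=
  m.mem_parity hV fun y hy => by rw [m.hat_constHom hV x hy]; exact hx

variable [Module.Finite ℝ F]

/-- The section defined by a smooth function. -/
def funSec {V : Opens M} (hV : V ≤ U) (f : M → ℝ) (hf : ContMDiffOn (𝓡 n) 𝓘(ℝ) ∞ f (V : Set M)) :
    O.Sec V :=
  m.toSec hV (fun y => algebraMap ℝ _ (f y)) (smooth_algebraMap hf)

theorem hat_funSec {V : Opens M} (hV : V ≤ U) {f : M → ℝ}
    (hf : ContMDiffOn (𝓡 n) 𝓘(ℝ) ∞ f (V : Set M)) {y : M} (hy : y ∈ V) :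
    m.hat V (m.funSec hV f hf) y = algebraMap ℝ _ (f y) :=
  m.hat_toSec hV _ hy

theorem funSec_mem {V : Opens M} (hV : V ≤ U) {f : M → ℝ}
    (hf : ContMDiffOn (𝓡 n) 𝓘(ℝ) ∞ f (V : Set M)) : m.funSec hV f hf ∈ O.parity V 0 :=
  m.toSec_mem_parity hV _ fun _ _ => algebraMap_mem_extParity _

/-- The decomposition `C^∞ ⊗ Λ F*` of the sections; statements about `O` thereby reduce to smooth
functions and to constant elements of the exterior algebra. -/
theorem eq_sum_funSec_mul_constHom {V : Opens M} (hV : V ≤ U) (f : O.Sec V) :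
    f = ∑ i, m.funSec hV (fun y => (Module.finBasis ℝ (ExtAlg F)).coord i (m.hat V f y))
      (m.hat_smooth hV f _) * m.constHom hV (Module.finBasis ℝ (ExtAlg F) i) := by
  refine m.hat_inj hV fun y hy => ?_
  rw [map_sum, Finset.sum_apply]
  conv_lhs => rw [← (Module.finBasis ℝ (ExtAlg F)).sum_repr (m.hat V f y)]
  refine Finset.sum_congr rfl fun i _ => ?_
  rw [m.hat_mul hV _ _ hy, m.hat_funSec hV _ hy, m.hat_constHom hV _ hy, Algebra.smul_def]
  rfl

variable [IsManifold (𝓡 n) ∞ M] {c : OpenPartialHomeomorph M (EuclideanSpace ℝ (Fin n))}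

/-- Constant sections are generated by the odd coordinates, so `Z` kills them. For a smooth function
`f` and a point `y`, Hadamard's lemma gives `f = f(y) + ∑ (x_j - y_j) g_j` near `y`; `Z` kills `x_j
- y_j`, and `(x_j - y_j) Z(g_j)` vanishes at `y`. As `y` is arbitrary, `Z f = 0`. No continuity of
`Z` is needed. -/
theorem superDer_eq_zero (hc : c ∈ IsManifold.maximalAtlas (𝓡 n) ∞ M)
    (hU : (U : Set M) ⊆ c.source) {V : Opens M} (hV : V ≤ U) {i : ZMod 2} {Z : O.LinFamily V}
    (hZ : Z ∈ O.superDer V i)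
    (hZc : ∀ k, Z ⟨V, le_rfl⟩ (O.res hV (m.coord hc hU k)) = 0) : Z = 0 := by
  have hcoord : ∀ (W : Opens M) (hW : W ≤ V) k, Z ⟨W, hW⟩ (O.res (hW.trans hV) (m.coord hc hU k)) = 0 := by
    intro W hW k
    rw [← O.res_res hV hW, ← hZ.1 V W le_rfl hW, hZc, map_zero]
  have hconst : ∀ (W : Opens M) (hW : W ≤ V) (x : ExtAlg F),
      Z ⟨W, hW⟩ (m.constHom (hW.trans hV) x) = 0 := by
    intro W hW x
    induction x using CliffordAlgebra.left_induction with
    | algebraMap r =>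
      have := superDer_const hZ ⟨W, hW⟩ r
      rwa [← AlgHom.commutes (m.constHom (hW.trans hV)) r] at this
    | add x y hx hy =>
      rw [map_add, map_add, hx, hy, add_zero]
    | ι_mul x v hx =>
      have hι : m.constHom (hW.trans hV) (ExteriorAlgebra.ι ℝ v) =
          ∑ a, v (Module.finBasis ℝ F a) • O.res (hW.trans hV) (m.coord hc hU (Sum.inr a)) := by
        refine m.hat_inj (hW.trans hV) fun y hy => ?_
        rw [m.hat_constHom _ _ hy, map_sum, Finset.sum_apply]
        have hv : v = ∑ a, v (Module.finBasis ℝ F a) • (Module.finBasis ℝ F).coord a := by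
          refine (Module.finBasis ℝ F).ext fun b => ?_
          simp
        conv_lhs => rw [hv, map_sum]
        refine Finset.sum_congr rfl fun a _ => ?_
        rw [map_smul, map_smul, Pi.smul_apply, m.hat_res le_rfl _ _ hy,
          m.hat_coord hc hU _ (hV (hW hy))]
        rfl
      have hmul : m.constHom (hW.trans hV) (CliffordAlgebra.ι 0 v * x) =
          m.constHom (hW.trans hV) (ExteriorAlgebra.ι ℝ v) * m.constHom (hW.trans hV) x :=
        map_mul _ _ _
      rw [hmul, hZ.2.2 ⟨W, hW⟩ 1 _ _ (m.constHom_mem (hW.trans hV) (ι_mem_extParity v)), hx, hι,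
        map_sum]
      simp [hcoord]
  have hfun : ∀ (W : Opens M) (hW : W ≤ V) (f : M → ℝ)
      (hf : ContMDiffOn (𝓡 n) 𝓘(ℝ) ∞ f (W : Set M)), Z ⟨W, hW⟩ (m.funSec (hW.trans hV) f hf) = 0 := by
    intro W hW f hf
    refine m.hat_inj (hW.trans hV) fun y hy => ?_
    rw [map_zero, Pi.zero_apply]
    have hWc : (W : Set M) ⊆ c.source := fun y hy => hU (hV (hW hy))
    obtain ⟨t, ht, hto, hyt, g, hg, hfg⟩ := hadamard (isOpen_chart_target_inter W.2)
      (contDiffOn_comp_chart_symm hc hf) (chart_mem_target_inter hWc hy)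
    -- Hadamard's expansion holds only near `y`; `Z` commutes with restriction, so its value at `y`
    -- can be computed on `W'`.
    let W' : Opens M := ⟨W ∩ (c.source ∩ c ⁻¹' t), W.2.inter (c.isOpen_inter_preimage hto)⟩
    have hW' : W' ≤ W := fun y hy => hy.1
    have hyW' : y ∈ W' := ⟨hy, hWc hy, hyt⟩
    have hgs : ∀ j, ContMDiffOn (𝓡 n) 𝓘(ℝ) ∞ (fun y => g j (c y)) (W' : Set M) := fun j =>
      contMDiffOn_comp_chart hc (fun y hy => hy.2.1) (hg j).contDiffOn (fun _ _ => Set.mem_univ _)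
    have hle : W' ≤ U := (hW'.trans hW).trans hV
    have key : O.res hW' (m.funSec (hW.trans hV) f hf) = algebraMap ℝ _ (f y) +
        ∑ j, (O.res hle (m.coord hc hU (Sum.inl j)) - algebraMap ℝ _ (c y j)) *
          m.funSec hle _ (hgs j) := by
      refine m.hat_inj hle fun x hx => ?_
      have hal : ∀ r : ℝ, m.hat W' (algebraMap ℝ _ r) x = algebraMap ℝ _ r := by
        intro r
        rw [Algebra.algebraMap_eq_smul_one, map_smul, Pi.smul_apply, m.hat_one hle hx,
          Algebra.algebraMap_eq_smul_one]
      rw [m.hat_res (hW.trans hV) _ _ hx, m.hat_funSec (hW.trans hV) _ (hW' hx), map_add, Pi.add_apply, hal, map_sum,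
        Finset.sum_apply]
      have h1 := hfg (c x) hx.2.2
      simp only [Function.comp_apply, c.left_inv hx.2.1, c.left_inv (hWc hy)] at h1
      rw [h1, map_add, map_sum]
      congr 1
      refine Finset.sum_congr rfl fun j _ => ?_
      rw [m.hat_mul hle _ _ hx, map_sub, Pi.sub_apply, hal, m.hat_res le_rfl _ _ hx,
        m.hat_coord hc hU _ (hle hx), m.hat_funSec _ _ hx, map_mul, map_sub]
      rfl
    rw [← m.hat_res (hW.trans hV) hW' _ hyW', hZ.1 W W' hW hW', key, map_add, map_sum,
      superDer_const hZ, zero_add, map_sum, Finset.sum_apply]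
    refine Finset.sum_eq_zero fun j _ => ?_
    have hmem : O.res hle (m.coord hc hU (Sum.inl j)) - algebraMap ℝ _ (c y j) ∈ O.parity W' 0 := by
      refine sub_mem (O.res_mem_parity hle 0 _ (m.coord_mem hc hU (Sum.inl j))) ?_
      exact SetLike.algebraMap_mem_graded (O.parity W') _
    -- Leibniz rule: the first term vanishes since `Z` kills coordinates and constants, the second
    -- since its factor `x_j - y_j` is zero at `y`.
    rw [hZ.2.2 ⟨W', hW'.trans hW⟩ 0 _ _ hmem, map_sub, hcoord W' (hW'.trans hW),
      superDer_const hZ, sub_zero, zero_mul, zero_add, map_smul, Pi.smul_apply,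
      m.hat_mul hle _ _ hyW', map_sub, Pi.sub_apply, m.hat_res le_rfl _ _ hyW',
      m.hat_coord hc hU _ (hle hyW'), Algebra.algebraMap_eq_smul_one, map_smul, Pi.smul_apply,
      m.hat_one hle hyW']
    simp [coordFun, Algebra.algebraMap_eq_smul_one]
  funext W
  ext f
  conv_lhs => rw [m.eq_sum_funSec_mul_constHom (W.2.trans hV) f]
  rw [map_sum]
  refine Finset.sum_eq_zero fun j _ => ?_
  rw [hZ.2.2 W 0 _ _ (m.funSec_mem (W.2.trans hV) _), hfun W.1 W.2, hconst W.1 W.2]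
  simp

/-- By duality the difference of the two sides kills every coordinate, so `superDer_eq_zero`
applies. -/
theorem superDer_expansion (hc : c ∈ IsManifold.maximalAtlas (𝓡 n) ∞ M)
    (hU : (U : Set M) ⊆ c.source) {V : Opens M} (hV : V ≤ U) {i : ZMod 2} {X : O.LinFamily V}
    (hX : X ∈ O.superDer V i) :
    X = ∑ k, O.smulFamily (X ⟨V, le_rfl⟩ (O.res hV (m.coord hc hU k)))
      (O.resFamily hV (m.partialDer hc hU k)) := by
  rw [← sub_eq_zero]
  -- The coefficient `X(c_k)` has parity `i + |c_k|` and `∂_k` has parity `|c_k|`, so each summand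
  -- has the parity `i` of `X`.
  have htwo : ∀ p q : ZMod 2, p + q + q = p := by decide
  refine m.superDer_eq_zero hc hU hV (i := i) (sub_mem hX (sum_mem fun k _ => ?_)) fun l => ?_
  · have h1 : X ⟨V, le_rfl⟩ (O.res hV (m.coord hc hU k)) ∈ O.parity V (i + idxParity k) :=
      hX.2.1 ⟨V, le_rfl⟩ _ _ (O.res_mem_parity hV _ _ (m.coord_mem hc hU k))
    have h2 := O.smulFamily_mem_superDer h1 (resFamily_mem hV (m.partialDer_mem hc hU k))
    rwa [htwo] at h2
  · have h3 : ∀ k, O.resFamily hV (m.partialDer hc hU k) ⟨V, le_rfl⟩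
        (O.res hV (m.coord hc hU l)) = if k = l then 1 else 0 := by
      intro k
      have := (m.partialDer_mem hc hU k).1 U V le_rfl hV (m.coord hc hU l)
      refine this.symm.trans ?_
      rw [m.partialDer_coord]
      split_ifs <;> simp
    simp only [Pi.sub_apply, LinearMap.sub_apply, Finset.sum_apply, LinearMap.sum_apply]
    simp [smulFamily, h3, res_self]

end LocalModel

end Expansion

open SuperalgebraSheaf

/-! ### Supercoordinates and Christoffel symbols of a superconnection. -/

section SuperCoordinates

variable {M : Type u} [TopologicalSpace M]

/-- Supercoordinates of `O` on an open set, with their coordinate superderivations. -/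
structure SuperCoords (O : SuperalgebraSheaf.{u, w} M) (U : Opens M) (ι : Type) [Fintype ι]
    [DecidableEq ι] where
  p : ι → ZMod 2
  c : ι → O.Sec U
  c_mem (k : ι) : c k ∈ O.parity U (p k)
  d : ι → O.LinFamily U
  d_mem (k : ι) : d k ∈ O.superDer U (p k)
  dual (k l : ι) : d k ⟨U, le_rfl⟩ (c l) = if k = l then 1 else 0
  expansion {V : Opens M} (hV : V ≤ U) {i : ZMod 2} {X : O.LinFamily V} :
    X ∈ O.superDer V i →
      X = ∑ k, O.smulFamily (X ⟨V, le_rfl⟩ (O.res hV (c k))) (O.resFamily hV (d k))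

/-- The supercoordinates defined by a local model and a chart. -/
def LocalModel.superCoords {n : ℕ} [ChartedSpace (EuclideanSpace ℝ (Fin n)) M]
    [IsManifold (𝓡 n) ∞ M] {F : Type*} [AddCommGroup F] [Module ℝ F] [Module.Finite ℝ F]
    {O : SuperalgebraSheaf.{u, w} M} {U : Opens M} (m : LocalModel n O F U)
    {c : OpenPartialHomeomorph M (EuclideanSpace ℝ (Fin n))}
    (hc : c ∈ IsManifold.maximalAtlas (𝓡 n) ∞ M) (hU : (U : Set M) ⊆ c.source) :
    SuperCoords O U (LocalModel.Idx n F) where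
  p := LocalModel.idxParity
  c := m.coord hc hU
  c_mem := m.coord_mem hc hU
  d := m.partialDer hc hU
  d_mem := m.partialDer_mem hc hU
  dual := m.partialDer_coord hc hU
  expansion hV _ _ hX := m.superDer_expansion hc hU hV hX

namespace SuperCoords

variable {O : SuperalgebraSheaf.{u, w} M} {U : Opens M} {ι : Type} [Fintype ι] [DecidableEq ι]
  (S : SuperCoords O U ι)

/-- Restriction of supercoordinates to a smaller open set. -/
def restrict {V : Opens M} (h : V ≤ U) : SuperCoords O V ι where
  p := S.p
  c k := O.res h (S.c k)
  c_mem k := O.res_mem_parity h _ _ (S.c_mem k)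
  d k := O.resFamily h (S.d k)
  d_mem k := resFamily_mem h (S.d_mem k)
  dual k l := by
    refine ((S.d_mem k).1 U V le_rfl h (S.c l)).symm.trans ?_
    rw [S.dual]
    split_ifs <;> simp
  expansion {W} hW i X hX := by
    have := S.expansion (hW.trans h) hX
    refine this.trans (Finset.sum_congr rfl fun k _ => ?_)
    rw [O.res_res]
    rfl

/-- The coordinate superderivations as sections of the tangent sheaf. -/
def D (k : ι) : O.tangent U :=
  ⟨S.d k, superDer_le_tangent _ (S.d_mem k)⟩

theorem even_or_odd (p : ZMod 2) : p = 0 ∨ p = 1 := by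
  revert p; decide

theorem tangent_expansion {i : ZMod 2} {X : O.tangent U} (hX : X.1 ∈ O.superDer U i) :
    X = ∑ k, X.1 ⟨U, le_rfl⟩ (S.c k) • S.D k := by
  apply Subtype.ext
  refine (S.expansion le_rfl hX).trans ?_
  rw [AddSubmonoidClass.coe_finsetSum]
  refine Finset.sum_congr rfl fun k _ => ?_
  rw [res_self]
  rfl

theorem expansion_apply {i : ZMod 2} {X : O.LinFamily U} (hX : X ∈ O.superDer U i)
    {V : Opens M} (hV : V ≤ U) (f : O.Sec V) :
    X ⟨V, hV⟩ f = ∑ k, O.res hV (X ⟨U, le_rfl⟩ (S.c k)) * S.d k ⟨V, hV⟩ f := by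
  have h := congrFun (S.expansion le_rfl hX) ⟨V, hV⟩
  rw [h]
  simp only [Finset.sum_apply, LinearMap.sum_apply]
  refine Finset.sum_congr rfl fun k _ => ?_
  rw [res_self]
  rfl

variable (D : O.Connection)

/-- The Christoffel symbols of a connection on `O` in supercoordinates. -/
def christoffel (μ ν κ : ι) : O.Sec U :=
  (D.nabla U (S.D μ) (S.D ν)).1 ⟨U, le_rfl⟩ (S.c κ)

-- Expand `Y` by the Leibniz rule and then `X` by linearity. Signs are absent because `X` is even.
-- The order of the factors, `Y(c_ν)` before `X(c_μ)` before `Γ`, is kept, since the coefficients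
-- need not commute.
set_option synthInstance.maxHeartbeats 100000 in
theorem nabla_apply_coord {X Y : O.tangent U} (hX : X.1 ∈ O.superDer U 0)
    (hY : Y.1 ∈ O.superDer U 0) (κ : ι) :
    (D.nabla U X Y).1 ⟨U, le_rfl⟩ (S.c κ) =
      X.1 ⟨U, le_rfl⟩ (Y.1 ⟨U, le_rfl⟩ (S.c κ)) +
      ∑ ν, ∑ μ, Y.1 ⟨U, le_rfl⟩ (S.c ν) * (X.1 ⟨U, le_rfl⟩ (S.c μ) * S.christoffel D μ ν κ) := by
  have happ : ∀ (f : O.Sec U) (Z : O.tangent U) (g : O.Sec U),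
      (f • Z).1 ⟨U, le_rfl⟩ g = f * Z.1 ⟨U, le_rfl⟩ g := by
    intro f Z g
    change O.res _ f * _ = _
    rw [res_self]
  have hsum : ∀ (s : ι → O.tangent U) (g : O.Sec U),
      (∑ k, s k).1 ⟨U, le_rfl⟩ g = ∑ k, (s k).1 ⟨U, le_rfl⟩ g := by
    intro s g
    rw [AddSubmonoidClass.coe_finsetSum, Finset.sum_apply, LinearMap.sum_apply]
  have hadd : ∀ (Z Z' : O.tangent U) (g : O.Sec U),
      (Z + Z').1 ⟨U, le_rfl⟩ g = Z.1 ⟨U, le_rfl⟩ g + Z'.1 ⟨U, le_rfl⟩ g := fun _ _ _ => rfl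
  have hXD : ∀ ν, D.nabla U X (S.D ν) =
      ∑ μ, X.1 ⟨U, le_rfl⟩ (S.c μ) • D.nabla U (S.D μ) (S.D ν) := by
    intro ν
    conv_lhs => rw [S.tangent_expansion hX]
    rw [map_sum, LinearMap.sum_apply]
    exact Finset.sum_congr rfl fun μ _ => D.nabla_smul_left _ _ _ _
  have hYmem : ∀ ν, Y.1 ⟨U, le_rfl⟩ (S.c ν) ∈ O.parity U (S.p ν) := by
    intro ν
    have := hY.2.1 ⟨U, le_rfl⟩ _ _ (S.c_mem ν)
    rwa [zero_add] at this
  conv_lhs => rw [S.tangent_expansion hY]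
  rw [map_sum, hsum]
  have hterm : ∀ ν, (D.nabla U X (Y.1 ⟨U, le_rfl⟩ (S.c ν) • S.D ν)).1 ⟨U, le_rfl⟩ (S.c κ) =
      (if ν = κ then X.1 ⟨U, le_rfl⟩ (Y.1 ⟨U, le_rfl⟩ (S.c ν)) else 0) +
      ∑ μ, Y.1 ⟨U, le_rfl⟩ (S.c ν) * (X.1 ⟨U, le_rfl⟩ (S.c μ) * S.christoffel D μ ν κ) := by
    intro ν
    rw [D.nabla_leibniz U 0 (S.p ν) _ X (S.D ν) hX (hYmem ν), hadd, happ]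
    congr 1
    · change _ * S.d ν ⟨U, le_rfl⟩ (S.c κ) = _
      rw [S.dual]
      split_ifs <;> simp
    · have h1 : (-1 : ℝ) ^ (0 * S.p ν).val = 1 := by simp
      rw [h1, one_smul, happ, hXD, hsum, Finset.mul_sum]
      exact Finset.sum_congr rfl fun μ _ => by rw [happ]; rfl
  simp only [hterm, Finset.sum_add_distrib]
  congr 1
  simp

end SuperCoords

end SuperCoordinates

/-! ### The map `ψ ∘ pr` on all sections, and the reduced Christoffel symbols. -/

section Reduction

variable {n : ℕ} {M : Type u} [TopologicalSpace M] [ChartedSpace (EuclideanSpace ℝ (Fin n)) M]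
  {F : Type*} [NormedAddCommGroup F] [NormedSpace ℝ F]
  {E : M → Type*} [∀ x, AddCommGroup (E x)] [∀ x, Module ℝ (E x)] [∀ x, TopologicalSpace (E x)]
  [TopologicalSpace (TotalSpace F E)] [FiberBundle F E]
  {O : SuperalgebraSheaf.{u, w} M}

namespace ModelIso

variable (θ : BatchelorModel (n := n) O F E)

/-- The fibrewise affine function on `E` defined by a section of `O`. -/
def psi {V : Opens M} (f : O.Sec V) (e : TotalSpace F E) : ℝ :=
  affineFun (θ.equiv V le_top f) e

/-- The component of degree `0` of a section of `O`. -/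
def val {V : Opens M} (f : O.Sec V) (x : M) : ℝ :=
  θ.psi f ⟨x, 0⟩

variable {V : Opens M}

theorem psi_eq (f : O.Sec V) {e : TotalSpace F E} (he : e.proj ∈ V) :
    θ.psi f e = affineEval e.2 ((θ.equiv V le_top f).1 ⟨e.proj, he⟩) := by
  simp [psi, affineFun, he, affineEval_apply]

theorem val_eq (f : O.Sec V) {x : M} (hx : x ∈ V) :
    θ.val f x = ExteriorAlgebra.algebraMapInv ((θ.equiv V le_top f).1 ⟨x, hx⟩) := by
  rw [val, θ.psi_eq f (e := ⟨x, 0⟩) hx, affineEval_apply]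
  simp

theorem psi_eq_val_add (f : O.Sec V) {e : TotalSpace F E} (he : e.proj ∈ V) :
    θ.psi f e = θ.val f e.proj + ExteriorAlgebra.ιInv ((θ.equiv V le_top f).1 ⟨e.proj, he⟩) e.2 := by
  rw [θ.psi_eq f he, θ.val_eq f he, affineEval_apply]

theorem psi_add (f g : O.Sec V) (e : TotalSpace F E) : θ.psi (f + g) e = θ.psi f e + θ.psi g e := by
  by_cases he : e.proj ∈ V
  · rw [θ.psi_eq _ he, θ.psi_eq _ he, θ.psi_eq _ he, map_add]
    exact map_add (affineEval e.2) _ _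
  · simp [psi, affineFun, he]

theorem psi_smul (r : ℝ) (g : O.Sec V) (e : TotalSpace F E) : θ.psi (r • g) e = r * θ.psi g e := by
  by_cases he : e.proj ∈ V
  · rw [θ.psi_eq _ he, θ.psi_eq _ he, map_smul]
    exact map_smul (affineEval e.2) _ _
  · simp [psi, affineFun, he]

/-- The linear map `f ↦ ψ(f)(e)`. -/
def psiHom (e : TotalSpace F E) : O.Sec V →ₗ[ℝ] ℝ where
  toFun f := θ.psi f e
  map_add' f g := θ.psi_add f g e
  map_smul' r f := θ.psi_smul r f e

theorem psi_sum {ι : Type*} (s : Finset ι) (f : ι → O.Sec V) (e : TotalSpace F E) :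
    θ.psi (∑ i ∈ s, f i) e = ∑ i ∈ s, θ.psi (f i) e :=
  map_sum (θ.psiHom e) f s

theorem psi_res {W : Opens M} (h : W ≤ V) (f : O.Sec V) {e : TotalSpace F E} (he : e.proj ∈ W) :
    θ.psi (O.res h f) e = θ.psi f e := by
  rw [θ.psi_eq _ he, θ.psi_eq _ (h he), θ.equiv_res le_top h]

theorem val_res {W : Opens M} (h : W ≤ V) (f : O.Sec V) {x : M} (he : x ∈ W) :
    θ.val (O.res h f) x = θ.val f x :=
  θ.psi_res h f (e := ⟨x, 0⟩) he

theorem val_mul (f g : O.Sec V) {x : M} (hx : x ∈ V) : θ.val (f * g) x = θ.val f x * θ.val g x := by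
  rw [θ.val_eq _ hx, θ.val_eq _ hx, θ.val_eq _ hx, map_mul]
  exact map_mul ExteriorAlgebra.algebraMapInv _ _

/-- Multiplicativity of the projection to `ℝ ⊕ E*`, with the product `f₁ g₁` of degree two
discarded; the subtracted term compensates for counting `f₀ g₀` twice. -/
theorem psi_mul (f g : O.Sec V) {e : TotalSpace F E} (he : e.proj ∈ V) :
    θ.psi (f * g) e = θ.val f e.proj * θ.psi g e + θ.val g e.proj * θ.psi f e -
      θ.val f e.proj * θ.val g e.proj := by
  rw [θ.psi_eq_val_add _ he, θ.psi_eq_val_add f he, θ.psi_eq_val_add g he, θ.val_mul _ _ he,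
    map_mul]
  have := ιInv_mul ((θ.equiv V le_top f).1 ⟨e.proj, he⟩) ((θ.equiv V le_top g).1 ⟨e.proj, he⟩)
  have h2 : ExteriorAlgebra.ιInv
      (((θ.equiv V le_top) f * (θ.equiv V le_top) g).1 ⟨e.proj, he⟩) e.2 =
      (ExteriorAlgebra.algebraMapInv ((θ.equiv V le_top f).1 ⟨e.proj, he⟩) •
        ExteriorAlgebra.ιInv ((θ.equiv V le_top g).1 ⟨e.proj, he⟩) +
      ExteriorAlgebra.algebraMapInv ((θ.equiv V le_top g).1 ⟨e.proj, he⟩) •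
        ExteriorAlgebra.ιInv ((θ.equiv V le_top f).1 ⟨e.proj, he⟩)) e.2 := by
    rw [← this]; rfl
  rw [h2, ← θ.val_eq f he, ← θ.val_eq g he]
  simp only [LinearMap.add_apply, LinearMap.smul_apply, smul_eq_mul]
  ring

theorem psi_even {f : O.Sec V} (hf : f ∈ O.parity V 0) {e : TotalSpace F E} (he : e.proj ∈ V) :
    θ.psi f e = θ.val f e.proj := by
  rw [θ.psi_eq_val_add _ he, ιInv_of_even (θ.equiv_parity V le_top 0 f hf _)]
  simp

theorem val_odd {f : O.Sec V} (hf : f ∈ O.parity V 1) {x : M} (hx : x ∈ V) :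
    θ.val f x = 0 := by
  rw [θ.val_eq _ hx]
  exact algebraMapInv_of_odd (θ.equiv_parity V le_top 1 f hf _)

theorem psi_even_mul {f : O.Sec V} (hf : f ∈ O.parity V 0) (g : O.Sec V) {e : TotalSpace F E}
    (he : e.proj ∈ V) : θ.psi (f * g) e = θ.psi f e * θ.psi g e := by
  rw [θ.psi_mul _ _ he, θ.psi_even hf he]
  ring

theorem psi_odd_mul {f : O.Sec V} (hf : f ∈ O.parity V 1) (g : O.Sec V) {e : TotalSpace F E}
    (he : e.proj ∈ V) : θ.psi (f * g) e = θ.psi f e * θ.val g e.proj := by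
  rw [θ.psi_mul _ _ he, θ.val_odd hf he]
  ring

theorem val_algebraMap (r : ℝ) {x : M} (hx : x ∈ V) : θ.val (algebraMap ℝ (O.Sec V) r) x = r := by
  rw [θ.val_eq _ hx, AlgEquiv.commutes]
  exact algebraMapInv_algebraMap r

/-- The derivative component of `ψ`: `ψ(f)` for even and the degree `0` component for odd
coordinate directions. -/
def psiDir (p : ZMod 2) (f : O.Sec V) (e : TotalSpace F E) : ℝ :=
  if p = 0 then θ.psi f e else θ.val f e.proj

/-- An odd left factor has degree at least one already, so only the degree 0 component of `g`
survives the truncation. `psiDir` expresses both parities in one formula. -/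
theorem psi_mul_psiDir {p : ZMod 2} {f : O.Sec V} (hf : f ∈ O.parity V p) (g : O.Sec V)
    {e : TotalSpace F E} (he : e.proj ∈ V) :
    θ.psi (f * g) e = θ.psi f e * θ.psiDir p g e := by
  rcases SuperCoords.even_or_odd p with rfl | rfl
  · rw [θ.psi_even_mul hf g he, psiDir, if_pos rfl]
  · rw [θ.psi_odd_mul hf g he, psiDir, if_neg one_ne_zero]

variable {U : Opens M} {ι : Type} [Fintype ι] [DecidableEq ι] (S : SuperCoords O U ι)
  (D : O.Connection)

/-- The Christoffel symbols of the reduced connection. -/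
def redChristoffel (μ ν κ : ι) (e : TotalSpace F E) : ℝ :=
  if S.p μ = 0 then θ.psiDir (S.p ν) (S.christoffel D μ ν κ) e
  else if S.p ν = 0 then θ.val (S.christoffel D μ ν κ) e.proj else 0

/-- This is the classical formula for a connection: truncation turns each product `Y^ν X^μ Γ` into a
product of `ψ(Y^ν)`, `ψ(X^μ)` and a function that does not depend on `X` and `Y`. -/
theorem psi_nabla_apply_coord {X Y : O.tangent U} (hX : X.1 ∈ O.superDer U 0)
    (hY : Y.1 ∈ O.superDer U 0) (κ : ι) {e : TotalSpace F E} (he : e.proj ∈ U) :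
    θ.psi ((D.nabla U X Y).1 ⟨U, le_rfl⟩ (S.c κ)) e =
      θ.psi (X.1 ⟨U, le_rfl⟩ (Y.1 ⟨U, le_rfl⟩ (S.c κ))) e +
      ∑ ν, ∑ μ, θ.psi (Y.1 ⟨U, le_rfl⟩ (S.c ν)) e * (θ.psi (X.1 ⟨U, le_rfl⟩ (S.c μ)) e *
        θ.redChristoffel S D μ ν κ e) := by
  rw [S.nabla_apply_coord D hX hY, θ.psi_add, θ.psi_sum]
  congr 1
  refine Finset.sum_congr rfl fun ν _ => ?_
  rw [θ.psi_sum]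
  refine Finset.sum_congr rfl fun μ _ => ?_
  have hYν : Y.1 ⟨U, le_rfl⟩ (S.c ν) ∈ O.parity U (S.p ν) := by
    have := hY.2.1 ⟨U, le_rfl⟩ _ _ (S.c_mem ν)
    rwa [zero_add] at this
  have hXμ : X.1 ⟨U, le_rfl⟩ (S.c μ) ∈ O.parity U (S.p μ) := by
    have := hX.2.1 ⟨U, le_rfl⟩ _ _ (S.c_mem μ)
    rwa [zero_add] at this
  rw [θ.psi_mul_psiDir hYν _ he]
  congr 1
  -- At most one of the two coefficients may be odd; when both are, the product has degree at least
  -- two, and this is the value `0` of `redChristoffel`.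
  rcases SuperCoords.even_or_odd (S.p ν) with hν | hν <;>
    rcases SuperCoords.even_or_odd (S.p μ) with hμ | hμ <;>
    simp only [psiDir, redChristoffel, hν, hμ, if_true, one_ne_zero, if_false] <;>
    rw [hμ] at hXμ
  · rw [θ.psi_even_mul hXμ _ he]
  · rw [θ.psi_odd_mul hXμ _ he]
  · rw [θ.val_mul _ _ he, θ.psi_even hXμ he]
  · rw [θ.val_mul _ _ he, θ.val_odd hXμ he]
    simp

theorem psi_superDer_apply {X : O.LinFamily U} (hX : X ∈ O.superDer U 0) {V : Opens M} (hV : V ≤ U)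
    (f : O.Sec V) {e : TotalSpace F E} (he : e.proj ∈ V) :
    θ.psi (X ⟨V, hV⟩ f) e =
      ∑ k, θ.psi (X ⟨U, le_rfl⟩ (S.c k)) e * θ.psiDir (S.p k) (S.d k ⟨V, hV⟩ f) e := by
  rw [S.expansion_apply hX hV f, θ.psi_sum]
  refine Finset.sum_congr rfl fun k _ => ?_
  have hXk : X ⟨U, le_rfl⟩ (S.c k) ∈ O.parity U (S.p k) := by
    have := hX.2.1 ⟨U, le_rfl⟩ _ _ (S.c_mem k)
    rwa [zero_add] at this
  have hres : O.res hV (X ⟨U, le_rfl⟩ (S.c k)) ∈ O.parity V (S.p k) := O.res_mem_parity hV _ _ hXk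
  rw [θ.psi_mul_psiDir hres _ he]
  congr 1
  exact θ.psi_res hV _ he

end ModelIso

end Reduction

/-! ### Manifolds: vector fields and connections in local coordinates. -/

section Coordinates

variable {B : Type*} [NormedAddCommGroup B] [NormedSpace ℝ B] {H : Type*} [TopologicalSpace H]
  {I : ModelWithCorners ℝ B H} {N : Type*} [TopologicalSpace N] [ChartedSpace H N]
  [IsManifold I ∞ N]

theorem mvfderiv_congr {G : Type*} [NormedAddCommGroup G] [NormedSpace ℝ G] {f g : N → G} {e : N}
    (h : f =ᶠ[nhds e] g) : mvfderiv I f e = mvfderiv I g e := by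
  have := h.mfderiv_eq (I := I) (I' := 𝓘(ℝ, G))
  ext v
  exact congr($this v)

/-- The derivative of a smooth function, read in the tangent trivialization at `e₀`, is smooth. -/
theorem contMDiffAt_mvfderiv_comp_symmL {G : Type*} [NormedAddCommGroup G] [NormedSpace ℝ G]
    {f : N → G} {e₀ : N} (hf : ContMDiffAt I 𝓘(ℝ, G) ∞ f e₀) :
    ContMDiffAt I 𝓘(ℝ, B →L[ℝ] G) ∞
      (fun e => (mvfderiv I f e).comp
        ((trivializationAt B (TangentSpace I : N → Type _) e₀).symmL ℝ e)) e₀ := by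
  refine (hf.mfderiv_const (m := ∞) (by simp)).congr_of_eventuallyEq (.of_forall fun e => ?_)
  simp only [inTangentCoordinates, ContinuousLinearMap.inCoordinates, id,
    TangentBundle.continuousLinearMapAt_model_space]
  rfl

/-- The value of a vector field in the tangent trivialization at `e₀`. -/
theorem mvfderiv_apply_eq {G : Type*} [NormedAddCommGroup G] [NormedSpace ℝ G]
    (f : N → G) {e₀ e : N}
    (he : e ∈ (trivializationAt B (TangentSpace I : N → Type _) e₀).baseSet)
    (v : TangentSpace I e) :
    mvfderiv I f e v = ((mvfderiv I f e).comp
      ((trivializationAt B (TangentSpace I : N → Type _) e₀).symmL ℝ e))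
        (trivializationAt B (TangentSpace I : N → Type _) e₀ ⟨e, v⟩).2 := by
  rw [ContinuousLinearMap.comp_apply]
  congr 1
  have := (trivializationAt B (TangentSpace I : N → Type _) e₀).symmL_continuousLinearMapAt
    (R := ℝ) he v
  rw [Trivialization.continuousLinearMapAt_apply, Trivialization.linearMapAt_apply,
    if_pos he] at this
  exact this.symm

theorem mdifferentiableAt_mvfderiv_apply {G : Type*} [NormedAddCommGroup G] [NormedSpace ℝ G]
    {f : N → G} {e₀ : N} (hf : ContMDiffAt I 𝓘(ℝ, G) ∞ f e₀) {Y : (e : N) → TangentSpace I e}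
    (hY : MDifferentiableAt I I.tangent (fun e => (⟨e, Y e⟩ : TangentBundle I N)) e₀) :
    MDifferentiableAt I 𝓘(ℝ, G) (fun e => mvfderiv I f e (Y e)) e₀ := by
  have h1 := (contMDiffAt_mvfderiv_comp_symmL hf).mdifferentiableAt (by simp)
  have h2 := (mdifferentiableAt_section (F := B) I Y).1 hY
  refine (h1.clm_apply h2).congr_of_eventuallyEq ?_
  filter_upwards [(trivializationAt B (TangentSpace I : N → Type _) e₀).open_baseSet.mem_nhds
    (FiberBundle.mem_baseSet_trivializationAt' e₀)] with e he
  exact mvfderiv_apply_eq f he (Y e)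

theorem contMDiffAt_mvfderiv_apply {G : Type*} [NormedAddCommGroup G] [NormedSpace ℝ G]
    {f : N → G} {e₀ : N} (hf : ContMDiffAt I 𝓘(ℝ, G) ∞ f e₀) {Y : (e : N) → TangentSpace I e}
    (hY : ContMDiffAt I I.tangent ∞ (fun e => (⟨e, Y e⟩ : TangentBundle I N)) e₀) :
    ContMDiffAt I 𝓘(ℝ, G) ∞ (fun e => mvfderiv I f e (Y e)) e₀ := by
  have h1 := contMDiffAt_mvfderiv_comp_symmL hf
  have h2 := (contMDiffAt_section (F := B) (s := Y) e₀).1 hY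
  refine (h1.clm_apply h2).congr_of_eventuallyEq ?_
  filter_upwards [(trivializationAt B (TangentSpace I : N → Type _) e₀).open_baseSet.mem_nhds
    (FiberBundle.mem_baseSet_trivializationAt' e₀)] with e he
  exact mvfderiv_apply_eq f he (Y e)

variable {G : Type*} [NormedAddCommGroup G] [NormedSpace ℝ G]

variable (I) in
/-- `z` is smooth on the open set `S` and its derivative is invertible there. -/
structure IsLocalCoordinate (z : N → G) (S : Set N) : Prop where
  isOpen : IsOpen S
  smooth : ContMDiffOn I 𝓘(ℝ, G) ∞ z S
  inv : ∀ e ∈ S, (mvfderiv I z e).IsInvertible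

namespace IsLocalCoordinate

variable {z : N → G} {S : Set N}

theorem mono (hz : IsLocalCoordinate I z S) {S' : Set N} (hS : S' ⊆ S) (ho : IsOpen S') :
    IsLocalCoordinate I z S' :=
  ⟨ho, hz.smooth.mono hS, fun e he => hz.inv e (hS he)⟩

theorem smoothAt (hz : IsLocalCoordinate I z S) {e : N} (he : e ∈ S) :
    ContMDiffAt I 𝓘(ℝ, G) ∞ z e :=
  (hz.smooth e he).contMDiffAt (hz.isOpen.mem_nhds he)

theorem inverse_apply (hz : IsLocalCoordinate I z S) {e : N} (he : e ∈ S)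
    (v : TangentSpace I e) : (mvfderiv I z e).inverse (mvfderiv I z e v) = v := by
  obtain ⟨A, hA⟩ := hz.inv e he
  rw [← hA, ContinuousLinearMap.inverse_equiv]; simp

theorem apply_inverse (hz : IsLocalCoordinate I z S) {e : N} (he : e ∈ S) (w : G) :
    mvfderiv I z e ((mvfderiv I z e).inverse w) = w := by
  obtain ⟨A, hA⟩ := hz.inv e he
  rw [← hA, ContinuousLinearMap.inverse_equiv]; simp

theorem injective (hz : IsLocalCoordinate I z S) {e : N} (he : e ∈ S) {v w : TangentSpace I e}
    (h : mvfderiv I z e v = mvfderiv I z e w) : v = w := by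
  rw [← hz.inverse_apply he v, h, hz.inverse_apply he]

variable [FiniteDimensional ℝ B]

/-- In the tangent trivialization the derivative of `z` is a smooth family of linear isomorphisms,
and inversion of continuous linear maps is smooth at isomorphisms. -/
theorem contMDiffAt_inverse (hz : IsLocalCoordinate I z S) {e₀ : N} (he₀ : e₀ ∈ S) :
    ContMDiffAt I 𝓘(ℝ, G →L[ℝ] B) ∞
      (fun e => ((trivializationAt B (TangentSpace I : N → Type _) e₀).continuousLinearMapAt ℝ
        e).comp (mvfderiv I z e).inverse) e₀ := by
  have : CompleteSpace B := FiniteDimensional.complete ℝ B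
  have h1 := contMDiffAt_mvfderiv_comp_symmL (hz.smoothAt he₀)
  have hb := FiberBundle.mem_baseSet_trivializationAt' (F := B) (E := (TangentSpace I : N → Type _)) e₀
  have key : ∀ e ∈ S ∩ (trivializationAt B (TangentSpace I : N → Type _) e₀).baseSet,
      ∃ A : B ≃L[ℝ] G, (A : B →L[ℝ] G) = (mvfderiv I z e).comp
          ((trivializationAt B (TangentSpace I : N → Type _) e₀).symmL ℝ e) ∧
        (A.symm : G →L[ℝ] B) = ((trivializationAt B (TangentSpace I : N → Type _)
          e₀).continuousLinearMapAt ℝ e).comp (mvfderiv I z e).inverse := by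
    rintro e ⟨he, he'⟩
    obtain ⟨A, hA⟩ := hz.inv e he
    refine ⟨(((trivializationAt B (TangentSpace I : N → Type _) e₀).continuousLinearEquivAt ℝ e
      he').symm.trans A), ?_, ?_⟩
    · ext v
      rw [← hA]
      exact congrArg A (congr($((trivializationAt B (TangentSpace I : N → Type _)
        e₀).symm_continuousLinearEquivAt_eq (R := ℝ) he') v))
    · ext v
      rw [← hA, ContinuousLinearMap.inverse_equiv]
      simp [Trivialization.coe_linearMapAt_of_mem _ he']
  obtain ⟨A, hA, -⟩ := key e₀ ⟨he₀, hb⟩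
  have h2 : ContMDiffAt I 𝓘(ℝ, G →L[ℝ] B) ∞ (ContinuousLinearMap.inverse ∘ fun e =>
      (mvfderiv I z e).comp
        ((trivializationAt B (TangentSpace I : N → Type _) e₀).symmL ℝ e)) e₀ := by
    refine ContMDiffAt.comp e₀ (ContDiffAt.contMDiffAt ?_) h1
    rw [← hA]
    exact contDiffAt_map_inverse A
  refine h2.congr_of_eventuallyEq ?_
  filter_upwards [(hz.isOpen.inter (trivializationAt B (TangentSpace I : N → Type _)
    e₀).open_baseSet).mem_nhds ⟨he₀, hb⟩] with e he
  obtain ⟨A, hA, hA'⟩ := key e he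
  rw [← hA', Function.comp_apply, ← hA, ContinuousLinearMap.inverse_equiv]

theorem contMDiffAt_inverse_apply (hz : IsLocalCoordinate I z S) {e₀ : N} (he₀ : e₀ ∈ S)
    {w : N → G} (hw : ContMDiffAt I 𝓘(ℝ, G) ∞ w e₀) :
    ContMDiffAt I I.tangent ∞
      (fun e => (⟨e, (mvfderiv I z e).inverse (w e)⟩ : TangentBundle I N)) e₀ := by
  refine (contMDiffAt_section (F := B) (E := (TangentSpace I : N → Type _))
    (s := fun e => (mvfderiv I z e).inverse (w e)) e₀).2 ?_
  refine ((hz.contMDiffAt_inverse he₀).clm_apply hw).congr_of_eventuallyEq ?_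
  filter_upwards [(trivializationAt B (TangentSpace I : N → Type _) e₀).open_baseSet.mem_nhds
    (FiberBundle.mem_baseSet_trivializationAt' e₀)] with e he
  simp [Trivialization.coe_linearMapAt_of_mem _ he]

theorem mdifferentiableAt_inverse_apply (hz : IsLocalCoordinate I z S) {e₀ : N} (he₀ : e₀ ∈ S)
    {w : N → G} (hw : MDifferentiableAt I 𝓘(ℝ, G) w e₀) :
    MDifferentiableAt I I.tangent
      (fun e => (⟨e, (mvfderiv I z e).inverse (w e)⟩ : TangentBundle I N)) e₀ := by
  refine (mdifferentiableAt_section (F := B) (E := (TangentSpace I : N → Type _)) I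
    (fun e => (mvfderiv I z e).inverse (w e))).2 ?_
  refine (((hz.contMDiffAt_inverse he₀).mdifferentiableAt (by simp)).clm_apply
    hw).congr_of_eventuallyEq ?_
  filter_upwards [(trivializationAt B (TangentSpace I : N → Type _) e₀).open_baseSet.mem_nhds
    (FiberBundle.mem_baseSet_trivializationAt' e₀)] with e he
  simp [Trivialization.coe_linearMapAt_of_mem _ he]

end IsLocalCoordinate

/-! ### Connections given by Christoffel symbols -/

variable (I) in
/-- The vector field with constant components `w` in the coordinates `z`. -/
def constField (z : N → G) (w : G) (e : N) : TangentSpace I e :=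
  (mvfderiv I z e).inverse w

variable (I) in
/-- The connection with Christoffel symbols `Γ` in the coordinates `z`. -/
def christoffelCov (z : N → G) (Γ : N → G →L[ℝ] G →L[ℝ] G) (Y : (e : N) → TangentSpace I e)
    (e : N) : TangentSpace I e →L[ℝ] TangentSpace I e :=
  (mvfderiv I z e).inverse.comp (mvfderiv I (fun e' => mvfderiv I z e' (Y e')) e +
    (Γ e (mvfderiv I z e (Y e))).comp (mvfderiv I z e))

namespace IsLocalCoordinate

variable {z : N → G} {S : Set N} {Γ : N → G →L[ℝ] G →L[ℝ] G}

theorem mvfderiv_christoffelCov (hz : IsLocalCoordinate I z S) {e : N} (he : e ∈ S)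
    (Y : (e : N) → TangentSpace I e) (v : TangentSpace I e) :
    mvfderiv I z e (christoffelCov I z Γ Y e v) =
      mvfderiv I (fun e' => mvfderiv I z e' (Y e')) e v +
        Γ e (mvfderiv I z e (Y e)) (mvfderiv I z e v) := by
  simp only [christoffelCov, ContinuousLinearMap.comp_apply]
  rw [hz.apply_inverse he]
  simp

/-- The derivative of `z` is injective on `S`, so the axioms may be checked on components, where
they are the sum and product rules. -/
theorem isCovariantDerivativeOn_christoffelCov (hz : IsLocalCoordinate I z S) :
    IsCovariantDerivativeOn B (christoffelCov I z Γ) S where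
  add {Y Y' e} hY hY' he := by
    ext1 v
    apply hz.injective he
    rw [add_apply, map_add, hz.mvfderiv_christoffelCov he, hz.mvfderiv_christoffelCov he,
      hz.mvfderiv_christoffelCov he]
    have h1 := mdifferentiableAt_mvfderiv_apply (hz.smoothAt he) hY
    have h2 := mdifferentiableAt_mvfderiv_apply (hz.smoothAt he) hY'
    have h3 : (fun e' => mvfderiv I z e' ((Y + Y') e')) = (fun e' => mvfderiv I z e' (Y e')) +
      fun e' => mvfderiv I z e' (Y' e') := by ext1 e'; simp
    rw [h3, mvfderiv_add h1 h2]
    simp only [Pi.add_apply, map_add, add_apply]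
    abel
  leibniz {Y g e} hY hg he := by
    ext1 v
    apply hz.injective he
    rw [add_apply, map_add, hz.mvfderiv_christoffelCov he, smul_apply, map_smul,
      hz.mvfderiv_christoffelCov he, ContinuousLinearMap.smulRight_apply, map_smul]
    have h1 := mdifferentiableAt_mvfderiv_apply (hz.smoothAt he) hY
    have h3 : (fun e' => mvfderiv I z e' ((g • Y) e')) = g • (fun e' => mvfderiv I z e' (Y e')) := by
      ext1 e'; simp
    rw [h3, mvfderiv_smul hg h1]
    simp only [Pi.smul_apply', map_smul, add_apply, smul_apply, smul_add,
      ContinuousLinearMap.smulRight_apply]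
    abel

variable [FiniteDimensional ℝ B]

theorem contMDiffAt_christoffelCov (hz : IsLocalCoordinate I z S) {e₀ : N} (he₀ : e₀ ∈ S)
    (hΓ : ContMDiffAt I 𝓘(ℝ, G →L[ℝ] G →L[ℝ] G) ∞ Γ e₀) {Y : (e : N) → TangentSpace I e}
    (hY : ∀ᶠ e in nhds e₀, ContMDiffAt I I.tangent ∞ (fun e => (⟨e, Y e⟩ : TangentBundle I N)) e) :
    ContMDiffAt I (I.prod 𝓘(ℝ, B →L[ℝ] B)) ∞
      (fun e => (⟨e, christoffelCov I z Γ Y e⟩ : TotalSpace (B →L[ℝ] B)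
        fun e => TangentSpace I e →L[ℝ] TangentSpace I e)) e₀ := by
  rw [contMDiffAt_hom_bundle]
  refine ⟨contMDiffAt_id, ?_⟩
  have hY₀ := hY.self_of_nhds
  have h1 := contMDiffAt_mvfderiv_comp_symmL (hz.smoothAt he₀)
  have h2 := contMDiffAt_mvfderiv_apply (hz.smoothAt he₀) hY₀
  have h3 := contMDiffAt_mvfderiv_comp_symmL h2
  refine ((hz.contMDiffAt_inverse he₀).clm_comp (h3.add ((hΓ.clm_apply h2).clm_comp
    h1))).congr_of_eventuallyEq (.of_forall fun e => ?_)
  ext v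
  simp [ContinuousLinearMap.inCoordinates, christoffelCov]

theorem mvfderiv_constField (hz : IsLocalCoordinate I z S) {e : N} (he : e ∈ S) (w : G) :
    mvfderiv I z e (constField I z w e) = w :=
  hz.apply_inverse he w

theorem contMDiffAt_constField (hz : IsLocalCoordinate I z S) {e : N} (he : e ∈ S) (w : G) :
    ContMDiffAt I I.tangent ∞ (fun e => (⟨e, constField I z w e⟩ : TangentBundle I N)) e :=
  hz.contMDiffAt_inverse_apply he contMDiffAt_const

theorem mvfderiv_christoffelCov_constField (hz : IsLocalCoordinate I z S) {e : N} (he : e ∈ S)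
    (w : G) (v : TangentSpace I e) :
    mvfderiv I z e (christoffelCov I z Γ (constField I z w) e v) =
      Γ e w (mvfderiv I z e v) := by
  rw [hz.mvfderiv_christoffelCov he, hz.mvfderiv_constField he]
  have h : (fun e' => mvfderiv I z e' (constField I z w e')) =ᶠ[nhds e] fun _ => w := by
    filter_upwards [hz.isOpen.mem_nhds he] with e' he'
    exact hz.mvfderiv_constField he' w
  rw [mvfderiv_congr h, mvfderiv_const]
  simp

/-- A covariant derivative is determined by its values on the coordinate fields. -/
theorem eq_christoffelCov_of_basis (hz : IsLocalCoordinate I z S)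
    {C : ((e : N) → TangentSpace I e) → (e : N) → TangentSpace I e →L[ℝ] TangentSpace I e}
    (hC : IsCovariantDerivativeOn B C S) {e : N} (he : e ∈ S) {ι : Type*} (b : Module.Basis ι ℝ G)
    (h : ∀ μ ν, mvfderiv I z e (C (constField I z (b ν)) e (constField I z (b μ) e)) =
      Γ e (b ν) (b μ))
    {Y : (e : N) → TangentSpace I e}
    (hY : MDifferentiableAt I I.tangent (fun e => (⟨e, Y e⟩ : TangentBundle I N)) e) :
    C Y e = christoffelCov I z Γ Y e := by
  have hcov := hz.isCovariantDerivativeOn_christoffelCov (Γ := Γ)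
  have : IsManifold I (1 + 1) N := IsManifold.of_le (n := ∞) (by norm_cast)
  obtain ⟨A, hA⟩ := hz.inv e he
  -- The difference of two covariant derivatives is a tensor, so it is enough to evaluate it on the
  -- basis of the tangent space formed by the coordinate fields.
  have key : IsCovariantDerivativeOn.difference hC hcov e = 0 := by
    let b' : Module.Basis ι ℝ (TangentSpace I e) := b.map A.symm.toLinearEquiv
    have hb' : ∀ k, b' k = constField I z (b k) e := fun k => by
      rw [constField, ← hA, ContinuousLinearMap.inverse_equiv]; simp [b']
    refine ContinuousLinearMap.coe_injective (b'.ext fun ν => ?_)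
    refine ContinuousLinearMap.coe_injective (b'.ext fun μ => ?_)
    simp only [ContinuousLinearMap.coe_coe]
    rw [hb', hb', IsCovariantDerivativeOn.difference_apply hC hcov he
      ((hz.contMDiffAt_constField he (b ν)).mdifferentiableAt (by simp))]
    refine hz.injective he ?_
    rw [sub_apply, map_sub, h, hz.mvfderiv_christoffelCov_constField he,
      hz.mvfderiv_constField he]
    simp
  have := IsCovariantDerivativeOn.difference_apply hC hcov he hY
  rw [key] at this
  exact (sub_eq_zero.1 this.symm)

end IsLocalCoordinate

end Coordinates

theorem mvfderiv_pi_apply {B H N ι : Type*} [NormedAddCommGroup B] [NormedSpace ℝ B]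
    [TopologicalSpace H] {I : ModelWithCorners ℝ B H} [TopologicalSpace N] [ChartedSpace H N]
    [Fintype ι] {f : N → ι → ℝ} {e : N}
    (hf : MDifferentiableAt I 𝓘(ℝ, ι → ℝ) f e) (k : ι) (v : TangentSpace I e) :
    mvfderiv I f e v k = mvfderiv I (fun e' => f e' k) e v := by
  have h := ((ContinuousLinearMap.proj (R := ℝ) (φ := fun _ : ι => ℝ) k).hasMFDerivAt
    (x := f e)).comp e hf.hasMFDerivAt
  have := h.mfderiv
  exact congr($this.symm v)

/-! ### Coordinates on `E` from supercoordinates: existence and uniqueness of the local connection.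
-/

section ModelCoordinates

variable {n : ℕ} {M : Type u} [TopologicalSpace M] [ChartedSpace (EuclideanSpace ℝ (Fin n)) M]
  [IsManifold (𝓡 n) ∞ M]
  {F : Type*} [NormedAddCommGroup F] [NormedSpace ℝ F] [FiniteDimensional ℝ F]
  {E : M → Type*} [∀ x, AddCommGroup (E x)] [∀ x, Module ℝ (E x)] [∀ x, TopologicalSpace (E x)]
  [TopologicalSpace (TotalSpace F E)] [FiberBundle F E] [VectorBundle ℝ F E]
  [ContMDiffVectorBundle ∞ F E (𝓡 n)]
  {O : SuperalgebraSheaf.{u, w} M}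
  {U : Opens M} {ι : Type} [Fintype ι] [DecidableEq ι]

/-- The bilinear map with components `γ μ ν κ`. -/
def bilinearOfComponents (γ : ι → ι → ι → ℝ) : (ι → ℝ) →L[ℝ] (ι → ℝ) →L[ℝ] (ι → ℝ) :=
  ∑ κ, ∑ ν, ∑ μ, γ μ ν κ • (ContinuousLinearMap.proj (R := ℝ) (φ := fun _ : ι => ℝ) ν).smulRight
    ((ContinuousLinearMap.proj (R := ℝ) (φ := fun _ : ι => ℝ) μ).smulRight
      (Pi.single κ (1 : ℝ) : ι → ℝ))

theorem bilinearOfComponents_apply (γ : ι → ι → ι → ℝ) (w v : ι → ℝ) (κ : ι) :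
    bilinearOfComponents γ w v κ = ∑ ν, ∑ μ, w ν * (v μ * γ μ ν κ) := by
  simp only [bilinearOfComponents, sum_apply, smul_apply, Finset.sum_apply,
    ContinuousLinearMap.smulRight_apply, ContinuousLinearMap.proj_apply, Pi.smul_apply, smul_eq_mul]
  rw [Finset.sum_eq_single κ]
  · refine Finset.sum_congr rfl fun ν _ => Finset.sum_congr rfl fun μ _ => ?_
    simp; ring
  · intro l _ hl
    refine Finset.sum_eq_zero fun ν _ => Finset.sum_eq_zero fun μ _ => ?_
    simp [Pi.single_eq_of_ne hl.symm]
  · simp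

namespace ModelIso

variable (θ : BatchelorModel (n := n) O F E) (S : SuperCoords O U ι) (D : O.Connection)

/-- The Christoffel symbols of the reduced connection as a bilinear map. -/
def redGamma (e : TotalSpace F E) : (ι → ℝ) →L[ℝ] (ι → ℝ) →L[ℝ] (ι → ℝ) :=
  bilinearOfComponents fun μ ν κ => θ.redChristoffel S D μ ν κ e

/-- `z` are the coordinates on the total space of `E` given by the images under `ψ` of the
supercoordinates `S`, with the expected behaviour of derivatives. -/
structure IsModelCoords (z : TotalSpace F E → ι → ℝ) : Prop where
  isLocalCoordinate : IsLocalCoordinate ((𝓡 n).prod 𝓘(ℝ, F)) z (TotalSpace.proj ⁻¹' (U : Set M))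
  psi_c (k : ι) (e : TotalSpace F E) : e.proj ∈ U → θ.psi (S.c k) e = z e k
  smooth_psi {V : Opens M} (hV : V ≤ U) (f : O.Sec V) :
    ContMDiffOn ((𝓡 n).prod 𝓘(ℝ, F)) 𝓘(ℝ) ∞ (θ.psi f) (TotalSpace.proj ⁻¹' (V : Set M))
  mvfderiv_psi {V : Opens M} (hV : V ≤ U) (f : O.Sec V) (e : TotalSpace F E) (he : e.proj ∈ V)
    (v : TangentSpace ((𝓡 n).prod 𝓘(ℝ, F)) e) :
    mvfderiv ((𝓡 n).prod 𝓘(ℝ, F)) (θ.psi f) e v =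
      ∑ k, mvfderiv ((𝓡 n).prod 𝓘(ℝ, F)) z e v k * θ.psiDir (S.p k) (S.d k ⟨V, hV⟩ f) e

namespace IsModelCoords

variable {θ S D} {z : TotalSpace F E → ι → ℝ} (hz : θ.IsModelCoords S z)

theorem isOpen_preimage (V : Opens M) :
    IsOpen ((TotalSpace.proj : TotalSpace F E → M) ⁻¹' (V : Set M)) :=
  V.isOpen.preimage (FiberBundle.continuous_proj F E)

include hz in
theorem restrict {V : Opens M} (h : V ≤ U) : θ.IsModelCoords (S.restrict h) z where
  isLocalCoordinate := hz.isLocalCoordinate.mono (Set.preimage_mono h) (isOpen_preimage V)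
  psi_c k e he := (θ.psi_res h (S.c k) he).trans (hz.psi_c k e (h he))
  smooth_psi hV f := hz.smooth_psi (hV.trans h) f
  mvfderiv_psi hV f e he v := hz.mvfderiv_psi (hV.trans h) f e he v

end IsModelCoords

/-- Christoffel symbols restrict well because `∇` is a morphism of sheaves. -/
theorem redChristoffel_restrict {V : Opens M} (h : V ≤ U) (μ ν κ : ι) {e : TotalSpace F E}
    (he : e.proj ∈ V) :
    θ.redChristoffel (S.restrict h) D μ ν κ e = θ.redChristoffel S D μ ν κ e := by
  have key : (S.restrict h).christoffel D μ ν κ = O.res h (S.christoffel D μ ν κ) := by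
    have h1 : (S.restrict h).D μ = O.resTangent h (S.D μ) := rfl
    have h2 : (S.restrict h).D ν = O.resTangent h (S.D ν) := rfl
    have h3 : (D.nabla U (S.D μ) (S.D ν)).1 ∈ O.superDer U (S.p μ + S.p ν) :=
      D.nabla_even U _ _ _ _ (S.d_mem μ) (S.d_mem ν)
    rw [SuperCoords.christoffel, h1, h2, ← D.nabla_res]
    exact (h3.1 U V le_rfl h (S.c κ)).symm
  have hp : (S.restrict h).p = S.p := rfl
  simp only [redChristoffel, psiDir, key, hp, θ.psi_res h _ he, θ.val_res h _ he]

theorem redGamma_restrict {V : Opens M} (h : V ≤ U) {e : TotalSpace F E}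
    (he : e.proj ∈ V) : θ.redGamma (S.restrict h) D e = θ.redGamma S D e := by
  simp only [redGamma, θ.redChristoffel_restrict S D h _ _ _ he]

namespace IsModelCoords

variable {θ S D} {z : TotalSpace F E → ι → ℝ} (hz : θ.IsModelCoords S z)

include hz

theorem smooth_val {V : Opens M} (hV : V ≤ U) (f : O.Sec V) :
    ContMDiffOn ((𝓡 n).prod 𝓘(ℝ, F)) 𝓘(ℝ) ∞ (fun e : TotalSpace F E => θ.val f e.proj)
      (TotalSpace.proj ⁻¹' (V : Set M)) := by
  have h1 : ContMDiff ((𝓡 n).prod 𝓘(ℝ, F)) ((𝓡 n).prod 𝓘(ℝ, F)) ∞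
      (fun e : TotalSpace F E => (⟨e.proj, 0⟩ : TotalSpace F E)) :=
    (Bundle.contMDiff_zeroSection ℝ E).comp (Bundle.contMDiff_proj E)
  exact (hz.smooth_psi hV f).comp h1.contMDiffOn fun e he => he

theorem smooth_redGamma {e : TotalSpace F E} (he : e.proj ∈ U) :
    ContMDiffAt ((𝓡 n).prod 𝓘(ℝ, F)) 𝓘(ℝ, (ι → ℝ) →L[ℝ] (ι → ℝ) →L[ℝ] (ι → ℝ)) ∞
      (θ.redGamma S D) e := by
  have h0 : ∀ μ ν κ, ContMDiffAt ((𝓡 n).prod 𝓘(ℝ, F)) 𝓘(ℝ) ∞ (θ.redChristoffel S D μ ν κ) e := by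
    intro μ ν κ
    have hn := (isOpen_preimage (F := F) (E := E) U).mem_nhds he
    have h1 := (hz.smooth_psi le_rfl (S.christoffel D μ ν κ)).contMDiffAt hn
    have h2 := (hz.smooth_val le_rfl (S.christoffel D μ ν κ)).contMDiffAt hn
    unfold redChristoffel psiDir
    by_cases hμ : S.p μ = 0
    · by_cases hν : S.p ν = 0
      · simpa only [hμ, hν, if_true] using h1
      · simpa only [hμ, hν, if_true, if_false] using h2
    · by_cases hν : S.p ν = 0
      · simpa only [hμ, hν, if_true, if_false] using h2
      · simpa only [hμ, hν, if_false] using contMDiffAt_const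
  unfold redGamma bilinearOfComponents
  refine ContMDiffAt.sum fun κ _ => ContMDiffAt.sum fun ν _ => ContMDiffAt.sum fun μ _ => ?_
  exact (h0 μ ν κ).smul contMDiffAt_const

/-- A vector field which corresponds to an even superderivation on the coordinates does so on all
sections. -/
theorem mvfderiv_psi_eq {V : Opens M} (hV : V ≤ U) {X : O.LinFamily V} (hX : X ∈ O.superDer V 0)
    {e : TotalSpace F E} {v : TangentSpace ((𝓡 n).prod 𝓘(ℝ, F)) e}
    (hv : ∀ k, mvfderiv ((𝓡 n).prod 𝓘(ℝ, F)) z e v k = θ.psi (X ⟨V, le_rfl⟩ (O.res hV (S.c k))) e)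
    {W : Opens M} (hW : W ≤ V) (he' : e.proj ∈ W) (f : O.Sec W) :
    mvfderiv ((𝓡 n).prod 𝓘(ℝ, F)) (θ.psi f) e v = θ.psi (X ⟨W, hW⟩ f) e := by
  rw [hz.mvfderiv_psi (hW.trans hV) f e he', θ.psi_superDer_apply (S.restrict hV) hX hW f he']
  exact Finset.sum_congr rfl fun k _ => by rw [hv]; rfl

/-- The derivative formula for `ψ`, applied to `c_k` itself, reduces by duality to one summand. -/
theorem mvfderiv_apply_eq_mvfderiv_psi {e : TotalSpace F E} (he : e.proj ∈ U)
    (v : TangentSpace ((𝓡 n).prod 𝓘(ℝ, F)) e) (k : ι) :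
    mvfderiv ((𝓡 n).prod 𝓘(ℝ, F)) z e v k =
      mvfderiv ((𝓡 n).prod 𝓘(ℝ, F)) (θ.psi (S.c k)) e v := by
  rw [hz.mvfderiv_psi le_rfl _ e he]
  simp only [S.dual, psiDir]
  rw [Finset.sum_eq_single k]
  · have h1 := θ.val_algebraMap (V := U) 1 he
    rw [map_one] at h1
    have h2 : θ.psi (1 : O.Sec U) e = 1 := by
      rw [θ.psi_even (SuperalgebraSheaf.one_mem_parity U) he, h1]
    simp [h1, h2]
  · intro l _ hl
    simp only [if_neg hl]
    have : θ.psi (0 : O.Sec U) e = 0 := (θ.psiHom e).map_zero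
    have h3 : θ.val (0 : O.Sec U) e.proj = 0 := (θ.psiHom _).map_zero
    simp [this, h3]
  · simp

/-- The connection with Christoffel symbols `redGamma` reduces `D`. -/
theorem mvfderiv_psi_christoffelCov {V : Opens M} (hV : V ≤ U) {X Y : O.tangent V}
    (hX : X.1 ∈ O.superDer V 0) (hY : Y.1 ∈ O.superDer V 0) {X' Y' : VField n F E}
    (hX' : ∀ e : TotalSpace F E, e.proj ∈ V → ∀ k,
      mvfderiv ((𝓡 n).prod 𝓘(ℝ, F)) z e (X' e) k = θ.psi (X.1 ⟨V, le_rfl⟩ (O.res hV (S.c k))) e)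
    (hY' : ∀ e : TotalSpace F E, e.proj ∈ V → ∀ k,
      mvfderiv ((𝓡 n).prod 𝓘(ℝ, F)) z e (Y' e) k = θ.psi (Y.1 ⟨V, le_rfl⟩ (O.res hV (S.c k))) e)
    {W : Opens M} (hW : W ≤ V) (f : O.Sec W) {e : TotalSpace F E} (he : e.proj ∈ W) :
    mvfderiv ((𝓡 n).prod 𝓘(ℝ, F)) (θ.psi f) e
        (christoffelCov ((𝓡 n).prod 𝓘(ℝ, F)) z (θ.redGamma S D) Y' e (X' e)) =
      θ.psi ((D.nabla V X Y).1 ⟨W, hW⟩ f) e := by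
  have heV := hW he
  have hN : (D.nabla V X Y).1 ∈ O.superDer V 0 := by
    have := D.nabla_even V 0 0 X Y hX hY
    rwa [zero_add] at this
  refine hz.mvfderiv_psi_eq hV hN (fun κ => ?_) hW he f
  rw [hz.isLocalCoordinate.mvfderiv_christoffelCov (hV heV), Pi.add_apply]
  have := θ.psi_nabla_apply_coord (S.restrict hV) D hX hY κ heV
  refine Eq.trans ?_ this.symm
  congr 1
  -- Near `e` the components of `Y'` are the functions `ψ(Y c_l)`, and `X'` differentiates `ψ` of
  -- any section as `X` does. So the derivative term is `ψ(X(Y c_κ))`, even when `Y c_κ` is not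
  -- affine.
  · rw [← hz.mvfderiv_psi_eq hV hX (hX' e heV) le_rfl heV]
    have hev : ∀ l, (fun e' => mvfderiv ((𝓡 n).prod 𝓘(ℝ, F)) z e' (Y' e') l) =ᶠ[nhds e]
        θ.psi (Y.1 ⟨V, le_rfl⟩ (O.res hV (S.c l))) := fun l => by
      filter_upwards [(isOpen_preimage V).mem_nhds heV] with e' he'
      exact hY' e' he' l
    have hs : ContMDiffAt ((𝓡 n).prod 𝓘(ℝ, F)) 𝓘(ℝ, ι → ℝ) ∞
        (fun e' => mvfderiv ((𝓡 n).prod 𝓘(ℝ, F)) z e' (Y' e')) e :=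
      contMDiffAt_pi_space.2 fun l => ((hz.smooth_psi hV _).contMDiffAt
        ((isOpen_preimage V).mem_nhds heV)).congr_of_eventuallyEq (hev l)
    rw [mvfderiv_pi_apply (hs.mdifferentiableAt (by simp)), mvfderiv_congr (hev κ)]
    rfl
  -- The Christoffel term; the first argument of the bilinear map carries the index `ν` of `Y`, the
  -- second the index `μ` of `X`.
  · rw [redGamma, bilinearOfComponents_apply]
    refine Finset.sum_congr rfl fun ν _ => Finset.sum_congr rfl fun μ _ => ?_
    rw [hX' e heV, hY' e heV, ← θ.redChristoffel_restrict S D hV _ _ _ heV]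
    rfl

end IsModelCoords

end ModelIso

namespace SuperCoords

variable (S : SuperCoords O U ι)

/-- The even superderivation `∂_k` or `c_k ∂_k`, according to the parity of `c_k`. -/
def testDer (k : ι) : O.LinFamily U :=
  if S.p k = 0 then S.d k else O.smulFamily (S.c k) (S.d k)

theorem testDer_mem (k : ι) : S.testDer k ∈ O.superDer U 0 := by
  have h := S.d_mem k
  have hc := S.c_mem k
  rcases even_or_odd (S.p k) with hp | hp
  · rw [testDer, if_pos hp, ← hp]
    exact h
  · rw [testDer, if_neg (by rw [hp]; exact one_ne_zero)]
    have := O.smulFamily_mem_superDer hc h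
    rwa [hp, show (1 + 1 : ZMod 2) = 0 by decide] at this

theorem testDer_coord (k l : ι) : S.testDer k ⟨U, le_rfl⟩ (S.c l) =
    if k = l then (if S.p k = 0 then 1 else S.c k) else 0 := by
  rcases even_or_odd (S.p k) with hp | hp
  · simp only [testDer, hp, if_true, S.dual]
  · simp only [testDer, hp, one_ne_zero, if_false]
    change O.res _ (S.c k) * S.d k ⟨U, le_rfl⟩ (S.c l) = _
    rw [S.dual, SuperalgebraSheaf.res_self]
    split_ifs <;> simp

/-- The superderivations `testDer` as sections of the tangent sheaf. -/
def testTangent (k : ι) : O.tangent U :=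
  ⟨S.testDer k, SuperalgebraSheaf.superDer_le_tangent _ (S.testDer_mem k)⟩

/-- The factor of `∂_k` in the vector field corresponding to `testDer k`. -/
def testScale (z : TotalSpace F E → ι → ℝ) (k : ι) (e : TotalSpace F E) : ℝ :=
  if S.p k = 0 then 1 else z e k

/-- The vector field corresponding to `testDer k`. -/
def testField (z : TotalSpace F E → ι → ℝ) (k : ι) : VField n F E :=
  S.testScale z k • constField ((𝓡 n).prod 𝓘(ℝ, F)) z (Pi.single k 1)

end SuperCoords

namespace ModelIso.IsModelCoords

variable {θ : BatchelorModel (n := n) O F E} {S : SuperCoords O U ι} {D : O.Connection}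
  {z : TotalSpace F E → ι → ℝ} (hz : θ.IsModelCoords S z)

include hz

theorem smooth_testScale (k : ι) {e : TotalSpace F E} (he : e.proj ∈ U) :
    ContMDiffAt ((𝓡 n).prod 𝓘(ℝ, F)) 𝓘(ℝ) ∞ (S.testScale z k) e := by
  unfold SuperCoords.testScale
  split_ifs
  · exact contMDiffAt_const
  · exact contMDiffAt_pi_space.1 (hz.isLocalCoordinate.smoothAt he) k

theorem smooth_testField (k : ι) {e : TotalSpace F E} (he : e.proj ∈ U) :
    ContMDiffAt ((𝓡 n).prod 𝓘(ℝ, F)) ((𝓡 n).prod 𝓘(ℝ, F)).tangent ∞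
      (fun e => (⟨e, S.testField z k e⟩ :
        TangentBundle ((𝓡 n).prod 𝓘(ℝ, F)) (TotalSpace F E))) e := by
  have := hz.isLocalCoordinate.contMDiffAt_constField he (Pi.single k 1)
  exact (hz.smooth_testScale k he).smul_section this

theorem mvfderiv_testField (k l : ι) {e : TotalSpace F E} (he : e.proj ∈ U) :
    mvfderiv ((𝓡 n).prod 𝓘(ℝ, F)) z e (S.testField z k e) l =
      θ.psi (S.testDer k ⟨U, le_rfl⟩ (S.c l)) e := by
  have h1 : S.testField z k e =
      S.testScale z k e • constField ((𝓡 n).prod 𝓘(ℝ, F)) z (Pi.single k 1) e := rfl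
  rw [h1, map_smul, hz.isLocalCoordinate.mvfderiv_constField he, S.testDer_coord]
  have h2 : θ.psi (1 : O.Sec U) e = 1 := by
    have := θ.val_algebraMap (V := U) 1 he
    rw [map_one] at this
    rw [θ.psi_even (SuperalgebraSheaf.one_mem_parity U) he, this]
  have h3 : θ.psi (0 : O.Sec U) e = 0 := (θ.psiHom e).map_zero
  by_cases hkl : k = l
  · subst hkl
    rw [if_pos rfl]
    unfold SuperCoords.testScale
    split_ifs
    · simp [h2]
    · simp [hz.psi_c k e he]
  · rw [if_neg hkl, h3]
    simp [Pi.single_eq_of_ne (Ne.symm hkl)]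

/-- The coordinates do not vanish on a dense set. -/
theorem exists_testScale_ne_zero (k : ι) {W : Set (TotalSpace F E)} (hW : IsOpen W)
    (hWU : W ⊆ TotalSpace.proj ⁻¹' (U : Set M)) (hne : W.Nonempty) :
    ∃ e ∈ W, S.testScale z k e ≠ 0 := by
  by_contra! hcon
  obtain ⟨e, he⟩ := hne
  -- For an even coordinate the scale is the constant `1`. For an odd one, vanishing on an open set
  -- would force the derivative of `z_k` to vanish there, but it is `1` on the `k`-th coordinate
  -- field.
  have hp : S.p k ≠ 0 := by
    intro hp
    have := hcon e he
    simp [SuperCoords.testScale, hp] at this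
  have hev : (fun e => z e k) =ᶠ[nhds e] fun _ => (0 : ℝ) := by
    filter_upwards [hW.mem_nhds he] with e' he'
    have := hcon e' he'
    rwa [SuperCoords.testScale, if_neg hp] at this
  have h1 := mvfderiv_pi_apply ((hz.isLocalCoordinate.smoothAt (hWU he)).mdifferentiableAt
    (by simp)) k (constField ((𝓡 n).prod 𝓘(ℝ, F)) z (Pi.single k 1) e)
  rw [hz.isLocalCoordinate.mvfderiv_constField (hWU he), mvfderiv_congr hev, mvfderiv_const] at h1
  simp at h1

/-- A connection with continuous components which reduces `D` on the test fields is the connection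
with Christoffel symbols `redGamma`. -/
theorem eq_christoffelCov
    {C : VField n F E → (e : TotalSpace F E) → TangentSpace ((𝓡 n).prod 𝓘(ℝ, F)) e →L[ℝ]
      TangentSpace ((𝓡 n).prod 𝓘(ℝ, F)) e}
    (hC : IsCovariantDerivativeOn (EuclideanSpace ℝ (Fin n) × F) C
      (TotalSpace.proj ⁻¹' (U : Set M)))
    (hcont : ∀ μ ν, ContinuousOn (fun e => mvfderiv ((𝓡 n).prod 𝓘(ℝ, F)) z e
      (C (constField ((𝓡 n).prod 𝓘(ℝ, F)) z (Pi.single ν 1)) e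
        (constField ((𝓡 n).prod 𝓘(ℝ, F)) z (Pi.single μ 1) e))) (TotalSpace.proj ⁻¹' (U : Set M)))
    (hred : ∀ μ ν κ, ∀ e : TotalSpace F E, e.proj ∈ U →
      mvfderiv ((𝓡 n).prod 𝓘(ℝ, F)) (θ.psi (S.c κ)) e
        (C (S.testField z ν) e (S.testField z μ e)) =
      θ.psi ((D.nabla U (S.testTangent μ) (S.testTangent ν)).1 ⟨U, le_rfl⟩ (S.c κ)) e)
    {Y : VField n F E} {e : TotalSpace F E} (he : e.proj ∈ U)
    (hY : MDifferentiableAt ((𝓡 n).prod 𝓘(ℝ, F)) ((𝓡 n).prod 𝓘(ℝ, F)).tangent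
      (fun e => (⟨e, Y e⟩ : TangentBundle ((𝓡 n).prod 𝓘(ℝ, F)) (TotalSpace F E))) e) :
    C Y e = christoffelCov ((𝓡 n).prod 𝓘(ℝ, F)) z (θ.redGamma S D) Y e := by
  have hcov := hz.isLocalCoordinate.isCovariantDerivativeOn_christoffelCov (Γ := θ.redGamma S D)
  -- `A` is the tensor by which `C` differs from the connection with symbols `redGamma`.
  set A := IsCovariantDerivativeOn.difference hC hcov with hA
  have hdiff : ∀ ν, ∀ e : TotalSpace F E, e.proj ∈ U → _ := fun ν e he =>
    (hz.isLocalCoordinate.contMDiffAt_constField he (Pi.single ν 1)).mdifferentiableAt (by simp)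
  have hAe : ∀ μ ν, ∀ e : TotalSpace F E, e.proj ∈ U →
      mvfderiv ((𝓡 n).prod 𝓘(ℝ, F)) z e
        (A e (constField ((𝓡 n).prod 𝓘(ℝ, F)) z (Pi.single ν 1) e)
          (constField ((𝓡 n).prod 𝓘(ℝ, F)) z (Pi.single μ 1) e)) =
      mvfderiv ((𝓡 n).prod 𝓘(ℝ, F)) z e
        (C (constField ((𝓡 n).prod 𝓘(ℝ, F)) z (Pi.single ν 1)) e
          (constField ((𝓡 n).prod 𝓘(ℝ, F)) z (Pi.single μ 1) e)) -
        θ.redGamma S D e (Pi.single ν 1) (Pi.single μ 1) := by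
    intro μ ν e he
    rw [hA, IsCovariantDerivativeOn.difference_apply hC hcov he (hdiff ν e he), sub_apply, map_sub,
      hz.isLocalCoordinate.mvfderiv_christoffelCov_constField he,
      hz.isLocalCoordinate.mvfderiv_constField he]
  -- Both connections reduce `D` on the test fields, so `A` vanishes there; being tensorial, `A`
  -- takes the scale factors out.
  have hscale : ∀ μ ν, ∀ e : TotalSpace F E, e.proj ∈ U →
      S.testScale z ν e * (S.testScale z μ e) = 0 ∨
      mvfderiv ((𝓡 n).prod 𝓘(ℝ, F)) z e
        (A e (constField ((𝓡 n).prod 𝓘(ℝ, F)) z (Pi.single ν 1) e)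
          (constField ((𝓡 n).prod 𝓘(ℝ, F)) z (Pi.single μ 1) e)) = 0 := by
    intro μ ν e he
    have h1 : A e (S.testField z ν e) (S.testField z μ e) = 0 := by
      refine hz.isLocalCoordinate.injective he ?_
      rw [map_zero]
      have hT := (hz.smooth_testField ν he).mdifferentiableAt (by simp)
      rw [hA, IsCovariantDerivativeOn.difference_apply hC hcov he hT, sub_apply, map_sub, sub_eq_zero]
      ext κ
      rw [hz.mvfderiv_apply_eq_mvfderiv_psi he, hz.mvfderiv_apply_eq_mvfderiv_psi he, hred μ ν κ e he]
      refine (hz.mvfderiv_psi_christoffelCov le_rfl (X := S.testTangent μ) (Y := S.testTangent ν)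
        (S.testDer_mem μ) (S.testDer_mem ν) (fun e he k => ?_) (fun e he k => ?_) le_rfl
          (S.c κ) he).symm
      · rw [hz.mvfderiv_testField μ k he, SuperalgebraSheaf.res_self]; rfl
      · rw [hz.mvfderiv_testField ν k he, SuperalgebraSheaf.res_self]; rfl
    have h2 : A e (S.testField z ν e) (S.testField z μ e) =
        (S.testScale z ν e * S.testScale z μ e) •
          A e (constField ((𝓡 n).prod 𝓘(ℝ, F)) z (Pi.single ν 1) e)
          (constField ((𝓡 n).prod 𝓘(ℝ, F)) z (Pi.single μ 1) e) := by
      simp only [SuperCoords.testField, Pi.smul_apply', map_smul, smul_apply, smul_smul]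
      rw [mul_comm]
    rw [h2, smul_eq_zero] at h1
    rcases h1 with h1 | h1
    · exact .inl h1
    · exact .inr (by rw [h1, map_zero])
  refine hz.isLocalCoordinate.eq_christoffelCov_of_basis hC he (Pi.basisFun ℝ ι) (fun μ ν => ?_) hY
  rw [Pi.basisFun_apply, Pi.basisFun_apply, ← sub_eq_zero, ← hAe μ ν e he]
  by_contra hne
  have hcontA : ContinuousOn (fun e => mvfderiv ((𝓡 n).prod 𝓘(ℝ, F)) z e
        (A e (constField ((𝓡 n).prod 𝓘(ℝ, F)) z (Pi.single ν 1) e)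
          (constField ((𝓡 n).prod 𝓘(ℝ, F)) z (Pi.single μ 1) e)))
      (TotalSpace.proj ⁻¹' (U : Set M)) := by
    refine ((hcont μ ν).sub (fun e he => ?_)).congr fun e he => hAe μ ν e he
    have h3 := (hz.smooth_redGamma (D := D) he).continuousAt
    exact ((h3.clm_apply continuousAt_const).clm_apply continuousAt_const).continuousWithinAt
  -- If this component of `A` were nonzero at `e`, it would be nonzero on an open set. Shrinking
  -- twice gives a point of that set at which both scales are nonzero, against `hscale`.
  have hopen := hcontA.isOpen_inter_preimage (isOpen_preimage U) isOpen_compl_singleton (t := {0}ᶜ)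
  obtain ⟨e₁, ⟨he₁, hne₁⟩, hs₁⟩ := hz.exists_testScale_ne_zero μ hopen Set.inter_subset_left
    ⟨e, he, hne⟩
  have hcs : ContinuousOn (S.testScale z μ) (TotalSpace.proj ⁻¹' (U : Set M)) := fun e he =>
    (hz.smooth_testScale μ he).continuousAt.continuousWithinAt
  have hopen' := (hcs.mono Set.inter_subset_left).isOpen_inter_preimage hopen
    isOpen_compl_singleton (t := {0}ᶜ)
  obtain ⟨e₂, ⟨⟨he₂, hne₂⟩, hs₂⟩, hs₃⟩ := hz.exists_testScale_ne_zero ν hopen'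
    (Set.inter_subset_left.trans Set.inter_subset_left) ⟨e₁, ⟨he₁, hne₁⟩, hs₁⟩
  rcases hscale μ ν e₂ he₂ with h | h
  · exact mul_ne_zero hs₃ hs₂ h
  · exact hne₂ h

end ModelIso.IsModelCoords

end ModelCoordinates

/-! ### From a Batchelor model and a trivialization of `E` to a local model. -/

section LocalTrivialization

variable {n : ℕ} {M : Type u} [TopologicalSpace M] [ChartedSpace (EuclideanSpace ℝ (Fin n)) M]
  [IsManifold (𝓡 n) ∞ M]
  {F : Type*} [NormedAddCommGroup F] [NormedSpace ℝ F] [FiniteDimensional ℝ F]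
  {E : M → Type*} [∀ x, AddCommGroup (E x)] [∀ x, Module ℝ (E x)] [∀ x, TopologicalSpace (E x)]
  [TopologicalSpace (TotalSpace F E)] [FiberBundle F E] [VectorBundle ℝ F E]
  [ContMDiffVectorBundle ∞ F E (𝓡 n)]
  {O : SuperalgebraSheaf.{u, w} M}
  (t : Trivialization F (TotalSpace.proj : TotalSpace F E → M)) [MemTrivializationAtlas t]

/-- A trivialization of `E` as a map on the fibres of the exterior bundle. -/
def extTriv (x : M) : ExtDual E x →ₐ[ℝ] ExtAlg F :=
  ExteriorAlgebra.map (t.symmₗ ℝ x).dualMap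

/-- The inverse of `extTriv`. -/
def extTrivSymm (x : M) : ExtAlg F →ₐ[ℝ] ExtDual E x :=
  ExteriorAlgebra.map (t.linearMapAt ℝ x).dualMap

variable {t}

theorem extTriv_extTrivSymm {x : M} (hx : x ∈ t.baseSet) (a : ExtAlg F) :
    extTriv t x (extTrivSymm t x a) = a := by
  have h : (t.symmₗ ℝ x).dualMap ∘ₗ (t.linearMapAt ℝ x).dualMap = LinearMap.id := by
    ext l v
    simp [t.linearMapAt_symmₗ (R := ℝ) hx]
  have := ExteriorAlgebra.map_comp_map (t.linearMapAt ℝ x).dualMap (t.symmₗ ℝ x).dualMap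
  rw [h, ExteriorAlgebra.map_id] at this
  exact DFunLike.congr_fun this a

theorem extTrivSymm_extTriv {x : M} (hx : x ∈ t.baseSet) (a : ExtDual E x) :
    extTrivSymm t x (extTriv t x a) = a := by
  have h : (t.linearMapAt ℝ x).dualMap ∘ₗ (t.symmₗ ℝ x).dualMap = LinearMap.id := by
    ext l v
    simp [t.symmₗ_linearMapAt (R := ℝ) hx]
  have := ExteriorAlgebra.map_comp_map (t.symmₗ ℝ x).dualMap (t.linearMapAt ℝ x).dualMap
  rw [h, ExteriorAlgebra.map_id] at this
  exact DFunLike.congr_fun this a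

/-- Forms are transported contragrediently to vectors, so the evaluation pairing is unchanged. -/
theorem affineEval_extTriv {e : TotalSpace F E} (he : e.proj ∈ t.baseSet) (a : ExtDual E e.proj) :
    affineEval (t e).2 (extTriv t e.proj a) = affineEval e.2 a := by
  rw [affineEval_apply, affineEval_apply, extTriv, algebraMapInv_map, ιInv_map,
    LinearMap.dualMap_apply]
  have : t.symmₗ ℝ e.proj (t e).2 = e.2 := by
    have h := t.symmₗ_linearMapAt (R := ℝ) he e.2
    rwa [t.linearMapAt_apply, if_pos he] at h
  rw [this]

theorem contMDiffOn_trivialization_symm (v : F) : ContMDiffOn (𝓡 n) ((𝓡 n).prod 𝓘(ℝ, F)) ∞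
    (fun y => (⟨y, t.symmₗ ℝ y v⟩ : TotalSpace F E)) t.baseSet := by
  have h : ContMDiffOn (𝓡 n) ((𝓡 n).prod 𝓘(ℝ, F)) ∞ (fun y : M => (y, v)) t.baseSet :=
    (contMDiff_id.prodMk contMDiff_const).contMDiffOn
  refine ((t.contMDiffOn_symm (IB := 𝓡 n) (n := ∞)).comp h fun y hy => ?_).congr fun y hy => ?_
  · exact t.mem_target.2 hy
  · rw [t.symmₗ_apply (R := ℝ) hy, Function.comp_apply]
    exact t.mk_symm hy v

theorem contMDiffOn_trivialization_snd : ContMDiffOn ((𝓡 n).prod 𝓘(ℝ, F)) 𝓘(ℝ, F) ∞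
    (fun e : TotalSpace F E => (t e).2) (TotalSpace.proj ⁻¹' t.baseSet) := by
  have := t.contMDiffOn (IB := 𝓡 n) (n := ∞)
  rw [t.source_eq] at this
  exact contMDiff_snd.comp_contMDiffOn this

/-- A section of the exterior bundle generated by smooth functions and smooth sections of the dual
bundle is smooth in a trivialization. -/
theorem smoothComponents_extTriv {W : Set M} (hW : W ⊆ t.baseSet) {s : (x : M) → ExtDual E x}
    (hs : s ∈ Algebra.adjoin ℝ (smoothGenerators (n := n) F E W)) :
    SmoothComponents n (fun y => extTriv t y (s y)) W := by
  induction hs using Algebra.adjoin_induction with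
  | mem s hs =>
    rcases hs with ⟨f, hf, rfl⟩ | ⟨s, hs, rfl⟩
    · simp only [AlgHom.commutes]
      exact LocalModel.smooth_algebraMap hf
    · let b := Module.finBasis ℝ F
      -- The coefficients of `s` in the dual frame are its values on the frame of `E`, which are
      -- smooth because the fibrewise linear function of `s` is smooth and the frame is a smooth map
      -- to the total space.
      have h : ∀ y, extTriv t y (ExteriorAlgebra.ι ℝ (s y)) =
          ∑ i, s y (t.symmₗ ℝ y (b i)) • ExteriorAlgebra.ι ℝ (b.coord i) := by
        intro y
        have h1 : (t.symmₗ ℝ y).dualMap (s y) =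
            ∑ i, s y (t.symmₗ ℝ y (b i)) • b.coord i := by
          refine b.ext fun j => ?_
          simp [LinearMap.sum_apply, Finsupp.single_apply]
        rw [extTriv, ExteriorAlgebra.map_apply_ι, h1, map_sum]
        simp only [map_smul]
      simp only [h]
      refine SmoothComponents.sum _ fun i _ => SmoothComponents.smul ?_ (SmoothComponents.const _)
      exact hs.comp ((contMDiffOn_trivialization_symm (b i)).mono hW) fun y hy => hy
  | algebraMap r =>
    simp only [Pi.algebraMap_apply, AlgHom.commutes]
    exact SmoothComponents.const _
  | add a b _ _ ha hb =>
    simp only [Pi.add_apply, map_add]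
    exact ha.add hb
  | mul a b _ _ ha hb =>
    simp only [Pi.mul_apply, map_mul]
    exact ha.mul hb

/-- A constant linear form, read in the trivialization, is a smooth section of `E*`; products and
sums of these give all constant elements. -/
theorem extTrivSymm_mem_adjoin {W : Set M} (hW : W ⊆ t.baseSet) (a : ExtAlg F) :
    (fun x => extTrivSymm t x a) ∈
      Algebra.adjoin ℝ (smoothGenerators (n := n) F E W) := by
  induction a using ExteriorAlgebra.induction with
  | algebraMap r =>
    simp only [AlgHom.commutes]
    exact Subalgebra.algebraMap_mem _ r
  | ι l =>
    refine Algebra.subset_adjoin (Or.inr ⟨fun x => (t.linearMapAt ℝ x).dualMap l, ?_, ?_⟩)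
    · refine ((LinearMap.toContinuousLinearMap l).contMDiff.comp_contMDiffOn
        ((contMDiffOn_trivialization_snd (t := t)).mono (Set.preimage_mono hW))).congr fun e he => ?_
      simp [t.coe_linearMapAt_of_mem (R := ℝ) (hW he)]
    · funext x
      rw [extTrivSymm, ExteriorAlgebra.map_apply_ι]
  | mul a b ha hb =>
    simp only [map_mul]
    exact Subalgebra.mul_mem _ ha hb
  | add a b ha hb =>
    simp only [map_add]
    exact Subalgebra.add_mem _ ha hb

theorem SmoothComponents.of_forall_nhds {Λ : Type*} [Ring Λ] [Algebra ℝ Λ] {a : M → Λ} {V : Set M}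
    (h : ∀ x ∈ V, ∃ W, IsOpen W ∧ x ∈ W ∧ SmoothComponents n a W) : SmoothComponents n a V := by
  intro l x hx
  obtain ⟨W, hW, hxW, ha⟩ := h x hx
  exact ((ha l).contMDiffAt (hW.mem_nhds hxW)).contMDiffWithinAt

namespace ModelIso

variable (θ : BatchelorModel (n := n) O F E)

open Classical in
/-- The local model of `O` defined by a Batchelor model and a trivialization of `E`. -/
def localModel {U : Opens M} (hU : (U : Set M) ⊆ t.baseSet) : LocalModel n O F U where
  hat V :=
    { toFun := fun f y => if h : y ∈ V then extTriv t y ((θ.equiv V le_top f).1 ⟨y, h⟩) else 0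
      map_add' := fun f g => by
        funext y
        by_cases h : y ∈ V <;> simp [h]
      map_smul' := fun r f => by
        funext y
        by_cases h : y ∈ V <;> simp [h] }
  hat_one {V} hV y hy := by simp [hy]
  hat_mul {V} hV f g y hy := by simp [hy]
  hat_res {V W} hV h f y hy := by
    simp only [LinearMap.coe_mk, AddHom.coe_mk, hy, h hy, dif_pos]
    rw [θ.equiv_res le_top h f ⟨y, hy⟩]
  hat_smooth {V} hV f := by
    refine SmoothComponents.of_forall_nhds fun x hx => ?_
    obtain ⟨W, hxW, s, hs, hfs⟩ := (θ.equiv V le_top f).2 ⟨x, hx⟩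
    refine ⟨(V ⊓ W : Opens M), (V ⊓ W).isOpen, ⟨hx, hxW⟩, ?_⟩
    have hs' := Algebra.adjoin_mono (smoothGenerators_mono (n := n) F E
      (V := (W : Set M)) (W := ((V ⊓ W : Opens M) : Set M)) fun y hy => hy.2) hs
    refine (smoothComponents_extTriv (fun y hy => hU (hV hy.1)) hs').congr fun y hy => ?_
    have hy1 : y ∈ V := hy.1
    simp only [LinearMap.coe_mk, AddHom.coe_mk, hy1, dif_pos]
    rw [hfs ⟨y, hy1⟩ hy.2]
  hat_parity {V} hV i f hf y hy := by
    simp only [LinearMap.coe_mk, AddHom.coe_mk, hy, dif_pos]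
    exact map_mem_extParity _ (θ.equiv_parity V le_top i f hf ⟨y, hy⟩)
  hat_inj {V} hV f g h := by
    refine (θ.equiv V le_top).injective (Subtype.ext (funext fun y => ?_))
    have := h y y.2
    simp only [LinearMap.coe_mk, AddHom.coe_mk, y.2, dif_pos] at this
    have h2 := congrArg (extTrivSymm t (y : M)) this
    rwa [extTrivSymm_extTriv (hU (hV y.2)), extTrivSymm_extTriv (hU (hV y.2))] at h2
  exists_hat {V} hV a ha := by
    let B := Module.finBasis ℝ (ExtAlg F)
    -- Expanded in a basis, the section is a sum of smooth functions times elements that are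
    -- constant in the trivialization, so it lies in the generated algebra.
    have hmem : (fun y : V => extTrivSymm t (y : M) (a y)) ∈ forms (n := n) F E V := by
      intro x
      refine ⟨V, x.2, ∑ i, (fun y => algebraMap ℝ (ExtDual E y) (B.coord i (a y))) *
        (fun y => extTrivSymm t y (B i)), ?_, fun y hy => ?_⟩
      · refine Subalgebra.sum_mem _ fun i _ => Subalgebra.mul_mem _ ?_
          (extTrivSymm_mem_adjoin (fun y hy => hU (hV hy)) _)
        exact Algebra.subset_adjoin (Or.inl ⟨_, ha (B.coord i), rfl⟩)
      · rw [Finset.sum_apply]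
        refine Eq.trans (congrArg (extTrivSymm t (y : M)) (B.sum_repr (a y)).symm) ?_
        rw [map_sum]
        refine Finset.sum_congr rfl fun i _ => ?_
        rw [map_smul, Algebra.smul_def]
        rfl
    refine ⟨(θ.equiv V le_top).symm ⟨_, hmem⟩, fun y hy => ?_⟩
    simp only [LinearMap.coe_mk, AddHom.coe_mk, hy, dif_pos, AlgEquiv.apply_symm_apply]
    exact extTriv_extTrivSymm (hU (hV hy)) _

variable {U : Opens M} (hU : (U : Set M) ⊆ t.baseSet)

theorem localModel_hat {V : Opens M} (f : O.Sec V) {y : M} (hy : y ∈ V) :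
    (θ.localModel hU).hat V f y = extTriv t y ((θ.equiv V le_top f).1 ⟨y, hy⟩) := by
  simp only [localModel, LinearMap.coe_mk, AddHom.coe_mk, hy, dif_pos]

theorem psi_eq_affineEval_hat {V : Opens M} (hV : V ≤ U) (f : O.Sec V) {e : TotalSpace F E}
    (he : e.proj ∈ V) : θ.psi f e = affineEval (t e).2 ((θ.localModel hU).hat V f e.proj) := by
  rw [θ.localModel_hat hU f he, affineEval_extTriv (hU (hV he)), θ.psi_eq f he]

theorem val_eq_hat {V : Opens M} (f : O.Sec V) {y : M} (hy : y ∈ V) :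
    θ.val f y = ExteriorAlgebra.algebraMapInv ((θ.localModel hU).hat V f y) := by
  rw [θ.localModel_hat hU f hy, extTriv, algebraMapInv_map, θ.val_eq f hy]

theorem isAffine_iff_hat {V : Opens M} (hV : V ≤ U) (f : O.Sec V) :
    IsAffine (θ.equiv V le_top f) ↔ ∀ y ∈ V,
      affineProj _ ((θ.localModel hU).hat V f y) = (θ.localModel hU).hat V f y := by
  constructor
  · intro h y hy
    rw [θ.localModel_hat hU f hy, extTriv, ← map_affineProj,
      (affineProj_eq_self_iff _).2 (h ⟨y, hy⟩)]
  · intro h x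
    have := h x x.2
    rw [θ.localModel_hat hU f x.2, extTriv, ← map_affineProj] at this
    have h2 := congrArg (extTrivSymm t (x : M)) this
    have h3 := extTrivSymm_extTriv (t := t) (hU (hV x.2))
    simp only [extTriv] at h3
    rw [h3, h3] at h2
    exact (affineProj_eq_self_iff _).1 h2

end ModelIso

end LocalTrivialization

theorem mvfderiv_finset_sum {B H N κ : Type*} [NormedAddCommGroup B] [NormedSpace ℝ B]
    [TopologicalSpace H] {I : ModelWithCorners ℝ B H} [TopologicalSpace N] [ChartedSpace H N]
    {f : κ → N → ℝ} {e : N} (s : Finset κ) (hf : ∀ i, MDifferentiableAt I 𝓘(ℝ) (f i) e) :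
    MDifferentiableAt I 𝓘(ℝ) (∑ i ∈ s, f i) e ∧
      mvfderiv I (∑ i ∈ s, f i) e = ∑ i ∈ s, mvfderiv I (f i) e := by
  classical
  induction s using Finset.induction_on with
  | empty => exact ⟨by rw [Finset.sum_empty]; exact mdifferentiableAt_const (c := (0 : ℝ)), by simp [mvfderiv_zero]⟩
  | insert i s hi ih =>
    rw [Finset.sum_insert hi, Finset.sum_insert hi]
    exact ⟨(hf i).add ih.1, by rw [mvfderiv_add (hf i) ih.1, ih.2]⟩

/-! ### Coordinates adapted to a Batchelor model. -/

section SplitCoordinates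

variable {n : ℕ} {M : Type u} [TopologicalSpace M] [ChartedSpace (EuclideanSpace ℝ (Fin n)) M]
  [IsManifold (𝓡 n) ∞ M]
  (F : Type*) [NormedAddCommGroup F] [NormedSpace ℝ F] [FiniteDimensional ℝ F]
  (E : M → Type*) [∀ x, AddCommGroup (E x)] [∀ x, Module ℝ (E x)] [∀ x, TopologicalSpace (E x)]
  [TopologicalSpace (TotalSpace F E)] [FiberBundle F E] [VectorBundle ℝ F E]
  [ContMDiffVectorBundle ∞ F E (𝓡 n)]
  {O : SuperalgebraSheaf.{u, w} M}

/-- The domain around `x₀` of a chart of `M` and of a trivialization of `E`. -/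
def splitOpen (x₀ : M) : Opens M :=
  ⟨(chartAt (EuclideanSpace ℝ (Fin n)) x₀).source ∩ (trivializationAt F E x₀).baseSet,
    (chartAt (EuclideanSpace ℝ (Fin n)) x₀).open_source.inter (trivializationAt F E x₀).open_baseSet⟩

theorem mem_splitOpen (x₀ : M) : x₀ ∈ splitOpen (n := n) F E x₀ :=
  ⟨mem_chart_source _ x₀, FiberBundle.mem_baseSet_trivializationAt' x₀⟩

/-- The coordinates on the total space of `E` given by a chart of `M` and a trivialization. -/
def splitMap (x₀ : M) (e : TotalSpace F E) : LocalModel.Idx n F → ℝ :=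
  Sum.elim (fun i => chartAt (EuclideanSpace ℝ (Fin n)) x₀ e.proj i)
    (fun a => (Module.finBasis ℝ F).coord a (trivializationAt F E x₀ e).2)

variable {F E}

theorem splitMap_eq (x₀ : M) {e : TotalSpace F E} (he : e.proj ∈ splitOpen (n := n) F E x₀) :
    splitMap (n := n) F E x₀ e =
      (((EuclideanSpace.basisFun (Fin n) ℝ).toBasis.prod (Module.finBasis ℝ F)).equivFunL)
        (extChartAt ((𝓡 n).prod 𝓘(ℝ, F)) (⟨x₀, 0⟩ : TotalSpace F E) e) := by
  have h : extChartAt ((𝓡 n).prod 𝓘(ℝ, F)) (⟨x₀, 0⟩ : TotalSpace F E) e =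
      (chartAt (EuclideanSpace ℝ (Fin n)) x₀ e.proj, (trivializationAt F E x₀ e).2) := by
    rw [FiberBundle.extChartAt]
    have h1 : (trivializationAt F E x₀ e).1 = e.proj := (trivializationAt F E x₀).coe_fst' he.2
    simp [h1]
  rw [h]
  funext k
  rcases k with i | a
  · simp [splitMap]
  · simp [splitMap]

theorem isLocalCoordinate_splitMap (x₀ : M) :
    IsLocalCoordinate ((𝓡 n).prod 𝓘(ℝ, F)) (splitMap (n := n) F E x₀)
      (TotalSpace.proj ⁻¹' (splitOpen (n := n) F E x₀ : Set M)) := by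
  set A := (((EuclideanSpace.basisFun (Fin n) ℝ).toBasis.prod (Module.finBasis ℝ F)).equivFunL)
  have ho := (splitOpen (n := n) F E x₀).isOpen.preimage (FiberBundle.continuous_proj F E)
  have hA : ∀ e : TotalSpace F E, e.proj ∈ splitOpen (n := n) F E x₀ →
      splitMap (n := n) F E x₀ =ᶠ[nhds e]
      (A : EuclideanSpace ℝ (Fin n) × F →L[ℝ] _) ∘
        (extChartAt ((𝓡 n).prod 𝓘(ℝ, F)) (⟨x₀, 0⟩ : TotalSpace F E)) := fun e he => by
    filter_upwards [ho.mem_nhds he] with e' he'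
    exact splitMap_eq x₀ he'
  have hsrc : ∀ e : TotalSpace F E, e.proj ∈ splitOpen (n := n) F E x₀ →
      e ∈ (chartAt (ModelProd (EuclideanSpace ℝ (Fin n)) F) (⟨x₀, 0⟩ : TotalSpace F E)).source := by
    intro e he
    rw [FiberBundle.chartedSpace_chartAt]
    simp [Trivialization.mem_source, he.1, he.2]
  refine ⟨ho, ?_, ?_⟩
  · intro e he
    exact (((A : EuclideanSpace ℝ (Fin n) × F →L[ℝ] _).contDiff.contMDiff.contMDiffAt.comp e
      (contMDiffAt_extChartAt' (hsrc e he))).congr_of_eventuallyEq (hA e he)).contMDiffWithinAt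
  · intro e he
    have h1 := isInvertible_mfderiv_extChartAt (I := (𝓡 n).prod 𝓘(ℝ, F))
      (x := (⟨x₀, 0⟩ : TotalSpace F E)) (y := e) (by rw [extChartAt_source]; exact hsrc e he)
    have h2 := (contMDiffAt_extChartAt' (I := (𝓡 n).prod 𝓘(ℝ, F)) (n := ∞)
      (hsrc e he)).mdifferentiableAt (by simp)
    obtain ⟨B, hB⟩ := h1
    refine ⟨B.trans A, ?_⟩
    rw [mvfderiv_congr (hA e he)]
    have := (((A : EuclideanSpace ℝ (Fin n) × F →L[ℝ] (LocalModel.Idx n F → ℝ)).hasMFDerivAt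
      (x := extChartAt ((𝓡 n).prod 𝓘(ℝ, F)) (⟨x₀, 0⟩ : TotalSpace F E) e)).comp e
        h2.hasMFDerivAt).mfderiv
    rw [← hB] at this
    exact this.symm

namespace ModelIso

variable (θ : BatchelorModel (n := n) O F E)

theorem splitOpen_subset_source (x₀ : M) : (splitOpen (n := n) F E x₀ : Set M) ⊆
    (chartAt (EuclideanSpace ℝ (Fin n)) x₀).source := Set.inter_subset_left

theorem splitOpen_subset_baseSet (x₀ : M) : (splitOpen (n := n) F E x₀ : Set M) ⊆
    (trivializationAt F E x₀).baseSet := Set.inter_subset_right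

/-- The local model of `O` around `x₀` defined by a Batchelor model. -/
def splitModel (x₀ : M) : LocalModel n O F (splitOpen (n := n) F E x₀) :=
  θ.localModel (splitOpen_subset_baseSet x₀)

/-- The supercoordinates around `x₀` defined by a Batchelor model. -/
def splitCoords (x₀ : M) : SuperCoords O (splitOpen (n := n) F E x₀) (LocalModel.Idx n F) :=
  (θ.splitModel x₀).superCoords (IsManifold.chart_mem_maximalAtlas x₀) (splitOpen_subset_source x₀)

theorem psi_eq_split {x₀ : M} {V : Opens M} (hV : V ≤ splitOpen (n := n) F E x₀) (f : O.Sec V)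
    {e : TotalSpace F E} (he : e.proj ∈ V) :
    θ.psi f e = ExteriorAlgebra.algebraMapInv ((θ.splitModel x₀).hat V f e.proj) +
      ∑ a, splitMap (n := n) F E x₀ e (Sum.inr a) * ExteriorAlgebra.ιInv
        ((θ.splitModel x₀).hat V f e.proj) (Module.finBasis ℝ F a) := by
  rw [θ.psi_eq_affineEval_hat (splitOpen_subset_baseSet x₀) hV f he, affineEval_apply]
  congr 1
  conv_lhs => rw [← (Module.finBasis ℝ F).sum_repr (trivializationAt F E x₀ e).2, map_sum]
  refine Finset.sum_congr rfl fun a _ => ?_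
  rw [map_smul, smul_eq_mul]
  rfl

theorem contMDiffOn_comp_proj {g : M → ℝ} {V : Set M} (hg : ContMDiffOn (𝓡 n) 𝓘(ℝ) ∞ g V) :
    ContMDiffOn ((𝓡 n).prod 𝓘(ℝ, F)) 𝓘(ℝ) ∞ (fun e : TotalSpace F E => g e.proj)
      (TotalSpace.proj ⁻¹' V) :=
  hg.comp (Bundle.contMDiff_proj E).contMDiffOn fun _ he => he

/-- The derivative of a function pulled back from `M`. -/
theorem mvfderiv_comp_proj {x₀ : M} {g : M → ℝ} {V : Set M} (hV : IsOpen V)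
    (hVU : V ⊆ (splitOpen (n := n) F E x₀ : Set M))
    (hg : ContMDiffOn (𝓡 n) 𝓘(ℝ) ∞ g V) {e : TotalSpace F E} (he : e.proj ∈ V)
    (v : TangentSpace ((𝓡 n).prod 𝓘(ℝ, F)) e) :
    mvfderiv ((𝓡 n).prod 𝓘(ℝ, F)) (fun e : TotalSpace F E => g e.proj) e v =
      ∑ i, mvfderiv ((𝓡 n).prod 𝓘(ℝ, F)) (splitMap (n := n) F E x₀) e v (Sum.inl i) *
        dirDeriv (chartAt (EuclideanSpace ℝ (Fin n)) x₀) (EuclideanSpace.single i 1) g e.proj := by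
  set c := chartAt (EuclideanSpace ℝ (Fin n)) x₀ with hc
  -- `P` keeps the base coordinates, so the pulled back function is `(g ∘ c.symm) ∘ P ∘ z` near `e`,
  -- and the chain rule applies.
  let P : (LocalModel.Idx n F → ℝ) →L[ℝ] EuclideanSpace ℝ (Fin n) :=
    ∑ i, (ContinuousLinearMap.proj (R := ℝ) (φ := fun _ : LocalModel.Idx n F => ℝ)
      (Sum.inl i)).smulRight (EuclideanSpace.single i 1)
  have hP : ∀ w, P w = ∑ i, w (Sum.inl i) • EuclideanSpace.single i (1 : ℝ) := fun w => by
    simp [P, sum_apply]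
  have hPz : ∀ e : TotalSpace F E, P (splitMap (n := n) F E x₀ e) = c e.proj := fun e => by
    rw [hP]
    ext j
    simp [splitMap, ← hc, Pi.single_apply]
  have hloc := isLocalCoordinate_splitMap (n := n) (F := F) (E := E) x₀
  have h1 : (fun e : TotalSpace F E => g e.proj) =ᶠ[nhds e]
      ((g ∘ c.symm) ∘ P) ∘ splitMap (n := n) F E x₀ := by
    filter_upwards [(hV.preimage (FiberBundle.continuous_proj F E)).mem_nhds he] with e' he'
    simp only [Function.comp_apply, hPz]
    rw [c.left_inv (splitOpen_subset_source x₀ (hVU he'))]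
  have h2 : DifferentiableAt ℝ (g ∘ c.symm) (P (splitMap (n := n) F E x₀ e)) := by
    rw [hPz]
    exact differentiableAt_comp_chart_symm (IsManifold.chart_mem_maximalAtlas x₀) hV
      (fun y hy => splitOpen_subset_source x₀ (hVU hy)) hg he
  have h3 := (h2.hasFDerivAt.comp _ P.hasFDerivAt).hasMFDerivAt.comp e
    ((hloc.smoothAt (hVU he)).mdifferentiableAt (by simp)).hasMFDerivAt
  rw [mvfderiv_congr h1]
  have h4 := congr($h3.mfderiv v)
  refine h4.trans ?_
  change fderiv ℝ (g ∘ c.symm) (P (splitMap (n := n) F E x₀ e))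
    (P (mvfderiv ((𝓡 n).prod 𝓘(ℝ, F)) (splitMap (n := n) F E x₀) e v)) = _
  rw [hPz, hP, map_sum]
  exact Finset.sum_congr rfl fun i _ => by rw [map_smul]; rfl

theorem psiDir_even_eq {x₀ : M} {V : Opens M} (hV : V ≤ splitOpen (n := n) F E x₀) (f : O.Sec V)
    (i : Fin n) {e : TotalSpace F E} (he : e.proj ∈ V) :
    θ.psi ((θ.splitCoords x₀).d (Sum.inl i) ⟨V, hV⟩ f) e =
      dirDeriv (chartAt (EuclideanSpace ℝ (Fin n)) x₀) (EuclideanSpace.single i 1)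
        (fun y => ExteriorAlgebra.algebraMapInv ((θ.splitModel x₀).hat V f y)) e.proj +
      ∑ a, splitMap (n := n) F E x₀ e (Sum.inr a) *
        dirDeriv (chartAt (EuclideanSpace ℝ (Fin n)) x₀) (EuclideanSpace.single i 1)
          (fun y => ExteriorAlgebra.ιInv ((θ.splitModel x₀).hat V f y)
            (Module.finBasis ℝ F a)) e.proj := by
  have hc := IsManifold.chart_mem_maximalAtlas (I := 𝓡 n) (n := ∞) x₀
  have hVc : (V : Set M) ⊆ (chartAt (EuclideanSpace ℝ (Fin n)) x₀).source :=
    fun y hy => splitOpen_subset_source (F := F) (E := E) x₀ (hV hy)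
  have hd : (θ.splitModel x₀).hat V ((θ.splitCoords x₀).d (Sum.inl i) ⟨V, hV⟩ f) e.proj =
      dirDerivComponents (chartAt (EuclideanSpace ℝ (Fin n)) x₀) (EuclideanSpace.single i 1)
        ((θ.splitModel x₀).hat V f) e.proj :=
    (θ.splitModel x₀).hat_partialDer hc (splitOpen_subset_source x₀) (Sum.inl i) hV f he
  have hs := (θ.splitModel x₀).hat_smooth hV f
  rw [θ.psi_eq_split hV _ he, hd]
  congr 1
  · exact apply_dirDerivComponents hc V.2 hVc hs he
      (ExteriorAlgebra.algebraMapInv (R := ℝ) (M := Module.Dual ℝ F)).toLinearMap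
  · refine Finset.sum_congr rfl fun a _ => congrArg _ ?_
    exact apply_dirDerivComponents hc V.2 hVc hs he
      (Module.Dual.eval ℝ F (Module.finBasis ℝ F a) ∘ₗ ExteriorAlgebra.ιInv)

/-- By `algebraMapInv_contract` the degree 0 component of an odd partial derivative is a coefficient
of the degree 1 component. -/
theorem val_odd_eq {x₀ : M} {V : Opens M} (hV : V ≤ splitOpen (n := n) F E x₀) (f : O.Sec V)
    (a : Fin (Module.finrank ℝ F)) {y : M} (hy : y ∈ V) :
    θ.val ((θ.splitCoords x₀).d (Sum.inr a) ⟨V, hV⟩ f) y =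
      ExteriorAlgebra.ιInv ((θ.splitModel x₀).hat V f y) (Module.finBasis ℝ F a) := by
  have hc := IsManifold.chart_mem_maximalAtlas (I := 𝓡 n) (n := ∞) x₀
  have hd : (θ.splitModel x₀).hat V ((θ.splitCoords x₀).d (Sum.inr a) ⟨V, hV⟩ f) y =
      contract (Module.Dual.eval ℝ F (Module.finBasis ℝ F a)) ((θ.splitModel x₀).hat V f y) :=
    (θ.splitModel x₀).hat_partialDer hc (splitOpen_subset_source x₀) (Sum.inr a) hV f hy
  refine (θ.val_eq_hat (U := splitOpen (n := n) F E x₀) (splitOpen_subset_baseSet x₀) _ hy).trans ?_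
  refine (congrArg _ hd).trans ?_
  rw [algebraMapInv_contract]
  rfl

/-- In these coordinates `ψ(f) = f₀(x) + ∑ z_a f_a(x)`. Its derivatives in the base directions are
`ψ(∂_i f)`, and those in the fibre directions are `f_a = val(∂_a f)`; this is the formula with
`psiDir`. -/
theorem isModelCoords_split (x₀ : M) :
    θ.IsModelCoords (θ.splitCoords x₀) (splitMap (n := n) F E x₀) := by
  have hloc := isLocalCoordinate_splitMap (n := n) (F := F) (E := E) x₀
  have hc := IsManifold.chart_mem_maximalAtlas (I := 𝓡 n) (n := ∞) x₀
  have h0 : ∀ {V : Opens M} (hV : V ≤ splitOpen (n := n) F E x₀) (f : O.Sec V),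
      ContMDiffOn (𝓡 n) 𝓘(ℝ) ∞
        (fun y => ExteriorAlgebra.algebraMapInv ((θ.splitModel x₀).hat V f y)) V := fun hV f =>
    (θ.splitModel x₀).hat_smooth hV f
      (ExteriorAlgebra.algebraMapInv (R := ℝ) (M := Module.Dual ℝ F)).toLinearMap
  have h1 : ∀ {V : Opens M} (hV : V ≤ splitOpen (n := n) F E x₀) (f : O.Sec V)
      (a : Fin (Module.finrank ℝ F)), ContMDiffOn (𝓡 n) 𝓘(ℝ) ∞
        (fun y => ExteriorAlgebra.ιInv ((θ.splitModel x₀).hat V f y)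
          (Module.finBasis ℝ F a)) V := fun hV f a =>
    (θ.splitModel x₀).hat_smooth hV f
      (Module.Dual.eval ℝ F (Module.finBasis ℝ F a) ∘ₗ ExteriorAlgebra.ιInv)
  have hz : ∀ {V : Opens M} (hV : V ≤ splitOpen (n := n) F E x₀) (k : LocalModel.Idx n F),
      ContMDiffOn ((𝓡 n).prod 𝓘(ℝ, F)) 𝓘(ℝ) ∞ (fun e => splitMap (n := n) F E x₀ e k)
        (TotalSpace.proj ⁻¹' (V : Set M)) := fun hV k e he =>
    (contMDiffAt_pi_space.1 (hloc.smoothAt (hV he)) k).contMDiffWithinAt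
  refine ⟨hloc, ?_, ?_, ?_⟩
  · intro k e he
    have hcoord : (θ.splitModel x₀).hat _ ((θ.splitCoords x₀).c k) e.proj =
        LocalModel.coordFun (chartAt (EuclideanSpace ℝ (Fin n)) x₀) k e.proj :=
      (θ.splitModel x₀).hat_coord hc (splitOpen_subset_source x₀) k he
    rw [θ.psi_eq_split le_rfl _ he, hcoord]
    rcases k with i | a
    · simp [LocalModel.coordFun, splitMap]
    · simp [LocalModel.coordFun, Finsupp.single_apply]
  · intro V hV f
    refine ContMDiffOn.congr ?_ fun e he => θ.psi_eq_split hV f he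
    refine (contMDiffOn_comp_proj (h0 hV f)).add (contMDiffOn_finsetSum fun a _ => ?_)
    exact (hz hV (Sum.inr a)).mul (contMDiffOn_comp_proj (h1 hV f a))
  · intro V hV f e he v
    have ho : IsOpen ((TotalSpace.proj : TotalSpace F E → M) ⁻¹' (V : Set M)) :=
      V.isOpen.preimage (FiberBundle.continuous_proj F E)
    have hev : θ.psi f =ᶠ[nhds e]
        (fun e => ExteriorAlgebra.algebraMapInv ((θ.splitModel x₀).hat V f e.proj)) +
        ∑ a, (fun e => splitMap (n := n) F E x₀ e (Sum.inr a)) * fun e => ExteriorAlgebra.ιInv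
          ((θ.splitModel x₀).hat V f e.proj) (Module.finBasis ℝ F a) := by
      filter_upwards [ho.mem_nhds he] with e' he'
      simpa using θ.psi_eq_split hV f he'
    have hmd : ∀ {g : TotalSpace F E → ℝ}, ContMDiffOn ((𝓡 n).prod 𝓘(ℝ, F)) 𝓘(ℝ) ∞ g
        (TotalSpace.proj ⁻¹' (V : Set M)) → MDifferentiableAt ((𝓡 n).prod 𝓘(ℝ, F)) 𝓘(ℝ) g e :=
      fun hg => (hg.contMDiffAt (ho.mem_nhds he)).mdifferentiableAt (by simp)
    have hma := fun a => hmd (hz hV (Sum.inr a))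
    have hmb := fun a => hmd (contMDiffOn_comp_proj (h1 hV f a))
    have hsum := mvfderiv_finset_sum Finset.univ fun a => (hma a).mul (hmb a)
    rw [mvfderiv_congr hev, mvfderiv_add (hmd (contMDiffOn_comp_proj (h0 hV f))) hsum.1, hsum.2,
      add_apply, sum_apply, mvfderiv_comp_proj V.2 hV (h0 hV f) he, Fintype.sum_sum_type]
    have hR1 : ∀ i : Fin n, θ.psiDir ((θ.splitCoords x₀).p (Sum.inl i))
        ((θ.splitCoords x₀).d (Sum.inl i) ⟨V, hV⟩ f) e = _ := fun i =>
      θ.psiDir_even_eq hV f i he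
    have hR2 : ∀ a : Fin (Module.finrank ℝ F), θ.psiDir ((θ.splitCoords x₀).p (Sum.inr a))
        ((θ.splitCoords x₀).d (Sum.inr a) ⟨V, hV⟩ f) e = _ := fun a =>
      θ.val_odd_eq hV f a he
    simp only [hR1, hR2]
    have hL : ∀ a, mvfderiv ((𝓡 n).prod 𝓘(ℝ, F))
        ((fun e => splitMap (n := n) F E x₀ e (Sum.inr a)) * fun e => ExteriorAlgebra.ιInv
          ((θ.splitModel x₀).hat V f e.proj) (Module.finBasis ℝ F a)) e v =
        splitMap (n := n) F E x₀ e (Sum.inr a) *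
          (∑ i, mvfderiv ((𝓡 n).prod 𝓘(ℝ, F)) (splitMap (n := n) F E x₀) e v (Sum.inl i) *
            dirDeriv (chartAt (EuclideanSpace ℝ (Fin n)) x₀) (EuclideanSpace.single i 1)
              (fun y => ExteriorAlgebra.ιInv ((θ.splitModel x₀).hat V f y)
                (Module.finBasis ℝ F a)) e.proj) +
        mvfderiv ((𝓡 n).prod 𝓘(ℝ, F)) (splitMap (n := n) F E x₀) e v (Sum.inr a) *
          ExteriorAlgebra.ιInv ((θ.splitModel x₀).hat V f e.proj) (Module.finBasis ℝ F a) := by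
      intro a
      rw [mvfderiv_mul (hma a) (hmb a), add_apply, smul_apply, smul_apply, smul_eq_mul, smul_eq_mul,
        mvfderiv_comp_proj V.2 hV (h1 hV f a) he,
        ← mvfderiv_pi_apply ((hloc.smoothAt (hV he)).mdifferentiableAt (by simp))]
      ring
    simp only [hL, mul_add, Finset.sum_add_distrib, Finset.mul_sum, add_assoc]
    congr 2
    rw [Finset.sum_comm]
    exact Finset.sum_congr rfl fun i _ => Finset.sum_congr rfl fun a _ => by ring

theorem isAffine_splitCoords (x₀ : M) (k : LocalModel.Idx n F) :
    IsAffine (θ.equiv _ le_top ((θ.splitCoords x₀).c k)) := by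
  have hc := IsManifold.chart_mem_maximalAtlas (I := 𝓡 n) (n := ∞) x₀
  rw [θ.isAffine_iff_hat (splitOpen_subset_baseSet x₀) le_rfl]
  intro y hy
  have hcoord : (θ.localModel (splitOpen_subset_baseSet x₀)).hat _ ((θ.splitCoords x₀).c k) y =
      LocalModel.coordFun (chartAt (EuclideanSpace ℝ (Fin n)) x₀) k y :=
    (θ.splitModel x₀).hat_coord hc (splitOpen_subset_source x₀) k hy
  rw [hcoord]
  rcases k with i | a
  · simp [LocalModel.coordFun, affineProj_apply]
  · simp [LocalModel.coordFun, affineProj_apply]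

/-- Base derivatives act on coefficients and therefore commute with the truncation; `c_a ∂_a` is
covered by `ι_mul_contract_affine`. -/
theorem isAffine_testDer (x₀ : M) (k : LocalModel.Idx n F) {V : Opens M}
    (hV : V ≤ splitOpen (n := n) F E x₀) {f : O.Sec V} (hf : IsAffine (θ.equiv V le_top f)) :
    IsAffine (θ.equiv V le_top ((θ.splitCoords x₀).testDer k ⟨V, hV⟩ f)) := by
  have hc := IsManifold.chart_mem_maximalAtlas (I := 𝓡 n) (n := ∞) x₀
  have hVc : (V : Set M) ⊆ (chartAt (EuclideanSpace ℝ (Fin n)) x₀).source :=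
    fun y hy => splitOpen_subset_source (F := F) (E := E) x₀ (hV hy)
  rw [θ.isAffine_iff_hat (splitOpen_subset_baseSet x₀) hV] at hf ⊢
  intro y hy
  have hd := (θ.splitModel x₀).hat_partialDer hc (splitOpen_subset_source x₀) k hV f hy
  rcases k with i | a
  · have h1 : (θ.splitCoords x₀).testDer (Sum.inl i) = (θ.splitCoords x₀).d (Sum.inl i) :=
      if_pos rfl
    rw [h1]
    have hd' : (θ.localModel (splitOpen_subset_baseSet (n := n) (F := F) (E := E) x₀)).hat V
      ((θ.splitCoords x₀).d (Sum.inl i) ⟨V, hV⟩ f) y = _ := hd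
    rw [hd']
    change affineProj _ (dirDerivComponents _ _ _ y) = dirDerivComponents _ _ _ y
    rw [← dirDerivComponents_comp hc V.2 hVc ((θ.splitModel x₀).hat_smooth hV f) _ hy]
    exact dirDerivComponents_congr V.2 hVc hf hy
  · have h1 : (θ.splitCoords x₀).testDer (Sum.inr a) =
        O.smulFamily ((θ.splitCoords x₀).c (Sum.inr a)) ((θ.splitCoords x₀).d (Sum.inr a)) :=
      if_neg one_ne_zero
    have hcoord : (θ.splitModel x₀).hat _ ((θ.splitCoords x₀).c (Sum.inr a)) y =
        ExteriorAlgebra.ι ℝ ((Module.finBasis ℝ F).coord a) :=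
      (θ.splitModel x₀).hat_coord hc (splitOpen_subset_source x₀) (Sum.inr a) (hV hy)
    have h2 : (θ.localModel (splitOpen_subset_baseSet (n := n) (F := F) (E := E) x₀)).hat V
        ((θ.splitCoords x₀).testDer (Sum.inr a) ⟨V, hV⟩ f) y =
        ExteriorAlgebra.ι ℝ ((Module.finBasis ℝ F).coord a) *
          contract (Module.Dual.eval ℝ F (Module.finBasis ℝ F a))
            ((θ.splitModel x₀).hat V f y) := by
      rw [h1]
      change (θ.splitModel x₀).hat V (O.res hV ((θ.splitCoords x₀).c (Sum.inr a)) *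
        (θ.splitCoords x₀).d (Sum.inr a) ⟨V, hV⟩ f) y = _
      rw [(θ.splitModel x₀).hat_mul hV _ _ hy, (θ.splitModel x₀).hat_res le_rfl hV _ hy, hcoord]
      exact congrArg _ hd
    rw [h2]
    exact ι_mul_contract_affine _ _ (hf y hy)

end ModelIso

end SplitCoordinates

theorem christoffelCov_congr {B G H N : Type*} [NormedAddCommGroup B] [NormedSpace ℝ B]
    [NormedAddCommGroup G] [NormedSpace ℝ G] [TopologicalSpace H] {I : ModelWithCorners ℝ B H}
    [TopologicalSpace N] [ChartedSpace H N] {z : N → G} {Γ Γ' : N → G →L[ℝ] G →L[ℝ] G} {e : N}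
    (h : Γ e = Γ' e) (Y : (e : N) → TangentSpace I e) :
    christoffelCov I z Γ Y e = christoffelCov I z Γ' Y e := by
  simp only [christoffelCov, h]

/-! ### The reduced connection: gluing, existence and uniqueness. -/

section ReducedConnection

variable {n : ℕ} {M : Type u} [TopologicalSpace M] [ChartedSpace (EuclideanSpace ℝ (Fin n)) M]
  [IsManifold (𝓡 n) ∞ M]
  {F : Type*} [NormedAddCommGroup F] [NormedSpace ℝ F] [FiniteDimensional ℝ F]
  {E : M → Type*} [∀ x, AddCommGroup (E x)] [∀ x, Module ℝ (E x)] [∀ x, TopologicalSpace (E x)]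
  [TopologicalSpace (TotalSpace F E)] [FiberBundle F E] [VectorBundle ℝ F E]
  [ContMDiffVectorBundle ∞ F E (𝓡 n)]
  {O : SuperalgebraSheaf.{u, w} M}

namespace ModelIso

variable {θ : BatchelorModel (n := n) O F E} {D : O.Connection}

namespace IsModelCoords

variable {U : Opens M} {ι ι' : Type} [Fintype ι] [DecidableEq ι] [Fintype ι'] [DecidableEq ι']
  {S : SuperCoords O U ι} {z : TotalSpace F E → ι → ℝ} (hz : θ.IsModelCoords S z)
  {S' : SuperCoords O U ι'} {z' : TotalSpace F E → ι' → ℝ} (hz' : θ.IsModelCoords S' z')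

include hz

theorem continuousAt_of_contMDiffAt
    {C : (e : TotalSpace F E) → TangentSpace ((𝓡 n).prod 𝓘(ℝ, F)) e →L[ℝ]
      TangentSpace ((𝓡 n).prod 𝓘(ℝ, F)) e} {X : VField n F E} {e : TotalSpace F E} (he : e.proj ∈ U)
    (hC : ContMDiffAt ((𝓡 n).prod 𝓘(ℝ, F)) (((𝓡 n).prod 𝓘(ℝ, F)).prod
        𝓘(ℝ, EuclideanSpace ℝ (Fin n) × F →L[ℝ] EuclideanSpace ℝ (Fin n) × F)) ∞
      (fun e => (⟨e, C e⟩ : TotalSpace (EuclideanSpace ℝ (Fin n) × F →L[ℝ] EuclideanSpace ℝ (Fin n) × F)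
        fun e : TotalSpace F E => TangentSpace ((𝓡 n).prod 𝓘(ℝ, F)) e →L[ℝ]
          TangentSpace ((𝓡 n).prod 𝓘(ℝ, F)) e)) e)
    (hX : ContMDiffAt ((𝓡 n).prod 𝓘(ℝ, F)) ((𝓡 n).prod 𝓘(ℝ, F)).tangent ∞
      (fun e => (⟨e, X e⟩ : TangentBundle ((𝓡 n).prod 𝓘(ℝ, F)) (TotalSpace F E))) e) :
    ContinuousAt (fun e => mvfderiv ((𝓡 n).prod 𝓘(ℝ, F)) z e (C e (X e))) e :=
  (contMDiffAt_mvfderiv_apply (hz.isLocalCoordinate.smoothAt he)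
    (hC.clm_bundle_apply hX)).continuousAt

include hz'

/-- The reduced connection does not depend on the coordinates. -/
theorem christoffelCov_eq {Y : VField n F E} {e : TotalSpace F E} (he : e.proj ∈ U)
    (hY : MDifferentiableAt ((𝓡 n).prod 𝓘(ℝ, F)) ((𝓡 n).prod 𝓘(ℝ, F)).tangent
      (fun e => (⟨e, Y e⟩ : TangentBundle ((𝓡 n).prod 𝓘(ℝ, F)) (TotalSpace F E))) e) :
    christoffelCov ((𝓡 n).prod 𝓘(ℝ, F)) z' (θ.redGamma S' D) Y e =
      christoffelCov ((𝓡 n).prod 𝓘(ℝ, F)) z (θ.redGamma S D) Y e := by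
  have ho : IsOpen ((TotalSpace.proj : TotalSpace F E → M) ⁻¹' (U : Set M)) :=
    isOpen_preimage U
  -- The test fields of the coordinates `z` also represent their derivations in the coordinates
  -- `z'`. So the connection built from `z'` reduces `D` on them, and the uniqueness result for `z`
  -- applies.
  have key : ∀ μ k, ∀ e : TotalSpace F E, e.proj ∈ U →
      mvfderiv ((𝓡 n).prod 𝓘(ℝ, F)) z' e (S.testField z μ e) k =
        θ.psi ((S.testTangent μ).1 ⟨U, le_rfl⟩ (O.res le_rfl (S'.c k))) e := by
    intro μ k e he
    rw [hz'.mvfderiv_apply_eq_mvfderiv_psi he, SuperalgebraSheaf.res_self]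
    refine hz.mvfderiv_psi_eq le_rfl (S.testDer_mem μ) (fun l => ?_) le_rfl he _
    rw [hz.mvfderiv_testField μ l he, SuperalgebraSheaf.res_self]
  refine hz.eq_christoffelCov hz'.isLocalCoordinate.isCovariantDerivativeOn_christoffelCov
    (fun μ ν e he => ?_) (fun μ ν κ e he => ?_) he hY
  · refine (hz.continuousAt_of_contMDiffAt he
      (hz'.isLocalCoordinate.contMDiffAt_christoffelCov he (hz'.smooth_redGamma he) ?_)
      (hz.isLocalCoordinate.contMDiffAt_constField he _)).continuousWithinAt
    filter_upwards [ho.mem_nhds he] with e' he'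
    exact hz.isLocalCoordinate.contMDiffAt_constField he' _
  · exact hz'.mvfderiv_psi_christoffelCov le_rfl (S.testDer_mem μ) (S.testDer_mem ν)
      (fun e he k => key μ k e he) (fun e he k => key ν k e he) le_rfl (S.c κ) he

end IsModelCoords

variable (θ D) in
/-- The reduced connection in the coordinates around `x₀`. -/
def splitCov (x₀ : M) : VField n F E → (e : TotalSpace F E) →
    TangentSpace ((𝓡 n).prod 𝓘(ℝ, F)) e →L[ℝ] TangentSpace ((𝓡 n).prod 𝓘(ℝ, F)) e :=
  christoffelCov ((𝓡 n).prod 𝓘(ℝ, F)) (splitMap (n := n) F E x₀)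
    (θ.redGamma (θ.splitCoords x₀) D)

/-- The reduced connection in the coordinates around `x₀` agrees with the one in any other
coordinates. -/
theorem splitCov_eq {U : Opens M} {ι : Type} [Fintype ι] [DecidableEq ι]
    {S : SuperCoords O U ι} {z : TotalSpace F E → ι → ℝ} (hz : θ.IsModelCoords S z) (x₀ : M)
    {Y : VField n F E} {e : TotalSpace F E} (he : e.proj ∈ U)
    (he₀ : e.proj ∈ splitOpen (n := n) F E x₀)
    (hY : MDifferentiableAt ((𝓡 n).prod 𝓘(ℝ, F)) ((𝓡 n).prod 𝓘(ℝ, F)).tangent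
      (fun e => (⟨e, Y e⟩ : TangentBundle ((𝓡 n).prod 𝓘(ℝ, F)) (TotalSpace F E))) e) :
    θ.splitCov D x₀ Y e = christoffelCov ((𝓡 n).prod 𝓘(ℝ, F)) z (θ.redGamma S D) Y e := by
  -- Both systems of coordinates are restricted to the intersection of their domains, where they can
  -- be compared.
  have he' : e.proj ∈ U ⊓ splitOpen (n := n) F E x₀ := ⟨he, he₀⟩
  have h1 := hz.restrict (inf_le_left (b := splitOpen (n := n) F E x₀))
  have h2 := (θ.isModelCoords_split x₀).restrict (inf_le_right (a := U))
  rw [splitCov, ← christoffelCov_congr (θ.redGamma_restrict S D inf_le_left he') Y,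
    ← christoffelCov_congr (θ.redGamma_restrict (θ.splitCoords x₀) D inf_le_right he') Y]
  exact h1.christoffelCov_eq h2 he' hY

theorem isAffine_res {V W : Opens M} (h : W ≤ V) {f : O.Sec V}
    (hf : IsAffine (θ.equiv V le_top f)) : IsAffine (θ.equiv W le_top (O.res h f)) := by
  intro x
  rw [θ.equiv_res le_top h f x]
  exact hf ⟨x, h x.2⟩

/-- The test derivations belong to `𝓛_0` of this model, so the defining property of a reduced
connection can be applied to them. -/
theorem corresponds_testField (x₀ : M) (k : LocalModel.Idx n F) :
    Corresponds θ ((θ.splitCoords x₀).testTangent k)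
      ((θ.splitCoords x₀).testField (splitMap (n := n) F E x₀) k) where
  even := (θ.splitCoords x₀).testDer_mem k
  preserves V hV s hs := by
    refine θ.isAffine_testDer x₀ k hV ?_
    rwa [AlgEquiv.apply_symm_apply]
  smooth e he := ((θ.isModelCoords_split x₀).smooth_testField k he).contMDiffWithinAt
  conj V hV s _ e he := by
    obtain ⟨f, rfl⟩ := (θ.equiv V le_top).surjective s
    have hz := θ.isModelCoords_split x₀
    rw [act, AlgEquiv.symm_apply_apply]
    refine hz.mvfderiv_psi_eq le_rfl ((θ.splitCoords x₀).testDer_mem k) (fun l => ?_) hV he f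
    rw [hz.mvfderiv_testField k l (hV he), SuperalgebraSheaf.res_self]

/-- The split coordinates are affine sections, so the relation defining `Ψ(X)` gives the components
of `X'` directly. -/
theorem mvfderiv_splitMap_of_corresponds {U : Opens M} {X : O.tangent U} {X' : VField n F E}
    (hX : Corresponds θ X X') (x₀ : M) {e : TotalSpace F E} (he : e.proj ∈ U)
    (he₀ : e.proj ∈ splitOpen (n := n) F E x₀) (k : LocalModel.Idx n F) :
    mvfderiv ((𝓡 n).prod 𝓘(ℝ, F)) (splitMap (n := n) F E x₀) e (X' e) k =
      θ.psi (X.1 ⟨U ⊓ splitOpen (n := n) F E x₀, inf_le_left⟩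
        (O.res inf_le_right ((θ.splitCoords x₀).c k))) e := by
  have he' : e.proj ∈ U ⊓ splitOpen (n := n) F E x₀ := ⟨he, he₀⟩
  have h2 := (θ.isModelCoords_split x₀).restrict (inf_le_right (a := U))
  rw [h2.mvfderiv_apply_eq_mvfderiv_psi he']
  have := hX.conj _ inf_le_left _ (isAffine_res inf_le_right (θ.isAffine_splitCoords x₀ k)) e he'
  rw [act, AlgEquiv.symm_apply_apply] at this
  exact this

/-- The components of `X'` and `Y'` are those required by `mvfderiv_psi_christoffelCov`; restriction
to the coordinate domain is harmless because `∇` and superderivations commute with it. -/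
theorem splitCov_reduces {U : Opens M} {X Y : O.tangent U} {X' Y' : VField n F E}
    (hX : Corresponds θ X X') (hY : Corresponds θ Y Y') (x₀ : M) {V : Opens M} (hV : V ≤ U)
    (s : forms (n := n) F E V) {e : TotalSpace F E} (he : e.proj ∈ V)
    (he₀ : e.proj ∈ splitOpen (n := n) F E x₀) :
    mvfderiv ((𝓡 n).prod 𝓘(ℝ, F)) (affineFun s) e (θ.splitCov D x₀ Y' e (X' e)) =
      affineFun (θ.act (D.nabla U X Y) hV s) e := by
  obtain ⟨f, rfl⟩ := (θ.equiv V le_top).surjective s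
  rw [act, AlgEquiv.symm_apply_apply]
  change mvfderiv _ (θ.psi f) e _ = θ.psi _ e
  have hVV : V ⊓ splitOpen (n := n) F E x₀ ≤ U ⊓ splitOpen (n := n) F E x₀ :=
    inf_le_inf_right _ hV
  have heV : e.proj ∈ V ⊓ splitOpen (n := n) F E x₀ := ⟨he, he₀⟩
  have hN : (D.nabla U X Y).1 ∈ O.superDer U 0 := by
    have := D.nabla_even U 0 0 X Y hX.even hY.even
    rwa [zero_add] at this
  have hXW : (O.resTangent (inf_le_left (b := splitOpen (n := n) F E x₀)) X).1 ∈
      O.superDer _ 0 :=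
    SuperalgebraSheaf.resFamily_mem (inf_le_left (b := splitOpen (n := n) F E x₀)) hX.even
  have hYW : (O.resTangent (inf_le_left (b := splitOpen (n := n) F E x₀)) Y).1 ∈
      O.superDer _ 0 :=
    SuperalgebraSheaf.resFamily_mem (inf_le_left (b := splitOpen (n := n) F E x₀)) hY.even
  have h := (θ.isModelCoords_split x₀).mvfderiv_psi_christoffelCov (D := D)
    (inf_le_right (a := U)) hXW hYW
    (fun e he k => mvfderiv_splitMap_of_corresponds hX x₀ he.1 he.2 k)
    (fun e he k => mvfderiv_splitMap_of_corresponds hY x₀ he.1 he.2 k) hVV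
    (O.res inf_le_left f) heV
  rw [← D.nabla_res] at h
  have hev : θ.psi (O.res (inf_le_left (b := splitOpen (n := n) F E x₀)) f) =ᶠ[nhds e]
      θ.psi f := by
    filter_upwards [(IsModelCoords.isOpen_preimage (V ⊓ splitOpen (n := n) F E x₀)).mem_nhds heV]
      with e' he'
    exact θ.psi_res _ f he'
  rw [mvfderiv_congr hev] at h
  refine h.trans ?_
  have h3 := hN.1 V _ hV (inf_le_left (b := splitOpen (n := n) F E x₀)) f
  rw [← θ.psi_res (inf_le_left (b := splitOpen (n := n) F E x₀)) _ heV, h3]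
  rfl

variable (θ D) in
/-- The reduced connection. -/
def reducedConnection : AffineConnection n F E where
  -- Each point uses the coordinates around its own base point. The axioms are then pointwise;
  -- compatibility of the choices is needed only for smoothness.
  toFun Y e := θ.splitCov D e.proj Y e
  isCovariantDerivativeOnUniv :=
    { add := fun {_ _ e} hY hY' _ =>
        (θ.isModelCoords_split e.proj).isLocalCoordinate.isCovariantDerivativeOn_christoffelCov.add
          hY hY' (mem_splitOpen F E e.proj)
      leibniz := fun {_ _ e} hY hg _ =>
        (θ.isModelCoords_split e.proj).isLocalCoordinate.isCovariantDerivativeOn_christoffelCov.leibniz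
          hY hg (mem_splitOpen F E e.proj) }

theorem isReduced_reducedConnection : IsReduced θ D (θ.reducedConnection D) where
  smooth := by
    refine ⟨⟨fun {Y} hY e₀ _ => ContMDiffAt.contMDiffWithinAt ?_⟩⟩
    have hY' : ∀ e, ContMDiffAt ((𝓡 n).prod 𝓘(ℝ, F)) ((𝓡 n).prod 𝓘(ℝ, F)).tangent ∞
        (fun e => (⟨e, Y e⟩ : TangentBundle ((𝓡 n).prod 𝓘(ℝ, F)) (TotalSpace F E))) e :=
      fun e => (hY e trivial).contMDiffAt Filter.univ_mem
    have hz := θ.isModelCoords_split e₀.proj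
    have he₀ := mem_splitOpen (n := n) F E e₀.proj
    have h1 := hz.isLocalCoordinate.contMDiffAt_christoffelCov he₀ (hz.smooth_redGamma (D := D) he₀)
      (.of_forall hY')
    refine h1.congr_of_eventuallyEq ?_
    -- Near `e₀` the varying choice of coordinates may be replaced by the fixed one around
    -- `e₀.proj`, by `splitCov_eq`.
    filter_upwards [hz.isLocalCoordinate.isOpen.mem_nhds he₀] with e he
    have := splitCov_eq (D := D) hz e.proj he (mem_splitOpen F E e.proj)
      ((hY' e).mdifferentiableAt (by simp))
    exact congrArg (TotalSpace.mk e) this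
  reduces U X Y X' Y' hX hY V hV s _ e he :=
    splitCov_reduces hX hY e.proj hV s he (mem_splitOpen F E e.proj)

/-- A vector field that is smooth over an open subset of `M` agrees near a given fibre with a
globally smooth vector field. -/
theorem exists_contMDiff_eventuallyEq [T2Space M] {U : Opens M} {Y : VField n F E}
    (hY : ∀ e : TotalSpace F E, e.proj ∈ U →
      ContMDiffAt ((𝓡 n).prod 𝓘(ℝ, F)) ((𝓡 n).prod 𝓘(ℝ, F)).tangent ∞
        (fun e => (⟨e, Y e⟩ : TangentBundle ((𝓡 n).prod 𝓘(ℝ, F)) (TotalSpace F E))) e)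
    {e₀ : TotalSpace F E} (he₀ : e₀.proj ∈ U) :
    ∃ Y' : VField n F E, (∀ e, ContMDiffAt ((𝓡 n).prod 𝓘(ℝ, F)) ((𝓡 n).prod 𝓘(ℝ, F)).tangent ∞
        (fun e => (⟨e, Y' e⟩ : TangentBundle ((𝓡 n).prod 𝓘(ℝ, F)) (TotalSpace F E))) e) ∧
      ∀ᶠ e in nhds e₀, Y' e = Y e := by
  obtain ⟨f, -, hf⟩ := (SmoothBumpFunction.nhds_basis_tsupport (I := 𝓡 n) e₀.proj).mem_iff.1
    (U.isOpen.mem_nhds he₀)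
  have hπ : Continuous (TotalSpace.proj : TotalSpace F E → M) := FiberBundle.continuous_proj F E
  -- The cutoff is a bump function on the base with support in `U`, pulled back to `E`.
  refine ⟨(fun e : TotalSpace F E => f e.proj) • Y, fun e => ?_, ?_⟩
  · by_cases he : e.proj ∈ tsupport f
    · have h1 : ContMDiffAt ((𝓡 n).prod 𝓘(ℝ, F)) 𝓘(ℝ) ∞ (fun e : TotalSpace F E => f e.proj) e :=
        (f.contMDiff.comp (Bundle.contMDiff_proj E)).contMDiffAt
      exact h1.smul_section (hY e (hf he))
    · have h0 : ContMDiffAt ((𝓡 n).prod 𝓘(ℝ, F)) ((𝓡 n).prod 𝓘(ℝ, F)).tangent ∞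
          (fun e => (⟨e, 0⟩ : TangentBundle ((𝓡 n).prod 𝓘(ℝ, F)) (TotalSpace F E))) e :=
        (Bundle.contMDiff_zeroSection ℝ
          (TangentSpace ((𝓡 n).prod 𝓘(ℝ, F)) : TotalSpace F E → Type _)).contMDiffAt
      refine h0.congr_of_eventuallyEq ?_
      filter_upwards [((isClosed_tsupport f).isOpen_compl.preimage hπ).mem_nhds he] with e' he'
      have : f e'.proj = 0 := image_eq_zero_of_notMem_tsupport he'
      simp [this]
  · filter_upwards [hπ.continuousAt.eventually f.eventuallyEq_one] with e he
    have : f e.proj = 1 := he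
    simp [this]

/-- A reduced connection satisfies the hypotheses of the local uniqueness result: the test fields
correspond to elements of `𝓛_0`, and its components are continuous. -/
theorem eq_splitCov_of_isReduced [T2Space M] {C : AffineConnection n F E} (hC : IsReduced θ D C)
    (x₀ : M) {Y : VField n F E} {e : TotalSpace F E} (he : e.proj ∈ splitOpen (n := n) F E x₀)
    (hY : MDifferentiableAt ((𝓡 n).prod 𝓘(ℝ, F)) ((𝓡 n).prod 𝓘(ℝ, F)).tangent
      (fun e => (⟨e, Y e⟩ : TangentBundle ((𝓡 n).prod 𝓘(ℝ, F)) (TotalSpace F E))) e) :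
    C Y e = θ.splitCov D x₀ Y e := by
  have hz := θ.isModelCoords_split x₀
  refine hz.eq_christoffelCov C.isCovariantDerivativeOn (fun μ ν e he => ?_)
    (fun μ ν κ e he => ?_) he hY
  · have hE := fun w (e : TotalSpace F E) (he : e.proj ∈ splitOpen (n := n) F E x₀) =>
      hz.isLocalCoordinate.contMDiffAt_constField he w
    -- Smoothness of `C` is used for globally smooth fields, so the coordinate field is first
    -- replaced by one that agrees with it near the point; a covariant derivative is local.
    obtain ⟨Y', hY', hev⟩ := exists_contMDiff_eventuallyEq (hE (Pi.single ν 1)) he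
    have h1 := (hC.smooth.contMDiff.contMDiff (σ := Y') fun e _ => (hY' e).contMDiffWithinAt)
    have h2 := (h1 e trivial).contMDiffAt Filter.univ_mem
    refine ContinuousAt.continuousWithinAt ?_
    refine (hz.continuousAt_of_contMDiffAt he h2 (hE (Pi.single μ 1) e he)).congr ?_
    filter_upwards [hev.eventually_nhds, hz.isLocalCoordinate.isOpen.mem_nhds he] with e' he' he₁
    rw [C.isCovariantDerivativeOnUniv.congr_of_eventuallyEq ((hY' e').mdifferentiableAt (by simp))
      ((hE (Pi.single ν 1) e' he₁).mdifferentiableAt (by simp)) Filter.univ_mem he']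
  · have := hC.reduces _ _ _ _ _ (corresponds_testField x₀ μ) (corresponds_testField x₀ ν)
      _ le_rfl _ (θ.isAffine_splitCoords x₀ κ) e he
    rw [act, AlgEquiv.symm_apply_apply] at this
    exact this

theorem sameConnection_of_isReduced [T2Space M] {C C' : AffineConnection n F E}
    (hC : IsReduced θ D C) (hC' : IsReduced θ D C') : SameConnection C C' := fun _ e hY =>
  (eq_splitCov_of_isReduced hC e.proj (mem_splitOpen F E e.proj) hY).trans
    (eq_splitCov_of_isReduced hC' e.proj (mem_splitOpen F E e.proj) hY).symm

end ModelIso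

end ReducedConnection

/-! ### The bundle isomorphism between two Batchelor models. -/

section Comparison

variable {n : ℕ} {M : Type u} [TopologicalSpace M] [ChartedSpace (EuclideanSpace ℝ (Fin n)) M]
  [IsManifold (𝓡 n) ∞ M]
  {F : Type*} [NormedAddCommGroup F] [NormedSpace ℝ F] [FiniteDimensional ℝ F]
  {E : M → Type*} [∀ x, AddCommGroup (E x)] [∀ x, Module ℝ (E x)] [∀ x, TopologicalSpace (E x)]
  [TopologicalSpace (TotalSpace F E)] [FiberBundle F E] [VectorBundle ℝ F E]
  [ContMDiffVectorBundle ∞ F E (𝓡 n)]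
  {O : SuperalgebraSheaf.{u, w} M}

theorem LocalModel.res_constHom {F : Type*} [AddCommGroup F] [Module ℝ F] {U V W : Opens M}
    (m : LocalModel n O F U) (hV : V ≤ U) (h : W ≤ V) (x : ExtAlg F) :
    O.res h (m.constHom hV x) = m.constHom (h.trans hV) x :=
  m.hat_inj (h.trans hV) fun y hy => by
    rw [m.hat_res hV h _ hy, m.hat_constHom _ _ (h hy), m.hat_constHom _ _ hy]

namespace ModelIso

variable (θ : BatchelorModel (n := n) O F E)

section LocalModel

variable {F' : Type*} [AddCommGroup F'] [Module ℝ F'] [Module.Finite ℝ F'] {U : Opens M}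
  (m : LocalModel n O F' U)

theorem psi_algebraMap {V : Opens M} (r : ℝ) {e : TotalSpace F E} (he : e.proj ∈ V) :
    θ.psi (algebraMap ℝ (O.Sec V) r) e = r := by
  rw [θ.psi_even (SetLike.algebraMap_mem_graded (O.parity V) r) he, θ.val_algebraMap r he]

/-- The value at a point of a section does not depend on the model. -/
theorem val_funSec {V : Opens M} (hV : V ≤ U) {g : M → ℝ}
    (hg : ContMDiffOn (𝓡 n) 𝓘(ℝ) ∞ g (V : Set M)) {x : M} (hx : x ∈ V) :
    θ.val (m.funSec hV g hg) x = g x := by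
  by_contra hne
  set c := θ.val (m.funSec hV g hg) x with hc
  -- If the value `c` differed from `g x`, then `g - c` would be invertible on `W`, while `val (g -
  -- c)` is zero at `x`; this contradicts multiplicativity of `val`.
  let W : Opens M := ⟨V ∩ g ⁻¹' {c}ᶜ,
    hg.continuousOn.isOpen_inter_preimage V.2 isOpen_compl_singleton⟩
  have hWV : W ≤ V := fun y hy => hy.1
  have hxW : x ∈ W := ⟨hx, fun h => hne h.symm⟩
  have h1 : ContMDiffOn (𝓡 n) 𝓘(ℝ) ∞ (fun y => g y - c) (W : Set M) :=
    (hg.mono hWV).sub contMDiffOn_const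
  have h2 : ContMDiffOn (𝓡 n) 𝓘(ℝ) ∞ (fun y => (g y - c)⁻¹) (W : Set M) :=
    h1.inv₀ fun y hy => sub_ne_zero.2 hy.2
  have hmul : m.funSec (hWV.trans hV) _ h1 * m.funSec (hWV.trans hV) _ h2 = algebraMap ℝ _ 1 := by
    refine m.hat_inj (hWV.trans hV) fun y hy => ?_
    rw [m.hat_mul (hWV.trans hV) _ _ hy, m.hat_funSec _ _ hy, m.hat_funSec _ _ hy, ← map_mul,
      mul_inv_cancel₀ (sub_ne_zero.2 hy.2), map_one, map_one, m.hat_one (hWV.trans hV) hy]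
  have hsub : m.funSec (hWV.trans hV) _ h1 + algebraMap ℝ _ c = O.res hWV (m.funSec hV g hg) := by
    refine m.hat_inj (hWV.trans hV) fun y hy => ?_
    rw [map_add, Pi.add_apply, m.hat_funSec _ _ hy, m.hat_res hV hWV _ hy, m.hat_funSec _ _ (hWV hy),
      Algebra.algebraMap_eq_smul_one (A := O.Sec W), map_smul, Pi.smul_apply,
      m.hat_one (hWV.trans hV) hy, ← Algebra.algebraMap_eq_smul_one, ← map_add, sub_add_cancel]
  have h3 : θ.val (m.funSec (hWV.trans hV) _ h1) x = 0 := by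
    have h4 := θ.val_res hWV (m.funSec hV g hg) hxW
    rw [← hsub, ← hc] at h4
    have h5 : θ.val (m.funSec (hWV.trans hV) _ h1 + algebraMap ℝ _ c) x =
      θ.val (m.funSec (hWV.trans hV) _ h1) x + θ.val (algebraMap ℝ (O.Sec W) c) x := θ.psi_add _ _ _
    rw [h5, θ.val_algebraMap c hxW] at h4
    linarith
  have h6 := θ.val_mul (m.funSec (hWV.trans hV) _ h1) (m.funSec (hWV.trans hV) _ h2) hxW
  rw [hmul, θ.val_algebraMap 1 hxW, h3, zero_mul] at h6
  exact one_ne_zero h6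

/-- The generators determine `val` and `psi` on constants, because both sides obey the same
truncated product rule. The two claims are proved together, as the rule for `psi` involves `val`. -/
theorem psi_constHom {V : Opens M} (hV : V ≤ U) {e : TotalSpace F E} (he : e.proj ∈ V) {u : F'}
    (hu : ∀ l, θ.psi (m.constHom hV (ExteriorAlgebra.ι ℝ l)) e = l u) (x : ExtAlg F') :
    θ.val (m.constHom hV x) e.proj = ExteriorAlgebra.algebraMapInv x ∧
      θ.psi (m.constHom hV x) e = affineEval u x := by
  induction x using ExteriorAlgebra.induction with
  | algebraMap r =>
    rw [AlgHom.commutes, θ.val_algebraMap r he, θ.psi_algebraMap r he, affineEval_apply]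
    simp
  | ι l =>
    rw [hu, θ.val_odd (m.constHom_mem hV (ι_mem_extParity l)) he, affineEval_apply]
    simp
  | mul a b ha hb =>
    rw [map_mul, θ.val_mul _ _ he, θ.psi_mul _ _ he, ha.1, ha.2, hb.1, hb.2, affineEval_apply,
      affineEval_apply, affineEval_apply, map_mul, ιInv_mul]
    refine ⟨rfl, ?_⟩
    simp only [LinearMap.add_apply, LinearMap.smul_apply, smul_eq_mul]
    ring
  | add a b ha hb =>
    rw [map_add, map_add, map_add, θ.psi_add, ha.2, hb.2, ← ha.1, ← hb.1]
    exact ⟨θ.psi_add _ _ _, rfl⟩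

/-- A point of `E` is an affine evaluation of sections in any local model. -/
theorem exists_psi_eq_affineEval (e : TotalSpace F E) :
    ∃ u : F', ∀ (V : Opens M), V ≤ U → e.proj ∈ V → ∀ f : O.Sec V,
      θ.val f e.proj = ExteriorAlgebra.algebraMapInv (m.hat V f e.proj) ∧
        θ.psi f e = affineEval u (m.hat V f e.proj) := by
  -- On constant linear forms, `ψ` at `e` is an element of the double dual, hence evaluation at a
  -- vector `u`, as `F'` is finite-dimensional.
  let L : Module.Dual ℝ (Module.Dual ℝ F') :=
    θ.psiHom e ∘ₗ (m.constHom le_rfl).toLinearMap ∘ₗ ExteriorAlgebra.ι ℝ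
  obtain ⟨u, hu⟩ := (Module.evalEquiv ℝ F').surjective L
  refine ⟨u, fun V hV hx f => ?_⟩
  have hl : ∀ l, θ.psi (m.constHom hV (ExteriorAlgebra.ι ℝ l)) e = l u := by
    intro l
    rw [← m.res_constHom le_rfl hV, θ.psi_res hV _ hx]
    exact (DFunLike.congr_fun hu l).symm
  have hsum : m.hat V f e.proj = ∑ i, (Module.finBasis ℝ (ExtAlg F')).coord i (m.hat V f e.proj) •
      Module.finBasis ℝ (ExtAlg F') i := ((Module.finBasis ℝ (ExtAlg F')).sum_repr _).symm
  have hf := m.eq_sum_funSec_mul_constHom hV f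
  constructor
  · conv_lhs => rw [hf, val, θ.psi_sum]
    conv_rhs => rw [hsum, map_sum]
    refine Finset.sum_congr rfl fun i _ => ?_
    refine (θ.val_mul _ _ hx).trans ?_
    rw [θ.val_funSec m hV _ hx, (θ.psi_constHom m hV hx hl _).1, map_smul, smul_eq_mul]
  · conv_lhs => rw [hf, θ.psi_sum]
    conv_rhs => rw [hsum, map_sum]
    refine Finset.sum_congr rfl fun i _ => ?_
    rw [θ.psi_even_mul (m.funSec_mem hV _) _ hx, θ.psi_even (m.funSec_mem hV _) hx,
      θ.val_funSec m hV _ hx, (θ.psi_constHom m hV hx hl _).2, map_smul, smul_eq_mul]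

end LocalModel

/-- The functions `ψ(f)` separate the points of the fibres of `E`. -/
theorem psi_ext {x : M} {v v' : E x}
    (h : ∀ (V : Opens M), x ∈ V → ∀ f : O.Sec V, θ.psi f ⟨x, v⟩ = θ.psi f ⟨x, v'⟩) : v = v' := by
  have hx := mem_splitOpen (n := n) F E x
  have hl : (trivializationAt F E x ⟨x, v⟩).2 = (trivializationAt F E x ⟨x, v'⟩).2 := by
    refine (Module.finBasis ℝ F).ext_elem fun a => ?_
    have := h _ hx ((θ.splitCoords x).c (Sum.inr a))
    rwa [(θ.isModelCoords_split x).psi_c _ _ hx, (θ.isModelCoords_split x).psi_c _ _ hx] at this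
  have hb := FiberBundle.mem_baseSet_trivializationAt' (F := F) (E := E) x
  have h1 := (trivializationAt F E x).symm_apply_apply_mk hb v
  rw [hl, (trivializationAt F E x).symm_apply_apply_mk hb v'] at h1
  exact h1.symm

theorem contMDiffAt_psi {V : Opens M} (f : O.Sec V) {e : TotalSpace F E} (he : e.proj ∈ V) :
    ContMDiffAt ((𝓡 n).prod 𝓘(ℝ, F)) 𝓘(ℝ) ∞ (θ.psi f) e := by
  let W := V ⊓ splitOpen (n := n) F E e.proj
  have hW : IsOpen ((TotalSpace.proj : TotalSpace F E → M) ⁻¹' (W : Set M)) :=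
    W.isOpen.preimage (FiberBundle.continuous_proj F E)
  have heW : e.proj ∈ W := ⟨he, mem_splitOpen F E e.proj⟩
  have h := ((θ.isModelCoords_split e.proj).smooth_psi (inf_le_right : W ≤ _)
    (O.res inf_le_left f)).contMDiffAt (hW.mem_nhds heW)
  refine h.congr_of_eventuallyEq ?_
  filter_upwards [hW.mem_nhds heW] with e' he'
  exact (θ.psi_res (inf_le_left : W ≤ V) f he').symm

variable {F₂ : Type*} [NormedAddCommGroup F₂] [NormedSpace ℝ F₂] [FiniteDimensional ℝ F₂]
  {E₂ : M → Type*} [∀ x, AddCommGroup (E₂ x)] [∀ x, Module ℝ (E₂ x)]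
  [∀ x, TopologicalSpace (E₂ x)] [TopologicalSpace (TotalSpace F₂ E₂)] [FiberBundle F₂ E₂]
  [VectorBundle ℝ F₂ E₂] [ContMDiffVectorBundle ∞ F₂ E₂ (𝓡 n)]
  (θ₂ : BatchelorModel (n := n) O F₂ E₂)

/-- Read the functional given by `u` in the local model of `θ₂`: it is the affine evaluation at a
vector of `F₂`, which the trivialization of `E₂` turns into `v`. -/
theorem exists_psi_eq_psi (x : M) (u : E x) : ∃ v : E₂ x, ∀ (V : Opens M), x ∈ V →
    ∀ f : O.Sec V, θ₂.val f x = θ.val f x ∧ θ₂.psi f ⟨x, v⟩ = θ.psi f ⟨x, u⟩ := by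
  have hx := mem_splitOpen (n := n) F₂ E₂ x
  have hs := splitOpen_subset_baseSet (n := n) (F := F₂) (E := E₂) x
  obtain ⟨w, hw⟩ := θ.exists_psi_eq_affineEval (θ₂.splitModel x) ⟨x, u⟩
  have hb := FiberBundle.mem_baseSet_trivializationAt' (F := F₂) (E := E₂) x
  refine ⟨(trivializationAt F₂ E₂ x).symm x w, fun V hV f => ?_⟩
  let W := V ⊓ splitOpen (n := n) F₂ E₂ x
  have hxW : x ∈ W := ⟨hV, hx⟩
  obtain ⟨h1, h2⟩ := hw W inf_le_right hxW (O.res inf_le_left f)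
  rw [← θ.psi_res (inf_le_left : W ≤ V) f (e := ⟨x, u⟩) hxW, h2,
    ← θ.val_res (inf_le_left : W ≤ V) f hxW, h1, ← θ₂.val_res (inf_le_left : W ≤ V) f hxW,
    ← θ₂.psi_res (inf_le_left : W ≤ V) f (e := ⟨x, _⟩) hxW,
    θ₂.psi_eq_affineEval_hat hs (inf_le_right : W ≤ _) _ (e := ⟨x, _⟩) hxW,
    (trivializationAt F₂ E₂ x).apply_mk_symm hb, θ₂.val_eq_hat hs _ hxW]
  exact ⟨rfl, rfl⟩

theorem psi_fibre_add {V : Opens M} (f : O.Sec V) {x : M} (hx : x ∈ V) (u v : E x) :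
    θ.psi f ⟨x, u + v⟩ = θ.psi f ⟨x, u⟩ + θ.psi f ⟨x, v⟩ - θ.val f x := by
  rw [θ.psi_eq_val_add f (e := ⟨x, u + v⟩) hx, θ.psi_eq_val_add f (e := ⟨x, u⟩) hx,
    θ.psi_eq_val_add f (e := ⟨x, v⟩) hx, map_add]
  ring

theorem psi_fibre_smul {V : Opens M} (f : O.Sec V) {x : M} (hx : x ∈ V) (r : ℝ) (u : E x) :
    θ.psi f ⟨x, r • u⟩ = r * θ.psi f ⟨x, u⟩ + (1 - r) * θ.val f x := by
  rw [θ.psi_eq_val_add f (e := ⟨x, r • u⟩) hx, θ.psi_eq_val_add f (e := ⟨x, u⟩) hx, map_smul,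
    smul_eq_mul]
  ring

/-- The degree `0` component of a section does not depend on the model. -/
theorem val_eq_val {V : Opens M} (f : O.Sec V) {x : M} (hx : x ∈ V) : θ₂.val f x = θ.val f x :=
  ((θ.exists_psi_eq_psi θ₂ x 0).choose_spec V hx f).1

/-- The map between the fibres of the bundles of two Batchelor models, as a function. -/
def fibreFun (x : M) (u : E x) : E₂ x := (θ.exists_psi_eq_psi θ₂ x u).choose

theorem psi_fibreFun {V : Opens M} (f : O.Sec V) {x : M} (hx : x ∈ V) (u : E x) :
    θ₂.psi f ⟨x, θ.fibreFun θ₂ x u⟩ = θ.psi f ⟨x, u⟩ :=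
  ((θ.exists_psi_eq_psi θ₂ x u).choose_spec V hx f).2

/-- The linear isomorphism between the fibres of the bundles of two Batchelor models. -/
def fibreEquiv (x : M) : E x ≃ₗ[ℝ] E₂ x where
  toFun := θ.fibreFun θ₂ x
  invFun := θ₂.fibreFun θ x
  -- The functions `ψ(f)` separate points of a fibre and are affine on fibres, with constant term
  -- `val f` in both models; so the map of fibres is linear.
  map_add' u v := θ₂.psi_ext fun V hx f => by
    rw [θ.psi_fibreFun θ₂ f hx, θ.psi_fibre_add f hx, θ₂.psi_fibre_add f hx,
      θ.psi_fibreFun θ₂ f hx, θ.psi_fibreFun θ₂ f hx, θ.val_eq_val θ₂ f hx]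
  map_smul' r u := θ₂.psi_ext fun V hx f => by
    rw [θ.psi_fibreFun θ₂ f hx, θ.psi_fibre_smul f hx, RingHom.id_apply, θ₂.psi_fibre_smul f hx,
      θ.psi_fibreFun θ₂ f hx, θ.val_eq_val θ₂ f hx]
  left_inv u := θ.psi_ext fun V hx f => by
    rw [θ₂.psi_fibreFun θ f hx, θ.psi_fibreFun θ₂ f hx]
  right_inv u := θ₂.psi_ext fun V hx f => by
    rw [θ.psi_fibreFun θ₂ f hx, θ₂.psi_fibreFun θ f hx]

/-- The bundle map between the bundles of two Batchelor models. -/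
def transitionFun (e : TotalSpace F E) : TotalSpace F₂ E₂ := ⟨e.proj, θ.fibreEquiv θ₂ e.proj e.2⟩

theorem psi_transitionFun {V : Opens M} (f : O.Sec V) {e : TotalSpace F E} (he : e.proj ∈ V) :
    θ₂.psi f (θ.transitionFun θ₂ e) = θ.psi f e :=
  θ.psi_fibreFun θ₂ f he e.2

/-- In a trivialization of `E₂` the fibre components of the map are the functions `ψ(c_a)` of the
first model, where the `c_a` are the odd coordinates of the second; these are smooth on `E`. -/
theorem contMDiff_transitionFun : ContMDiff ((𝓡 n).prod 𝓘(ℝ, F)) ((𝓡 n).prod 𝓘(ℝ, F₂)) ∞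
    (θ.transitionFun θ₂) := by
  intro e
  rw [Bundle.contMDiffAt_totalSpace]
  refine ⟨Bundle.contMDiffAt_proj E, ?_⟩
  have he := mem_splitOpen (n := n) F₂ E₂ e.proj
  have ho : IsOpen ((TotalSpace.proj : TotalSpace F E → M) ⁻¹'
      (splitOpen (n := n) F₂ E₂ e.proj : Set M)) :=
    (splitOpen (n := n) F₂ E₂ e.proj).isOpen.preimage (FiberBundle.continuous_proj F E)
  have hsmooth : ContMDiffAt ((𝓡 n).prod 𝓘(ℝ, F)) 𝓘(ℝ, F₂) ∞ (fun e' : TotalSpace F E =>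
      ∑ a, θ.psi ((θ₂.splitCoords e.proj).c (Sum.inr a)) e' • Module.finBasis ℝ F₂ a) e :=
    ContMDiffAt.sum fun a _ => (θ.contMDiffAt_psi _ he).smul contMDiffAt_const
  refine hsmooth.congr_of_eventuallyEq ?_
  filter_upwards [ho.mem_nhds he] with e' he'
  refine ((Module.finBasis ℝ F₂).sum_repr _).symm.trans (Finset.sum_congr rfl fun a _ => ?_)
  rw [← θ.psi_transitionFun θ₂ _ he', (θ₂.isModelCoords_split e.proj).psi_c _ (θ.transitionFun θ₂ e') he']
  rfl

/-- The isomorphism of vector bundles defined by two Batchelor models. -/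
def transition :
    TotalSpace F E ≃ₘ⟮(𝓡 n).prod 𝓘(ℝ, F), (𝓡 n).prod 𝓘(ℝ, F₂)⟯ TotalSpace F₂ E₂ where
  toFun := θ.transitionFun θ₂
  invFun := θ₂.transitionFun θ
  left_inv e := congrArg (TotalSpace.mk e.proj) ((θ.fibreEquiv θ₂ e.proj).symm_apply_apply e.2)
  right_inv e := congrArg (TotalSpace.mk e.proj) ((θ₂.fibreEquiv θ e.proj).symm_apply_apply e.2)
  contMDiff_toFun := θ.contMDiff_transitionFun θ₂
  contMDiff_invFun := θ₂.contMDiff_transitionFun θ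

theorem isBundleIso_transition : IsBundleIso (θ.transition θ₂) :=
  ⟨θ.fibreEquiv θ₂, fun _ => rfl⟩

end ModelIso
end Comparison

/-! ### Transport of coordinates and Christoffel connections along diffeomorphisms. -/

section Diffeomorph

variable {B B' G H H' N N' : Type*} [NormedAddCommGroup B] [NormedSpace ℝ B]
  [NormedAddCommGroup B'] [NormedSpace ℝ B'] [NormedAddCommGroup G] [NormedSpace ℝ G]
  [TopologicalSpace H] [TopologicalSpace H'] {I : ModelWithCorners ℝ B H}
  {J : ModelWithCorners ℝ B' H'} [TopologicalSpace N] [ChartedSpace H N] [IsManifold I ∞ N]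
  [TopologicalSpace N'] [ChartedSpace H' N'] [IsManifold J ∞ N'] (φ : N ≃ₘ⟮I, J⟯ N')

/-- The chain rule for functions with values in a normed space. -/
theorem mvfderiv_comp_mfderiv {z : N → G} {f : N' → N} {e : N'}
    (hz : MDifferentiableAt I 𝓘(ℝ, G) z (f e)) (hf : MDifferentiableAt J I f e) :
    mvfderiv J (z ∘ f) e = (mvfderiv I z (f e)).comp (mfderiv J I f e) :=
  mfderiv_comp e hz hf

theorem mvfderiv_comp_symm_apply {z : N → G} {e : N} (hz : MDifferentiableAt I 𝓘(ℝ, G) z e)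
    (v : TangentSpace I e) :
    mvfderiv J (z ∘ φ.symm) (φ e) (mfderiv I J φ e v) = mvfderiv I z e v := by
  have h1 : MDifferentiableAt J 𝓘(ℝ, G) (z ∘ φ.symm) (φ e) := by
    refine MDifferentiableAt.comp (I' := I) (φ e) ?_ (φ.symm.mdifferentiable (by simp) _)
    rwa [φ.symm_apply_apply]
  have h2 : (z ∘ φ.symm) ∘ φ = z := by
    funext x
    simp
  have h := mvfderiv_comp_mfderiv h1 (φ.mdifferentiable (by simp) e)
  rw [h2] at h
  exact congr($h.symm v)

theorem IsLocalCoordinate.comp_symm {z : N → G} {S : Set N} (hz : IsLocalCoordinate I z S) :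
    IsLocalCoordinate J (z ∘ φ.symm) (φ.symm ⁻¹' S) where
  isOpen := hz.isOpen.preimage φ.symm.continuous
  smooth := hz.smooth.comp φ.symm.contMDiff.contMDiffOn fun _ h => h
  inv e he := by
    obtain ⟨A, hA⟩ := hz.inv (φ.symm e) he
    refine ⟨(φ.symm.mfderivToContinuousLinearEquiv (by simp) e).trans A, ?_⟩
    have h := mvfderiv_comp_mfderiv ((hz.smoothAt he).mdifferentiableAt (by simp))
      (φ.symm.mdifferentiable (by simp) e)
    rw [← hA] at h
    exact h.symm

/-- The connection given by Christoffel symbols is compatible with diffeomorphisms. -/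
theorem IsLocalCoordinate.mfderiv_christoffelCov {z : N → G} {S : Set N}
    (hz : IsLocalCoordinate I z S) {Γ : N → G →L[ℝ] G →L[ℝ] G} {Γ' : N' → G →L[ℝ] G →L[ℝ] G}
    {e : N} (he : e ∈ S) (hΓ : Γ' (φ e) = Γ e) {Y : (e : N) → TangentSpace I e}
    {Y' : (e : N') → TangentSpace J e} (hYY' : ∀ e, Y' (φ e) = mfderiv I J φ e (Y e))
    (hY : MDifferentiableAt I I.tangent (fun e => (⟨e, Y e⟩ : TangentBundle I N)) e)
    (v : TangentSpace I e) :
    mfderiv I J φ e (christoffelCov I z Γ Y e v) =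
      christoffelCov J (z ∘ φ.symm) Γ' Y' (φ e) (mfderiv I J φ e v) := by
  have hz' := hz.comp_symm φ
  have he' : φ e ∈ φ.symm ⁻¹' S := by simpa using he
  have hd := (hz.smoothAt he).mdifferentiableAt (by simp : (∞ : WithTop ℕ∞) ≠ 0)
  refine hz'.injective he' ?_
  -- In the coordinates `z` and `z ∘ φ⁻¹`, a vector and its image have the same components; only the
  -- derivative terms remain to be compared.
  rw [hz'.mvfderiv_christoffelCov he', hYY', mvfderiv_comp_symm_apply φ hd,
    mvfderiv_comp_symm_apply φ hd, mvfderiv_comp_symm_apply φ hd, hz.mvfderiv_christoffelCov he, hΓ]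
  congr 1
  have h := mdifferentiableAt_mvfderiv_apply (hz.smoothAt he) hY
  rw [← mvfderiv_comp_symm_apply φ h]
  refine congr($(mvfderiv_congr ?_) _)
  filter_upwards [hz'.isOpen.mem_nhds he'] with p hp
  have hp' := (hz.smoothAt hp).mdifferentiableAt (by simp : (∞ : WithTop ℕ∞) ≠ 0)
  obtain ⟨q, rfl⟩ : ∃ q, φ q = p := φ.surjective p
  rw [hYY', mvfderiv_comp_symm_apply φ (by simpa using hp')]
  exact congrArg (fun q => mvfderiv I z q (Y q)) (φ.symm_apply_apply q)

/-- The image of a differentiable vector field under a diffeomorphism is differentiable where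
there are local coordinates. -/
theorem IsLocalCoordinate.mdifferentiableAt_pushforward [FiniteDimensional ℝ B']
    {z : N → G} {S : Set N} (hz : IsLocalCoordinate I z S) {e : N} (he : e ∈ S)
    {Y : (e : N) → TangentSpace I e}
    {Y' : (e : N') → TangentSpace J e} (hYY' : ∀ e, Y' (φ e) = mfderiv I J φ e (Y e))
    (hY : MDifferentiableAt I I.tangent (fun e => (⟨e, Y e⟩ : TangentBundle I N)) e) :
    MDifferentiableAt J J.tangent (fun e => (⟨e, Y' e⟩ : TangentBundle J N')) (φ e) := by
  have hz' := hz.comp_symm φ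
  have he' : φ e ∈ φ.symm ⁻¹' S := by simpa using he
  have h := mdifferentiableAt_mvfderiv_apply (hz.smoothAt he) hY
  have h2 : MDifferentiableAt J 𝓘(ℝ, G) ((fun e => mvfderiv I z e (Y e)) ∘ φ.symm) (φ e) := by
    refine MDifferentiableAt.comp (I' := I) (φ e) ?_ (φ.symm.mdifferentiable (by simp) _)
    rwa [φ.symm_apply_apply]
  refine (hz'.mdifferentiableAt_inverse_apply he' h2).congr_of_eventuallyEq ?_
  filter_upwards [hz'.isOpen.mem_nhds he'] with p hp
  have hp' := (hz.smoothAt hp).mdifferentiableAt (by simp : (∞ : WithTop ℕ∞) ≠ 0)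
  obtain ⟨q, rfl⟩ : ∃ q, φ q = p := φ.surjective p
  congr 1
  refine hz'.injective hp ?_
  rw [hz'.apply_inverse hp, hYY', mvfderiv_comp_symm_apply φ (by simpa using hp')]
  exact (congrArg (fun q => mvfderiv I z q (Y q)) (φ.symm_apply_apply q)).symm

end Diffeomorph

/-! ### The transition isomorphism preserves the reduced connections. -/

section Independence

variable {n : ℕ} {M : Type u} [TopologicalSpace M] [ChartedSpace (EuclideanSpace ℝ (Fin n)) M]
  [IsManifold (𝓡 n) ∞ M]
  {F : Type*} [NormedAddCommGroup F] [NormedSpace ℝ F] [FiniteDimensional ℝ F]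
  {E : M → Type*} [∀ x, AddCommGroup (E x)] [∀ x, Module ℝ (E x)] [∀ x, TopologicalSpace (E x)]
  [TopologicalSpace (TotalSpace F E)] [FiberBundle F E] [VectorBundle ℝ F E]
  [ContMDiffVectorBundle ∞ F E (𝓡 n)]
  {F₂ : Type*} [NormedAddCommGroup F₂] [NormedSpace ℝ F₂] [FiniteDimensional ℝ F₂]
  {E₂ : M → Type*} [∀ x, AddCommGroup (E₂ x)] [∀ x, Module ℝ (E₂ x)]
  [∀ x, TopologicalSpace (E₂ x)] [TopologicalSpace (TotalSpace F₂ E₂)] [FiberBundle F₂ E₂]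
  [VectorBundle ℝ F₂ E₂] [ContMDiffVectorBundle ∞ F₂ E₂ (𝓡 n)]
  {O : SuperalgebraSheaf.{u, w} M} {D : O.Connection}

namespace ModelIso

variable (θ : BatchelorModel (n := n) O F E) (θ₂ : BatchelorModel (n := n) O F₂ E₂)

theorem psi_eq_psi_transition_symm {V : Opens M} (f : O.Sec V) (e : TotalSpace F₂ E₂) :
    θ₂.psi f e = θ.psi f ((θ.transition θ₂).symm e) := by
  by_cases he : e.proj ∈ V
  · exact (θ₂.psi_transitionFun θ f he).symm
  -- Outside the preimage of `V` both functions have the default value `0`.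
  · have he' : ((θ.transition θ₂).symm e).proj ∉ V := he
    rw [psi, psi, affineFun, affineFun, dif_neg he, dif_neg he']

theorem psiDir_eq_psiDir_transition_symm (p : ZMod 2) {V : Opens M} (f : O.Sec V)
    {e : TotalSpace F₂ E₂} (he : e.proj ∈ V) :
    θ₂.psiDir p f e = θ.psiDir p f ((θ.transition θ₂).symm e) := by
  unfold psiDir
  rw [θ.psi_eq_psi_transition_symm θ₂, θ.val_eq_val θ₂ f he]
  rfl

variable {U : Opens M} {ι : Type} [Fintype ι] [DecidableEq ι] {S : SuperCoords O U ι}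

/-- The reduced symbols are built from `ψ` and `val` of the Christoffel symbols of `D`, and the
transition map intertwines both. -/
theorem redGamma_eq_redGamma_transition_symm {e : TotalSpace F₂ E₂} (he : e.proj ∈ U) :
    θ₂.redGamma S D e = θ.redGamma S D ((θ.transition θ₂).symm e) := by
  unfold redGamma redChristoffel
  simp only [θ.psiDir_eq_psiDir_transition_symm θ₂ _ _ he, θ.val_eq_val θ₂ _ he]
  rfl

variable {θ}

/-- The supercoordinates stay the same and only the model changes. This is possible because
`IsModelCoords` does not require the coordinates to be affine in the model. -/
theorem IsModelCoords.transition {z : TotalSpace F E → ι → ℝ} (hz : θ.IsModelCoords S z) :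
    θ₂.IsModelCoords S (z ∘ (θ.transition θ₂).symm) where
  isLocalCoordinate := hz.isLocalCoordinate.comp_symm (θ.transition θ₂)
  psi_c k e he := by
    rw [θ.psi_eq_psi_transition_symm θ₂]
    exact hz.psi_c k _ he
  smooth_psi hV f e he := (θ₂.contMDiffAt_psi f he).contMDiffWithinAt
  mvfderiv_psi {V} hV f e he v := by
    have he' : ((θ.transition θ₂).symm e).proj ∈ V := he
    have h : θ₂.psi f = θ.psi f ∘ (θ.transition θ₂).symm :=
      funext (θ.psi_eq_psi_transition_symm θ₂ f)
    have hd := (θ.transition θ₂).symm.mdifferentiable (by simp) e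
    rw [h, mvfderiv_comp_apply e ((θ.contMDiffAt_psi f he').mdifferentiableAt (by simp)) hd,
      hz.mvfderiv_psi hV f _ he']
    refine Finset.sum_congr rfl fun k _ => ?_
    rw [θ.psiDir_eq_psiDir_transition_symm θ₂ _ _ he]
    congr 1
    have hzd := (hz.isLocalCoordinate.smoothAt (hV he')).mdifferentiableAt
      (by simp : (∞ : WithTop ℕ∞) ≠ 0)
    exact congrFun congr($(mvfderiv_comp_mfderiv hzd hd) v).symm k

/-- By coordinate independence, the connection on `E₂` may be computed in the coordinates
transported from `E`. There the two connections have the same Christoffel symbols. -/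
theorem preservesConnection_transition [T2Space M] {θ₂ : BatchelorModel (n := n) O F₂ E₂}
    {C : AffineConnection n F E} {C₂ : AffineConnection n F₂ E₂} (hC : IsReduced θ D C)
    (hC₂ : IsReduced θ₂ D C₂) : PreservesConnection (θ.transition θ₂) C C₂ := by
  intro Y Y₂ hYY₂ e hY v
  have hz := θ.isModelCoords_split e.proj
  have he := mem_splitOpen (n := n) F E e.proj
  have hY₂ := hz.isLocalCoordinate.mdifferentiableAt_pushforward (θ.transition θ₂) he hYY₂ hY
  rw [eq_splitCov_of_isReduced hC e.proj he hY,
    eq_splitCov_of_isReduced hC₂ e.proj (e := θ.transition θ₂ e) (mem_splitOpen F₂ E₂ e.proj) hY₂,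
    θ₂.splitCov_eq (hz.transition θ₂) e.proj (e := θ.transition θ₂ e) he
      (mem_splitOpen F₂ E₂ e.proj) hY₂]
  refine hz.isLocalCoordinate.mfderiv_christoffelCov (θ.transition θ₂) he ?_ hYY₂ hY v
  rw [θ.redGamma_eq_redGamma_transition_symm θ₂ (e := θ.transition θ₂ e) he,
    Diffeomorph.symm_apply_apply]

end ModelIso
end Independence

end Supergeometry

end

theorem corollary3p13 {n q : ℕ} {M : Type*} [TopologicalSpace M] [T2Space M]
    [SecondCountableTopology M] [ChartedSpace (EuclideanSpace ℝ (Fin n)) M]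
    [IsManifold (𝓡 n) ∞ M]
    -- the supermanifold with connection
    (𝓜 : Supergeometry.Supermanifold n q M) (D : 𝓜.Connection)
    -- two vector bundles over `M`
    {F₁ : Type*} [NormedAddCommGroup F₁] [NormedSpace ℝ F₁] [FiniteDimensional ℝ F₁]
    {E₁ : M → Type*} [∀ x, AddCommGroup (E₁ x)] [∀ x, Module ℝ (E₁ x)]
    [∀ x, TopologicalSpace (E₁ x)] [TopologicalSpace (TotalSpace F₁ E₁)] [FiberBundle F₁ E₁]
    [VectorBundle ℝ F₁ E₁] [ContMDiffVectorBundle ∞ F₁ E₁ (𝓡 n)]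
    {F₂ : Type*} [NormedAddCommGroup F₂] [NormedSpace ℝ F₂] [FiniteDimensional ℝ F₂]
    {E₂ : M → Type*} [∀ x, AddCommGroup (E₂ x)] [∀ x, Module ℝ (E₂ x)]
    [∀ x, TopologicalSpace (E₂ x)] [TopologicalSpace (TotalSpace F₂ E₂)] [FiberBundle F₂ E₂]
    [VectorBundle ℝ F₂ E₂] [ContMDiffVectorBundle ∞ F₂ E₂ (𝓡 n)]
    -- two Batchelor models
    (θ₁ : Supergeometry.BatchelorModel (n := n) 𝓜.toSuperalgebraSheaf F₁ E₁)
    (θ₂ : Supergeometry.BatchelorModel (n := n) 𝓜.toSuperalgebraSheaf F₂ E₂) :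
    -- a Batchelor model determines a unique reduced connection on the total space
    ((∃ C : Supergeometry.AffineConnection n F₁ E₁, Supergeometry.IsReduced θ₁ D C) ∧
      ∀ C C' : Supergeometry.AffineConnection n F₁ E₁,
        Supergeometry.IsReduced θ₁ D C → Supergeometry.IsReduced θ₁ D C' →
          Supergeometry.SameConnection C C') ∧
    -- up to a bundle isomorphism, the reduction does not depend on the Batchelor model
    (∀ (C₁ : Supergeometry.AffineConnection n F₁ E₁)
      (C₂ : Supergeometry.AffineConnection n F₂ E₂),
        Supergeometry.IsReduced θ₁ D C₁ → Supergeometry.IsReduced θ₂ D C₂ →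
          ∃ φ : TotalSpace F₁ E₁
              ≃ₘ⟮(𝓡 n).prod 𝓘(ℝ, F₁), (𝓡 n).prod 𝓘(ℝ, F₂)⟯ TotalSpace F₂ E₂,
            Supergeometry.IsBundleIso φ ∧ Supergeometry.PreservesConnection φ C₁ C₂) := by
  refine ⟨⟨⟨θ₁.reducedConnection D, Supergeometry.ModelIso.isReduced_reducedConnection⟩,
    fun C C' h h' => Supergeometry.ModelIso.sameConnection_of_isReduced h h'⟩, fun C₁ C₂ h₁ h₂ => ?_⟩
  exact ⟨θ₁.transition θ₂, θ₁.isBundleIso_transition θ₂,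
    Supergeometry.ModelIso.preservesConnection_transition h₁ h₂⟩
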